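/- A permutation group $G$ on a finite set $\Omega$ is sharply $k$-transitive if for any two $k$-tuples of pairwise distinct points of $\Omega$ there is exactly one element of $G$ that maps the first tuple to the second. Put $\alpha=\sqrt{-2}=i\sqrt2$ and $\omega=\frac12(-1+\sqrt{-11})=\frac12(-1+i\sqrt{11})$. In the tables below the columns correspond to the conjugacy classes of $G$, each headed by the common cycle type of its elements (fixed points omitted, except for the identity class $1^{n}$; letters $A,B$ distinguish different classes with the same cycle type), and the rows correspond to the irreducible complex characters of $G$. That such a table is the character table of $G$ means that the conjugacy classes of $G$ and the irreducible complex characters of $G$ can be listed, each exactly once, in such a way that the elements of each class have the cycle type at the head of its column and the entries of the table are the character values. (1) If $G$ is a sharply $5$-transitive subgroup of $\mathrm{Alt}(12)$, acting on $12$ points, then $G$ has exactly $15$ conjugacy classes, and its character table is \[\begin{array}{c|ccccccccccccccc} & 1^{12} & 2^4 & 2^6 & 3^3 & 3^4 & 4^2 & 2^24^2 & 5^2 & 2^13^16^1 & 6^2 & 2^18^1 & 4^18^1 & 2^110^1 & 11^1_A & 11^1_B\\ \hline \chi_{0} & 1 & 1 & 1 & 1 & 1 & 1 & 1 & 1 &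 1 & 1 & 1 & 1 & 1 & 1 & 1\\ \chi_{1} & 11 & 3 & -1 & 2 & -1 & 3 & -1 & 1 & 0 & -1 & 1 & -1 & -1 & 0 & 0\\ \chi_{2} & 11 & 3 & -1 & 2 & -1 & -1 & 3 & 1 & 0 & -1 & -1 & 1 & -1 & 0 & 0\\ \chi_{3} & 16 & 0 & 4 & -2 & 1 & 0 & 0 & 1 & 0 & 1 & 0 & 0 & -1 & \omega & \overline{\omega}\\ \chi_{4} & 16 & 0 & 4 & -2 & 1 & 0 & 0 & 1 & 0 & 1 & 0 & 0 & -1 & \overline{\omega} & \omega\\ \chi_{5} & 45 & -3 & 5 & 0 & 3 & 1 & 1 & 0 & 0 & -1 & -1 & -1 & 0 & 1 & 1\\ \chi_{6} & 54 & 6 & 6 & 0 & 0 & 2 & 2 & -1 & 0 & 0 & 0 & 0 & 1 & -1 & -1\\ \chi_{7} & 55 & 7 & -5 & 1 & 1 & -1 & -1 & 0 & 1 & 1 & -1 & -1 & 0 & 0 & 0\\ \chi_{8} & 55 & -1 & -5 & 1 & 1 & 3 & -1 & 0 & -1 & 1 & -1 & 1 & 0 & 0 & 0\\ \chi_{9}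 & 55 & -1 & -5 & 1 & 1 & -1 & 3 & 0 & -1 & 1 & 1 & -1 & 0 & 0 & 0\\ \chi_{10} & 66 & 2 & 6 & 3 & 0 & -2 & -2 & 1 & -1 & 0 & 0 & 0 & 1 & 0 & 0\\ \chi_{11} & 99 & 3 & -1 & 0 & 3 & -1 & -1 & -1 & 0 & -1 & 1 & 1 & -1 & 0 & 0\\ \chi_{12} & 120 & -8 & 0 & 3 & 0 & 0 & 0 & 0 & 1 & 0 & 0 & 0 & 0 & -1 & -1\\ \chi_{13} & 144 & 0 & 4 & 0 & -3 & 0 & 0 & -1 & 0 & 1 & 0 & 0 & -1 & 1 & 1\\ \chi_{14} & 176 & 0 & -4 & -4 & -1 & 0 & 0 & 1 & 0 & -1 & 0 & 0 & 1 & 0 & 0 \end{array}\] (2) If $G$ is a sharply $4$-transitive subgroup of $\mathrm{Alt}(11)$, acting on $11$ points, then $G$ has exactly $10$ conjugacy classes, and its character table is \[\begin{array}{c|cccccccccc} & 1^{11} & 2^4 & 3^3 & 4^2 & 5^2 & 2^13^16^1 & 2^18^1_A & 2^18^1_B & 11^1_A & 11^1_B\\ \hline \chi_{0} & 1 & 1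 & 1 & 1 & 1 & 1 & 1 & 1 & 1 & 1\\ \chi_{1} & 10 & 2 & 1 & 2 & 0 & -1 & 0 & 0 & -1 & -1\\ \chi_{2} & 10 & -2 & 1 & 0 & 0 & 1 & \alpha & \overline{\alpha} & -1 & -1\\ \chi_{3} & 10 & -2 & 1 & 0 & 0 & 1 & \overline{\alpha} & \alpha & -1 & -1\\ \chi_{4} & 11 & 3 & 2 & -1 & 1 & 0 & -1 & -1 & 0 & 0\\ \chi_{5} & 16 & 0 & -2 & 0 & 1 & 0 & 0 & 0 & \omega & \overline{\omega}\\ \chi_{6} & 16 & 0 & -2 & 0 & 1 & 0 & 0 & 0 & \overline{\omega} & \omega\\ \chi_{7} & 44 & 4 & -1 & 0 & -1 & 1 & 0 & 0 & 0 & 0\\ \chi_{8} & 45 & -3 & 0 & 1 & 0 & 0 & -1 & -1 & 1 & 1\\ \chi_{9} & 55 & -1 & 1 & -1 & 0 & -1 & 1 & 1 & 0 & 0 \end{array}\] -/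

import Mathlib

open Equiv CategoryTheory
open scoped ComplexConjugate

/-- The action of `G` on `Ω` is sharply `k`-transitive: for any two `k`-tuples of pairwise distinct
points there is exactly one element of `G` that maps the first to the second. -/
def IsSharplyTransitive (G Ω : Type*) [Group G] [MulAction G Ω] (k : ℕ) : Prop :=
  ∀ x y : Fin k ↪ Ω, ∃! g : G, ∀ i, g • x i = y i

/-- `χ` is the character of an irreducible complex (finite-dimensional) representation of `G`. -/
def IsIrreducibleCharacter {G : Type*} [Group G] (χ : G → ℂ) : Prop :=
  ∃ V : FDRep ℂ G, Simple V ∧ V.character = χ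

/-- The permutation group `G` has the `n × n` character table `X` whose columns are headed by the
cycle types `T`: the conjugacy classes of `G` can be listed without repetition as `c 0, …, c (n-1)`,
and the irreducible complex characters of `G` as `χ 0, …, χ (n-1)`, such that every element of `c j`
has cycle type `T j` (fixed points omitted) and every `χ i` takes the value `X i j` on `c j`. -/
def HasCharacterTable {d n : ℕ} (G : Subgroup (Perm (Fin d))) (T : Fin n → Multiset ℕ)
    (X : Matrix (Fin n) (Fin n) ℂ) : Prop :=
  ∃ (c : Fin n ≃ ConjClasses G) (χ : Fin n ≃ {f : G → ℂ // IsIrreducibleCharacter f}),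
    ∀ (j : Fin n) (g : G), ConjClasses.mk g = c j →
      (g : Perm (Fin d)).cycleType = T j ∧ ∀ i, (χ i).1 g = X i j

/-- `√-2`. -/
noncomputable def alpha2 : ℂ := Complex.I * (Real.sqrt 2 : ℝ)

/-- `(-1 + √-11) / 2`. -/
noncomputable def omega11 : ℂ := (-1 + Complex.I * (Real.sqrt 11 : ℝ)) / 2

/-- Cycle types of the conjugacy classes heading the columns of `table12`. -/
def cycleTypes12 : Fin 15 → Multiset ℕ :=
  ![0, {2, 2, 2, 2}, {2, 2, 2, 2, 2, 2}, {3, 3, 3}, {3, 3, 3, 3}, {4, 4}, {2, 2, 4, 4}, {5, 5},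
    {2, 3, 6}, {6, 6}, {2, 8}, {4, 8}, {2, 10}, {11}, {11}]

/-- The character table in degree 12. -/
noncomputable def table12 : Matrix (Fin 15) (Fin 15) ℂ :=
  !![1, 1, 1, 1, 1, 1, 1, 1, 1, 1, 1, 1, 1, 1, 1;
    11, 3, -1, 2, -1, 3, -1, 1, 0, -1, 1, -1, -1, 0, 0;
    11, 3, -1, 2, -1, -1, 3, 1, 0, -1, -1, 1, -1, 0, 0;
    16, 0, 4, -2, 1, 0, 0, 1, 0, 1, 0, 0, -1, omega11, conj omega11;
    16, 0, 4, -2, 1, 0, 0, 1, 0, 1, 0, 0, -1, conj omega11, omega11;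
    45, -3, 5, 0, 3, 1, 1, 0, 0, -1, -1, -1, 0, 1, 1;
    54, 6, 6, 0, 0, 2, 2, -1, 0, 0, 0, 0, 1, -1, -1;
    55, 7, -5, 1, 1, -1, -1, 0, 1, 1, -1, -1, 0, 0, 0;
    55, -1, -5, 1, 1, 3, -1, 0, -1, 1, -1, 1, 0, 0, 0;
    55, -1, -5, 1, 1, -1, 3, 0, -1, 1, 1, -1, 0, 0, 0;
    66, 2, 6, 3, 0, -2, -2, 1, -1, 0, 0, 0, 1, 0, 0;
    99, 3, -1, 0, 3, -1, -1, -1, 0, -1, 1, 1, -1, 0, 0;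
    120, -8, 0, 3, 0, 0, 0, 0, 1, 0, 0, 0, 0, -1, -1;
    144, 0, 4, 0, -3, 0, 0, -1, 0, 1, 0, 0, -1, 1, 1;
    176, 0, -4, -4, -1, 0, 0, 1, 0, -1, 0, 0, 1, 0, 0]

/-- Cycle types of the conjugacy classes heading the columns of `table11`. -/
def cycleTypes11 : Fin 10 → Multiset ℕ :=
  ![0, {2, 2, 2, 2}, {3, 3, 3}, {4, 4}, {5, 5}, {2, 3, 6}, {2, 8}, {2, 8}, {11}, {11}]

/-- The character table in degree 11. -/
noncomputable def table11 : Matrix (Fin 10) (Fin 10) ℂ :=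
  !![1, 1, 1, 1, 1, 1, 1, 1, 1, 1;
    10, 2, 1, 2, 0, -1, 0, 0, -1, -1;
    10, -2, 1, 0, 0, 1, alpha2, conj alpha2, -1, -1;
    10, -2, 1, 0, 0, 1, conj alpha2, alpha2, -1, -1;
    11, 3, 2, -1, 1, 0, -1, -1, 0, 0;
    16, 0, -2, 0, 1, 0, 0, 0, omega11, conj omega11;
    16, 0, -2, 0, 1, 0, 0, 0, conj omega11, omega11;
    44, 4, -1, 0, -1, 1, 0, 0, 0, 0;
    45, -3, 0, 1, 0, 0, -1, -1, 1, 1;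
    55, -1, 1, -1, 0, -1, 1, 1, 0, 0]

/-! Sharp transitivity fixes the order of G and makes the identity the only element with k fixed
points. Together with evenness this leaves few possible cycle types (`exists_admissibleType`).
Colourings in which at most k points get a non-default colour form one G-orbit, so Burnside's lemma
gives linear equations for the number of elements of each type. In degree 12 two more colouring
counts, known only to be multiples of the group order, complete the system (`typeCard11_of_sum_eq`,
`typeCard12_of_sum_eq`). Scalar products of functions of the cycle type can then be computed before
the conjugacy classes are known.

The numbers of fixed colourings are permutation characters that depend on the cycle type only, so
their integral combinations are virtual characters. One of norm one and positive degree is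
irreducible. This yields the rational rows of the tables, and as virtual characters of norm two the
sums of the pairs of irrational rows. In degree 12 one row of degree 55 is obtained through a
lattice argument instead: four norm-two vectors with mutual products one share a signed unit vector
(`exists_eq_single_of_star`), and the other rows are corrected by multiples of that row. Each
norm-two function is a signed sum of two irreducible characters; since squared degrees add up to the
group order, the two have equal degrees and the list is complete. The number of classes follows.

Elements of order 11, and those of order 8 in degree 11, are not conjugate to their inverses: an
inverting element could be adjusted to an involution with an impossible fixed-point set. Counting
classes, each of these types is a class together with the class of inverses, and every other type is
a single class. The difference of the two characters of a pair is orthogonal to all rows, hence sums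
to zero over each type. So it is odd under inversion and lives on the non-real types. In degree 12
its norm gives the square -11. In degree 11 there are two differences and two non-real types;
integrality of the norm of a restriction to cyclic subgroups of orders 8 and 11 decides which
difference lives where (`differences_values`). Replacing a representative by its inverse fixes the
sign of each root. -/

namespace Representation

/-! ### Decomposition of representations and permutation characters -/

variable {G : Type} [Group G]

theorem Subrepresentation.toRepresentation_coe {V : Type} [AddCommGroup V] [Module ℂ V]
    {ρ : Representation ℂ G V} (W : Subrepresentation ρ) (g : G) (v : W.toSubmodule) :
    (W.toRepresentation g v : V) = ρ g v := rfl

theorem isCompl_toSubmodule {V : Type} [AddCommGroup V] [Module ℂ V]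
    {ρ : Representation ℂ G V} {W W' : Subrepresentation ρ} (h : IsCompl W W') :
    IsCompl W.toSubmodule W'.toSubmodule := by
  constructor
  · rw [disjoint_iff]
    have := congrArg Subrepresentation.toSubmodule (disjoint_iff.1 h.disjoint)
    exact this
  · rw [codisjoint_iff]
    have := congrArg Subrepresentation.toSubmodule (codisjoint_iff.1 h.codisjoint)
    exact this

/-- To prove a property of all finite-dimensional complex representations of a finite group it
suffices to treat the zero representation, irreducible representations, and direct sums. -/
theorem decomposition_induction [Finite G]
    {P : ∀ (V : Type) [AddCommGroup V] [Module ℂ V], Representation ℂ G V → Prop}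
    (zero : ∀ (V : Type) [AddCommGroup V] [Module ℂ V] (ρ : Representation ℂ G V),
      Subsingleton V → P V ρ)
    (irred : ∀ (V : Type) [AddCommGroup V] [Module ℂ V] [FiniteDimensional ℂ V]
      (ρ : Representation ℂ G V), IsIrreducible ρ → P V ρ)
    (add : ∀ (V : Type) [AddCommGroup V] [Module ℂ V] [FiniteDimensional ℂ V]
      (ρ : Representation ℂ G V) (W W' : Subrepresentation ρ), IsCompl W W' →
        P W.toSubmodule W.toRepresentation → P W'.toSubmodule W'.toRepresentation → P V ρ)
    (V : Type) [AddCommGroup V] [Module ℂ V] [FiniteDimensional ℂ V] (ρ : Representation ℂ G V) :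
    P V ρ := by
  generalize hn : Module.finrank ℂ V = n
  induction n using Nat.strong_induction_on generalizing V with
  | _ n ih =>
    subst hn
    by_cases hs : Subsingleton V
    · exact zero V ρ hs
    by_cases hi : IsIrreducible ρ
    · exact irred V ρ hi
    rw [not_subsingleton_iff_nontrivial] at hs
    have hnt : Nontrivial (Subrepresentation ρ) := by
      refine ⟨⊥, ⊤, fun h => ?_⟩
      have : (⊥ : Submodule ℂ V) = ⊤ := congrArg Subrepresentation.toSubmodule h
      exact bot_ne_top this
    obtain ⟨W, hW0, hW1⟩ : ∃ W : Subrepresentation ρ, W ≠ ⊥ ∧ W ≠ ⊤ := by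
      by_contra! hcon
      exact hi { eq_bot_or_eq_top := fun W => or_iff_not_imp_left.2 (hcon W) }
    have : NeZero (Nat.card G : ℂ) := ⟨by exact_mod_cast Nat.card_pos.ne'⟩
    obtain ⟨W', hc⟩ := exists_isCompl W
    have hcs := isCompl_toSubmodule hc
    have hlt : ∀ U : Subrepresentation ρ, U ≠ ⊤ →
        Module.finrank ℂ U.toSubmodule < Module.finrank ℂ V := fun U hU =>
      Submodule.finrank_lt (fun h => hU (Subrepresentation.toSubmodule_injective h))
    refine add V ρ W W' hc (ih _ (hlt W hW1) _ _ rfl) (ih _ (hlt W' ?_) _ _ rfl)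
    rintro rfl
    exact hW0 (by simpa using hc.disjoint.eq_bot)

theorem character_eq_add_of_isCompl {V : Type} [AddCommGroup V] [Module ℂ V] [FiniteDimensional ℂ V]
    {ρ : Representation ℂ G V} {W W' : Subrepresentation ρ} (h : IsCompl W W') (g : G) :
    ρ.character g = W.toRepresentation.character g + W'.toRepresentation.character g := by
  have hc := isCompl_toSubmodule h
  let e := Submodule.prodEquivOfIsCompl _ _ hc
  have : ρ g = e.conj ((W.toRepresentation g).prodMap (W'.toRepresentation g)) := by
    ext v
    obtain ⟨p, rfl⟩ := e.surjective v
    simp [e, LinearEquiv.conj_apply, Subrepresentation.toRepresentation_coe]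
  unfold character
  rw [this, LinearMap.trace_conj', LinearMap.trace_prodMap']

/-- The permutation representation on functions `X → ℂ`. -/
def perm (G X : Type) [Group G] [MulAction G X] : Representation ℂ G (X → ℂ) where
  toFun g := LinearMap.funLeft ℂ ℂ (g⁻¹ • · : X → X)
  map_one' := by ext; simp
  map_mul' g h := by ext; simp [LinearMap.funLeft_apply, mul_smul]

theorem perm_apply (X : Type) [MulAction G X] (g : G) (f : X → ℂ) (x : X) :
    perm G X g f x = f (g⁻¹ • x) := rfl

theorem character_perm (X : Type) [Fintype X] [MulAction G X] (g : G) :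
    (perm G X).character g = Nat.card (MulAction.fixedBy X g) := by
  classical
  unfold character
  rw [LinearMap.trace_eq_matrix_trace ℂ (Pi.basisFun ℂ X), Matrix.trace]
  simp only [Matrix.diag_apply, LinearMap.toMatrix_apply, Pi.basisFun_apply, Pi.basisFun_repr,
    perm_apply, Pi.single_apply]
  rw [Finset.sum_boole, Nat.card_eq_fintype_card, Fintype.card_subtype]
  congr 2
  ext x
  simp only [Finset.mem_filter, Finset.mem_univ, true_and, MulAction.mem_fixedBy]
  rw [inv_smul_eq_iff, eq_comm]

end Representation

/-! ### Irreducible characters: orthonormality, completeness and degrees -/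

/-- The irreducible complex characters of `G`. -/
abbrev Irr (G : Type) [Group G] := {f : G → ℂ // IsIrreducibleCharacter f}

/-- The bilinear form `|G|⁻¹ ∑ g, f g * h g⁻¹` on complex functions on a finite group. -/
noncomputable def charInner {G : Type} [Group G] [Fintype G] (f h : G → ℂ) : ℂ :=
  (Nat.card G : ℂ)⁻¹ * ∑ g, f g * h g⁻¹

section Irr

variable {G : Type} [Group G]

theorem isIrreducibleCharacter_of_isIrreducible [Finite G] {V : Type} [AddCommGroup V]
    [Module ℂ V] [FiniteDimensional ℂ V] (ρ : Representation ℂ G V) (h : ρ.IsIrreducible) :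
    IsIrreducibleCharacter ρ.character := by
  classical
  cases nonempty_fintype G
  have : Invertible (Nat.card G : ℂ) :=
    invertibleOfNonzero (by exact_mod_cast Nat.card_pos.ne')
  refine ⟨FDRep.of ρ, ?_, rfl⟩
  rw [FDRep.simple_iff_char_is_norm_one]
  have := Representation.char_orthonormal ρ ρ
  rw [if_pos ⟨Representation.Equiv.refl ρ⟩] at this
  have h2 : (Nat.card G : ℂ) ≠ 0 := by exact_mod_cast Nat.card_pos.ne'
  field_simp at this
  exact this

theorem Irr.conj_apply (χ : Irr G) (g h : G) : χ.1 (h * g * h⁻¹) = χ.1 g := by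
  obtain ⟨χ, V, hV, rfl⟩ := χ
  exact V.char_conj g h

theorem Irr.apply_eq_of_isConj (χ : Irr G) {g h : G} (hgh : IsConj g h) : χ.1 g = χ.1 h := by
  obtain ⟨c, rfl⟩ := isConj_iff.1 hgh
  exact (χ.conj_apply g c).symm

variable [Fintype G]

/-- Schur orthogonality is about isomorphism classes. Isomorphic representations have equal
characters, so distinct characters are orthogonal; for equal characters V may be compared with
itself. -/
theorem charInner_irr [DecidableEq (Irr G)] (χ ψ : Irr G) :
    charInner χ.1 ψ.1 = if χ = ψ then 1 else 0 := by
  classical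
  have : Invertible (Nat.card G : ℂ) :=
    invertibleOfNonzero (by exact_mod_cast Nat.card_pos.ne')
  obtain ⟨χ, V, hV, rfl⟩ := χ
  obtain ⟨ψ, W, hW, rfl⟩ := ψ
  have h := FDRep.char_orthonormal V W
  unfold charInner
  split_ifs with hVW
  · have hVW : V.character = W.character := congrArg Subtype.val hVW
    have h' := FDRep.char_orthonormal V V
    rw [if_pos ⟨Iso.refl V⟩] at h'
    simpa [← hVW] using h'
  · rw [if_neg] at h
    · simpa using h
    · rintro ⟨i⟩
      exact hVW (Subtype.ext (FDRep.char_iso i))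

theorem charInner_add_left (f f' h : G → ℂ) :
    charInner (f + f') h = charInner f h + charInner f' h := by
  simp [charInner, add_mul, Finset.sum_add_distrib, mul_add]

theorem charInner_smul_left (c : ℂ) (f h : G → ℂ) :
    charInner (c • f) h = c * charInner f h := by
  simp only [charInner, Pi.smul_apply, smul_eq_mul, Finset.mul_sum]
  exact Finset.sum_congr rfl fun _ _ => by ring

theorem charInner_comm (f h : G → ℂ) : charInner f h = charInner h f := by
  unfold charInner
  congr 1
  rw [← Equiv.sum_comp (Equiv.inv G)]
  exact Finset.sum_congr rfl fun _ _ => by simp [mul_comm]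

theorem charInner_add_right (f h h' : G → ℂ) :
    charInner f (h + h') = charInner f h + charInner f h' := by
  simp [charInner_comm f, charInner_add_left]

theorem charInner_smul_right (c : ℂ) (f h : G → ℂ) :
    charInner f (c • h) = c * charInner f h := by
  simp [charInner_comm f, charInner_smul_left]

/-- `charInner` as a bilinear map. -/
noncomputable def charForm (G : Type) [Group G] [Fintype G] :
    (G → ℂ) →ₗ[ℂ] (G → ℂ) →ₗ[ℂ] ℂ :=
  LinearMap.mk₂ ℂ charInner charInner_add_left charInner_smul_left charInner_add_right
    charInner_smul_right

theorem charForm_apply (f h : G → ℂ) : charForm G f h = charInner f h := rfl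

theorem irr_linearIndependent : LinearIndependent ℂ (fun χ : Irr G => χ.1) := by
  classical
  rw [linearIndependent_iff']
  intro s c hc ψ hψ
  have := congrArg (fun f => charForm G f ψ.1) hc
  simpa [charForm_apply, charInner_irr, hψ] using this

instance : Finite (Irr G) := irr_linearIndependent.finite

/-- The operator `∑ g, f g * ρ g⁻¹`. -/
noncomputable def classOperator {V : Type} [AddCommGroup V] [Module ℂ V] (f : G → ℂ)
    (ρ : Representation ℂ G V) : V →ₗ[ℂ] V := ∑ g, f g • ρ g⁻¹

theorem classOperator_apply {V : Type} [AddCommGroup V] [Module ℂ V] (f : G → ℂ)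
    (ρ : Representation ℂ G V) (v : V) : classOperator f ρ v = ∑ g, f g • ρ g⁻¹ v := by
  simp [classOperator]

theorem classOperator_comm {V : Type} [AddCommGroup V] [Module ℂ V] {f : G → ℂ}
    (hf : ∀ g h, IsConj g h → f g = f h) (ρ : Representation ℂ G V) (h : G) (v : V) :
    classOperator f ρ (ρ h v) = ρ h (classOperator f ρ v) := by
  simp only [classOperator_apply, map_sum, map_smul]
  rw [← Equiv.sum_comp (MulAut.conj h).toEquiv]
  refine Finset.sum_congr rfl fun g _ => ?_
  have h1 : f ((MulAut.conj h).toEquiv g) = f g :=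
    (hf _ _ (isConj_iff.2 ⟨h, rfl⟩)).symm
  rw [h1]
  congr 1
  simp only [← Module.End.mul_apply, ← map_mul]
  congr 2
  simp [mul_assoc]

/-- A class function orthogonal to all irreducible characters annihilates every representation. -/
theorem classOperator_eq_zero {f : G → ℂ} (hf : ∀ g h, IsConj g h → f g = f h)
    (h0 : ∀ χ : Irr G, charInner f χ.1 = 0) (V : Type) [AddCommGroup V] [Module ℂ V]
    [FiniteDimensional ℂ V] (ρ : Representation ℂ G V) : classOperator f ρ = 0 := by
  refine Representation.decomposition_induction (G := G)
    (P := fun V _ _ ρ => classOperator f ρ = 0) ?_ ?_ ?_ V ρ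
  · intro V _ _ ρ hV
    ext v
    exact Subsingleton.elim _ _
  · intro V _ _ _ ρ hρ
    let T : ρ.IntertwiningMap ρ :=
      { classOperator f ρ with
        isIntertwining' := fun h => by
          ext v
          exact classOperator_comm hf ρ h v }
    -- Schur's lemma: the operator commutes with G, so on an irreducible representation it is a
    -- scalar c.
    obtain ⟨c, hc⟩ :=
      (Representation.IsIrreducible.algebraMap_intertwiningMap_bijective_of_isAlgClosed
        (ρ := ρ)).2 T
    have hT : classOperator f ρ = c • LinearMap.id := by
      have := congrArg (fun S : ρ.IntertwiningMap ρ => S.toLinearMap) hc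
      ext v
      have := congrArg (fun S : V →ₗ[ℂ] V => S v) this
      simpa [T, Algebra.algebraMap_eq_smul_one] using! this.symm
    -- The trace is the group order times the scalar product of f with the character of ρ; on the
    -- other hand it is c times the dimension.
    have htr : LinearMap.trace ℂ V (classOperator f ρ) = 0 := by
      have h1 := h0 ⟨ρ.character, isIrreducibleCharacter_of_isIrreducible ρ hρ⟩
      rw [charInner, mul_eq_zero] at h1
      have h2 := h1.resolve_left (inv_ne_zero (by exact_mod_cast Nat.card_pos.ne'))
      simpa [classOperator, Representation.character] using h2
    rw [hT, map_smul, LinearMap.trace_id, smul_eq_mul, mul_eq_zero] at htr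
    rcases htr with h | h
    · rw [hT, h, zero_smul]
    · have : Subsingleton V := Module.finrank_zero_iff.1 (by exact_mod_cast h)
      ext v
      exact Subsingleton.elim _ _
  · intro V _ _ _ ρ W W' hc hW hW'
    have hcs := Representation.isCompl_toSubmodule hc
    ext v
    obtain ⟨⟨w, w'⟩, rfl⟩ := (Submodule.prodEquivOfIsCompl _ _ hcs).surjective v
    have h1 := congrArg (fun S => ((S w : W.toSubmodule) : V)) hW
    have h2 := congrArg (fun S => ((S w' : W'.toSubmodule) : V)) hW'
    simp only [classOperator_apply, LinearMap.zero_apply, Submodule.coe_zero,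
      AddSubmonoidClass.coe_finsetSum, Submodule.coe_smul] at h1 h2
    simp only [Submodule.coe_prodEquivOfIsCompl', map_add, classOperator_apply,
      LinearMap.zero_apply]
    refine congrArg₂ (· + ·) ?_ ?_
    · exact h1
    · exact h2

/-- In the regular representation the class operator of f sends the delta function at 1 to a
function whose value at x⁻¹ is f x, so the operator vanishes only if f does. -/
theorem eq_zero_of_charInner_irr_eq_zero {f : G → ℂ} (hf : ∀ g h, IsConj g h → f g = f h)
    (h0 : ∀ χ : Irr G, charInner f χ.1 = 0) : f = 0 := by
  classical
  have h := classOperator_eq_zero hf h0 (G → ℂ) (Representation.perm G G)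
  ext x
  have h1 := congrFun (congrArg (fun S : (G → ℂ) →ₗ[ℂ] (G → ℂ) => S (Pi.single 1 1)) h) x⁻¹
  simp only [classOperator_apply, Finset.sum_apply, Pi.smul_apply, Representation.perm_apply,
    inv_inv, smul_eq_mul, Pi.single_apply, LinearMap.zero_apply, Pi.zero_apply, mul_ite, mul_one,
    mul_zero] at h1
  rw [Finset.sum_eq_single x] at h1
  · simpa using h1
  · intro b _ hb
    rw [if_neg]
    rwa [mul_inv_eq_one]
  · simp

noncomputable instance : Fintype (Irr G) := Fintype.ofFinite _

/-- Every class function is the combination of the irreducible characters with coefficients the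
inner products. -/
theorem eq_sum_charInner_smul {f : G → ℂ} (hf : ∀ g h, IsConj g h → f g = f h) :
    f = ∑ χ : Irr G, charInner f χ.1 • χ.1 := by
  classical
  rw [← sub_eq_zero]
  apply eq_zero_of_charInner_irr_eq_zero
  · intro g h hgh
    simp [hf g h hgh, Irr.apply_eq_of_isConj _ hgh]
  · intro ψ
    rw [← charForm_apply, map_sub, map_sum]
    simp [charForm_apply, charInner_irr]

theorem charInner_eq_sum {f h : G → ℂ} (hf : ∀ g h, IsConj g h → f g = f h) :
    charInner f h = ∑ χ : Irr G, charInner f χ.1 * charInner h χ.1 := by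
  conv_lhs => rw [eq_sum_charInner_smul hf]
  rw [← charForm_apply, map_sum]
  simp [charForm_apply, charInner_comm]

/-- Taking scalar products with the irreducible characters is a linear isomorphism from functions on
the classes to functions on `Irr G`; the count compares dimensions. -/
theorem card_irr_eq_card_conjClasses : Nat.card (Irr G) = Nat.card (ConjClasses G) := by
  classical
  let e : (ConjClasses G → ℂ) →ₗ[ℂ] (Irr G → ℂ) :=
    { toFun := fun f χ => charInner (fun g => f (ConjClasses.mk g)) χ.1
      map_add' := fun f f' => by ext χ; exact charInner_add_left _ _ _
      map_smul' := fun c f => by ext χ; exact charInner_smul_left _ _ _ }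
  have hinj : Function.Injective e := by
    rw [← LinearMap.ker_eq_bot, LinearMap.ker_eq_bot']
    intro f hf
    have h := eq_zero_of_charInner_irr_eq_zero (f := fun g => f (ConjClasses.mk g))
      (fun g h hgh => by rw [ConjClasses.mk_eq_mk_iff_isConj.2 hgh]) (fun χ => congrFun hf χ)
    ext c
    obtain ⟨g, rfl⟩ := ConjClasses.exists_rep c
    exact congrFun h g
  have hsurj : Function.Surjective e := by
    intro c
    refine ⟨fun k => Quotient.liftOn k (fun g => ∑ χ : Irr G, c χ * χ.1 g) ?_, ?_⟩
    · intro g h hgh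
      simp [fun χ : Irr G => χ.apply_eq_of_isConj hgh]
    · ext ψ
      have : (fun g => ∑ χ : Irr G, c χ * χ.1 g) = ∑ χ : Irr G, c χ • χ.1 := by
        ext g; simp
      change charInner (fun g => ∑ χ : Irr G, c χ * χ.1 g) ψ.1 = c ψ
      rw [this, ← charForm_apply, map_sum]
      simp [charForm_apply, charInner_irr]
  have := (LinearEquiv.ofBijective e ⟨hinj, hsurj⟩).finrank_eq
  simpa [Nat.card_eq_fintype_card] using this.symm

/-- The degree of an irreducible character is a positive natural number. -/
theorem Irr.exists_degree (χ : Irr G) : ∃ d : ℕ, 0 < d ∧ χ.1 1 = d := by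
  classical
  have h := charInner_irr χ χ
  obtain ⟨χ, V, hV, rfl⟩ := χ
  refine ⟨Module.finrank ℂ V, Nat.pos_of_ne_zero fun h0 => ?_, V.char_one⟩
  have : Subsingleton V := Module.finrank_zero_iff.1 h0
  have h1 : V.character = 0 := by
    ext g
    have : V.ρ g = 0 := by ext v; exact Subsingleton.elim _ _
    simp [FDRep.character, this]
  simp [h1, charInner] at h

/-- Parseval's identity for the delta function at 1, whose scalar product with h is h 1 divided by
the group order. -/
theorem sum_degree_sq : ∑ χ : Irr G, χ.1 1 ^ 2 = Nat.card G := by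
  classical
  have hcard : (Nat.card G : ℂ) ≠ 0 := by exact_mod_cast Nat.card_pos.ne'
  have hd : ∀ h : G → ℂ, charInner (Pi.single 1 1) h = (Nat.card G : ℂ)⁻¹ * h 1 := by
    intro h
    simp [charInner, Pi.single_apply]
  have := charInner_eq_sum (f := (Pi.single 1 1 : G → ℂ)) (h := Pi.single 1 1) (by
    intro g h hgh
    by_cases hg : g = 1
    · subst hg; rw [isConj_one_right.1 hgh]
    · have : h ≠ 1 := by rintro rfl; exact hg (isConj_one_left.1 hgh)
      simp [hg, this])
  simp only [hd, Pi.single_eq_same, mul_one] at this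
  rw [Finset.sum_congr rfl (g := fun χ : Irr G => (Nat.card G : ℂ)⁻¹ ^ 2 * χ.1 1 ^ 2)
    (fun _ _ => by ring), ← Finset.mul_sum] at this
  field_simp at this
  exact this.symm

end Irr

/-! ### Virtual characters and integer vectors of small norm -/

section Virtual

variable {G : Type} [Group G] [Fintype G]

/-- The integral combinations of irreducible characters. -/
def virtualCharacters (G : Type) [Group G] : Submodule ℤ (G → ℂ) :=
  Submodule.span ℤ (Set.range fun χ : Irr G => χ.1)

theorem character_mem_virtualCharacters {V : Type} [AddCommGroup V] [Module ℂ V]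
    [FiniteDimensional ℂ V] (ρ : Representation ℂ G V) : ρ.character ∈ virtualCharacters G := by
  refine Representation.decomposition_induction (G := G)
    (P := fun V _ _ ρ => ρ.character ∈ virtualCharacters G) ?_ ?_ ?_ V ρ
  · intro V _ _ ρ hV
    convert (virtualCharacters G).zero_mem
    ext g
    have : ρ g = 0 := by ext v; exact Subsingleton.elim _ _
    simp [Representation.character, this]
  · intro V _ _ _ ρ hρ
    exact Submodule.subset_span
      ⟨⟨ρ.character, isIrreducibleCharacter_of_isIrreducible ρ hρ⟩, rfl⟩
  · intro V _ _ _ ρ W W' hc hW hW'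
    convert (virtualCharacters G).add_mem hW hW'
    ext g
    exact Representation.character_eq_add_of_isCompl hc g

theorem exists_coeff_of_mem_virtualCharacters {f : G → ℂ} (hf : f ∈ virtualCharacters G) :
    ∃ n : Irr G → ℤ, f = ∑ χ, (n χ : ℂ) • χ.1 := by
  obtain ⟨n, hn⟩ := (Submodule.mem_span_range_iff_exists_fun ℤ).1 hf
  exact ⟨n, by simp only [← hn, Int.cast_smul_eq_zsmul]⟩

theorem charInner_sum_coeff (n m : Irr G → ℤ) :
    charInner (∑ χ, (n χ : ℂ) • χ.1) (∑ χ, (m χ : ℂ) • χ.1) = (∑ χ, n χ * m χ : ℤ) := by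
  classical
  rw [← charForm_apply]
  simp [charForm_apply, charInner_irr, mul_comm]

end Virtual

section IntegerVectors

variable {ι : Type*} [Fintype ι] [DecidableEq ι]

/-- An integer vector of norm one is a signed unit vector. -/
theorem exists_eq_single_of_sum_sq_eq_one {n : ι → ℤ} (h : ∑ i, n i * n i = 1) :
    ∃ i, (n i = 1 ∨ n i = -1) ∧ ∀ j, j ≠ i → n j = 0 := by
  obtain ⟨i, hi⟩ : ∃ i, n i ≠ 0 := by
    by_contra! hcon
    simp [hcon] at h
  rw [← Finset.add_sum_erase _ _ (Finset.mem_univ i)] at h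
  have h0 : 0 ≤ ∑ j ∈ Finset.univ.erase i, n j * n j :=
    Finset.sum_nonneg fun j _ => mul_self_nonneg _
  have h1 : 0 < n i * n i := mul_self_pos.2 hi
  have h2 : ∑ j ∈ Finset.univ.erase i, n j * n j = 0 := by omega
  refine ⟨i, ?_, fun j hj => ?_⟩
  · have : n i * n i = 1 := by omega
    exact mul_self_eq_one_iff.1 this
  · have := (Finset.sum_eq_zero_iff_of_nonneg fun j _ => mul_self_nonneg (n j)).1 h2 j
      (Finset.mem_erase.2 ⟨hj, Finset.mem_univ j⟩)
    exact mul_self_eq_zero.1 this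

/-- An integer vector of norm two is a sum of two signed unit vectors. -/
theorem exists_eq_pair_of_sum_sq_eq_two {n : ι → ℤ} (h : ∑ i, n i * n i = 2) :
    ∃ i j, i ≠ j ∧ (n i = 1 ∨ n i = -1) ∧ (n j = 1 ∨ n j = -1) ∧
      ∀ k, k ≠ i → k ≠ j → n k = 0 := by
  obtain ⟨i, hi⟩ : ∃ i, n i ≠ 0 := by
    by_contra! hcon
    simp [hcon] at h
  have hsplit := Finset.add_sum_erase Finset.univ (fun j => n j * n j) (Finset.mem_univ i)
  rw [h] at hsplit
  have h0 : 0 ≤ ∑ j ∈ Finset.univ.erase i, n j * n j :=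
    Finset.sum_nonneg fun j _ => mul_self_nonneg _
  have h1 : 0 < n i * n i := mul_self_pos.2 hi
  have hi1 : n i * n i = 1 := by
    have : n i ≤ 1 := by nlinarith
    have : -1 ≤ n i := by nlinarith
    interval_cases hni : n i <;> simp_all
  have h2 : ∑ j, (if j = i then 0 else n j) * (if j = i then 0 else n j) = 1 := by
    rw [← Finset.add_sum_erase _ _ (Finset.mem_univ i)]
    rw [Finset.sum_congr rfl (g := fun j => n j * n j)
      (fun j hj => by rw [if_neg (Finset.mem_erase.1 hj).1])]
    simp
    omega
  obtain ⟨j, hj, hk⟩ := exists_eq_single_of_sum_sq_eq_one h2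
  have hji : j ≠ i := by
    rintro rfl
    simp at hj
  refine ⟨i, j, hji.symm, mul_self_eq_one_iff.1 hi1, by simpa [hji] using hj, fun k hki hkj => ?_⟩
  simpa [hki] using hk k hkj

theorem sum_mul_eq_of_pair {n : ι → ℤ} {i j : ι} (hij : i ≠ j)
    (h : ∀ k, k ≠ i → k ≠ j → n k = 0) (m : ι → ℤ) :
    ∑ k, n k * m k = n i * m i + n j * m j := by
  rw [← Finset.sum_subset (Finset.subset_univ {i, j}), Finset.sum_pair hij]
  intro k _ hk
  simp only [Finset.mem_insert, Finset.mem_singleton, not_or] at hk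
  rw [h k hk.1 hk.2, zero_mul]

end IntegerVectors

section Virtual

variable {G : Type} [Group G] [Fintype G]

/-- The coefficient vector is a signed unit vector, and the sign is positive because the value at 1
is a natural number while irreducible degrees are positive. -/
theorem isIrreducibleCharacter_of_charInner_eq_one {f : G → ℂ} (hf : f ∈ virtualCharacters G)
    (h1 : charInner f f = 1) {d : ℕ} (hd : f 1 = d) : IsIrreducibleCharacter f := by
  classical
  obtain ⟨n, rfl⟩ := exists_coeff_of_mem_virtualCharacters hf
  rw [charInner_sum_coeff] at h1
  obtain ⟨χ, hχ, h0⟩ := exists_eq_single_of_sum_sq_eq_one (n := n) (by exact_mod_cast h1)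
  have hs : ∑ ψ, (n ψ : ℂ) • ψ.1 = (n χ : ℂ) • χ.1 := by
    rw [Finset.sum_eq_single χ]
    · intro ψ _ hψ
      simp [h0 ψ hψ]
    · simp
  rw [hs] at hd ⊢
  obtain ⟨e, he, he'⟩ := χ.exists_degree
  rcases hχ with hχ | hχ
  · simpa [hχ] using χ.2
  · rw [hχ, Pi.smul_apply, he'] at hd
    have : ((-e : ℤ) : ℂ) = ((d : ℤ) : ℂ) := by
      push_cast
      simpa using hd
    have := Int.cast_injective this
    omega

/-- A virtual character of norm two is a signed sum of two irreducible characters. -/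
theorem exists_pair_of_charInner_eq_two {f : G → ℂ} (hf : f ∈ virtualCharacters G)
    (h2 : charInner f f = 2) : ∃ (χ ψ : Irr G) (a b : ℤ), χ ≠ ψ ∧ (a = 1 ∨ a = -1) ∧
      (b = 1 ∨ b = -1) ∧ f = (a : ℂ) • χ.1 + (b : ℂ) • ψ.1 := by
  classical
  obtain ⟨n, rfl⟩ := exists_coeff_of_mem_virtualCharacters hf
  rw [charInner_sum_coeff] at h2
  obtain ⟨χ, ψ, hne, hχ, hψ, h0⟩ := exists_eq_pair_of_sum_sq_eq_two (n := n) (by exact_mod_cast h2)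
  refine ⟨χ, ψ, n χ, n ψ, hne, hχ, hψ, ?_⟩
  rw [← Finset.sum_subset (Finset.subset_univ {χ, ψ}), Finset.sum_pair hne]
  intro k _ hk
  simp only [Finset.mem_insert, Finset.mem_singleton, not_or] at hk
  rw [h0 k hk.1 hk.2, Int.cast_zero, zero_smul]

end Virtual

/-! ### Norm-two integer vectors with a common coordinate -/

section Star

variable {ι : Type*} [Fintype ι] [DecidableEq ι]

/-- The product 1 is a sum of two terms, at i and at j, each equal to 0, 1 or -1; so one term is 1
and the other 0. -/
theorem star_values_of_pair {x y : ι → ℤ} {i j : ι} (hij : i ≠ j) (hi : x i = 1 ∨ x i = -1)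
    (hj : x j = 1 ∨ x j = -1) (h0 : ∀ k, k ≠ i → k ≠ j → x k = 0) (hy : ∑ k, y k * y k = 2)
    (hxy : ∑ k, x k * y k = 1) : (y i = x i ∧ y j = 0) ∨ (y j = x j ∧ y i = 0) := by
  rw [sum_mul_eq_of_pair hij h0] at hxy
  obtain ⟨p, q, -, hp, hq, hz⟩ := exists_eq_pair_of_sum_sq_eq_two hy
  have hv : ∀ k, y k = 0 ∨ y k = 1 ∨ y k = -1 := by
    intro k
    by_cases h1 : k = p
    · subst h1; exact Or.inr hp
    by_cases h2 : k = q
    · subst h2; exact Or.inr hq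
    exact Or.inl (hz k h1 h2)
  rcases hi with hi | hi <;> rcases hj with hj | hj <;> rw [hi, hj] at hxy ⊢ <;>
    rcases hv i with h | h | h <;> rcases hv j with h' | h' | h' <;> rw [h, h'] at hxy ⊢ <;> omega

/-- The other coordinate of a norm-two vector with a given nonzero coordinate. -/
theorem exists_other_of_sum_sq_eq_two {x : ι → ℤ} (hx : ∑ k, x k * x k = 2) {i : ι}
    (hi : x i ≠ 0) : ∃ k, k ≠ i ∧ (x i = 1 ∨ x i = -1) ∧ (x k = 1 ∨ x k = -1) ∧
      ∀ l, l ≠ i → l ≠ k → x l = 0 := by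
  obtain ⟨p, q, hpq, hp, hq, hz⟩ := exists_eq_pair_of_sum_sq_eq_two hx
  by_cases h1 : i = p
  · subst h1; exact ⟨q, hpq.symm, hp, hq, hz⟩
  by_cases h2 : i = q
  · subst h2; exact ⟨p, hpq, hq, hp, fun l h h' => hz l h' h⟩
  exact absurd (hz i h1 h2) hi

/-- Since u and v already have product 1 through i, their second coordinates k and l differ. As w
vanishes at i, it must be nonzero at k and at l, besides j: three nonzero coordinates are too many
for norm two. -/
theorem star_not_mixed {u v w : ι → ℤ} (hu : ∑ k, u k * u k = 2) (hv : ∑ k, v k * v k = 2)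
    (hw : ∑ k, w k * w k = 2) (huv : ∑ k, u k * v k = 1) (huw : ∑ k, u k * w k = 1)
    (hvw : ∑ k, v k * w k = 1) {i j : ι} (hui : u i ≠ 0) (hvi : v i = u i) (hwi : w i = 0)
    (huj : u j = 0) (hvj : v j = 0) (hwj : w j ≠ 0) : False := by
  obtain ⟨k, hki, hui', huk, hu0⟩ := exists_other_of_sum_sq_eq_two hu hui
  obtain ⟨l, hli, hvi', hvl, hv0⟩ := exists_other_of_sum_sq_eq_two hv (hvi.trans_ne hui)
  rw [sum_mul_eq_of_pair hki.symm hu0, hvi] at huv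
  rw [sum_mul_eq_of_pair hki.symm hu0, hwi] at huw
  rw [sum_mul_eq_of_pair hli.symm hv0, hwi] at hvw
  have hvk : v k = 0 := by
    rcases hui' with h | h <;> rcases huk with h' | h' <;> rw [h, h'] at huv <;> omega
  have hwk : w k ≠ 0 := by rintro h; simp [h] at huw
  have hwl : w l ≠ 0 := by rintro h; simp [h] at hvw
  have hkl : k ≠ l := by rintro rfl; omega
  have hkj : k ≠ j := by rintro rfl; omega
  have hlj : l ≠ j := by rintro rfl; omega
  obtain ⟨p, hpj, -, -, hw0⟩ := exists_other_of_sum_sq_eq_two hw hwj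
  have hkp : k = p := by_contra fun h => hwk (hw0 k hkj h)
  have hlp : l = p := by_contra fun h => hwl (hw0 l hlj h)
  exact hkl (hkp.trans hlp.symm)

/-- Four integer vectors of norm two with pairwise inner products one have a common signed unit
vector. -/
theorem exists_star_center {x : Fin 4 → ι → ℤ}
    (hx : ∀ r s, ∑ k, x r k * x s k = if r = s then 2 else 1) :
    ∃ p, (x 0 p = 1 ∨ x 0 p = -1) ∧ ∀ r, x r p = x 0 p := by
  have hn : ∀ r, ∑ k, x r k * x r k = 2 := fun r => by simpa using hx r r
  have hd : ∀ r s, r ≠ s → ∑ k, x r k * x s k = 1 := fun r s h => by simpa [h] using hx r s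
  obtain ⟨i, j, hij, hi, hj, h0⟩ := exists_eq_pair_of_sum_sq_eq_two (hn 0)
  have hi0 : x 0 i ≠ 0 := by omega
  have hj0 : x 0 j ≠ 0 := by omega
  -- Each of the other three vectors meets `x 0` in exactly one of i and j. A two-to-one split is
  -- excluded by `star_not_mixed`, so all three meet it in the same coordinate.
  have key : ∀ r, r ≠ 0 → (x r i = x 0 i ∧ x r j = 0) ∨ (x r j = x 0 j ∧ x r i = 0) :=
    fun r hr => star_values_of_pair hij hi hj h0 (hn r) (hd 0 r hr.symm)
  have hI : ∀ r s t : Fin 4, r ≠ 0 → r ≠ s → r ≠ t → s ≠ t → (x r i = x 0 i ∧ x r j = 0) →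
      (x s i = x 0 i ∧ x s j = 0) → (x t j = x 0 j ∧ x t i = 0) → False := by
    intro r s t _ hrs hrt hst h1 h2 h3
    exact star_not_mixed (hn r) (hn s) (hn t) (hd r s hrs) (hd r t hrt) (hd s t hst) (i := i)
      (j := j) (by omega) (by omega) h3.2 h1.2 h2.2 (by omega)
  have hJ : ∀ r s t : Fin 4, r ≠ 0 → r ≠ s → r ≠ t → s ≠ t → (x r j = x 0 j ∧ x r i = 0) →
      (x s j = x 0 j ∧ x s i = 0) → (x t i = x 0 i ∧ x t j = 0) → False := by
    intro r s t _ hrs hrt hst h1 h2 h3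
    exact star_not_mixed (hn r) (hn s) (hn t) (hd r s hrs) (hd r t hrt) (hd s t hst) (i := j)
      (j := i) (by omega) (by omega) h3.2 h1.2 h2.2 (by omega)
  have hcenter : ∀ p, x 1 p = x 0 p → x 2 p = x 0 p → x 3 p = x 0 p → ∀ r, x r p = x 0 p := by
    intro p h1 h2 h3 r
    fin_cases r
    exacts [rfl, h1, h2, h3]
  rcases key 1 (by decide) with h1 | h1 <;> rcases key 2 (by decide) with h2 | h2 <;>
    rcases key 3 (by decide) with h3 | h3
  · exact ⟨i, hi, hcenter i h1.1 h2.1 h3.1⟩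
  · exact (hI 1 2 3 (by decide) (by decide) (by decide) (by decide) h1 h2 h3).elim
  · exact (hI 1 3 2 (by decide) (by decide) (by decide) (by decide) h1 h3 h2).elim
  · exact (hJ 2 3 1 (by decide) (by decide) (by decide) (by decide) h2 h3 h1).elim
  · exact (hI 2 3 1 (by decide) (by decide) (by decide) (by decide) h2 h3 h1).elim
  · exact (hJ 1 3 2 (by decide) (by decide) (by decide) (by decide) h1 h3 h2).elim
  · exact (hJ 1 2 3 (by decide) (by decide) (by decide) (by decide) h1 h2 h3).elim
  · exact ⟨j, hj, hcenter j h1.1 h2.1 h3.1⟩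

/-- If moreover `y`, `z` have norm five, mutual inner product three and inner product two with the
four vectors, then `y + z` is four times a signed unit vector. -/
theorem exists_eq_single_of_star {x : Fin 4 → ι → ℤ} {y z : ι → ℤ}
    (hx : ∀ r s, ∑ k, x r k * x s k = if r = s then 2 else 1)
    (hxy : ∀ r, ∑ k, x r k * y k = 2) (hxz : ∀ r, ∑ k, x r k * z k = 2)
    (hy : ∑ k, y k * y k = 5) (hz : ∑ k, z k * z k = 5) (hyz : ∑ k, y k * z k = 3) :
    ∃ p, (y p + z p = 4 ∨ y p + z p = -4) ∧ ∀ k, k ≠ p → y k + z k = 0 := by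
  obtain ⟨p, hp, hpr⟩ := exists_star_center hx
  have hn : ∀ r, ∑ k, x r k * x r k = 2 := fun r => by simpa using hx r r
  have hd : ∀ r s, r ≠ s → ∑ k, x r k * x s k = 1 := fun r s h => by simpa [h] using hx r s
  -- Each vector is the common signed unit vector at p plus a signed unit vector at `q r`; the four
  -- places `q r` are distinct because the mutual products are already used up at p.
  choose q hqp hxp hq h0 using fun r =>
    exists_other_of_sum_sq_eq_two (hn r) (i := p) (by rw [hpr r]; omega)
  have hpp : x 0 p * x 0 p = 1 := by rcases hp with h | h <;> simp [h]
  have hqq : ∀ r, x r (q r) * x r (q r) = 1 := fun r => by rcases hq r with h | h <;> simp [h]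
  have hqinj : Function.Injective q := by
    intro r s hrs
    by_contra hne
    have := hd r s hne
    rw [sum_mul_eq_of_pair (hqp r).symm (h0 r), hpr r, hpr s, hpp] at this
    have h2 : x s (q r) = 0 := by
      have h3 : x r (q r) * x s (q r) = 0 := by omega
      rcases mul_eq_zero.1 h3 with h | h
      · rcases hq r with h' | h' <;> omega
      · exact h
    rw [hrs] at h2
    rcases hq s with h' | h' <;> omega
  have hsplit : ∀ f : ι → ℤ, ∑ k, f k = f p + (f (q 0) + f (q 1) + f (q 2) + f (q 3)) +
      ∑ k ∈ (Finset.univ.erase p) \ Finset.univ.image q, f k := by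
    intro f
    rw [← Finset.add_sum_erase _ _ (Finset.mem_univ p), add_assoc,
      ← Finset.sum_sdiff (s₁ := Finset.univ.image q) (s₂ := Finset.univ.erase p),
      Finset.sum_image (fun _ _ _ _ h => hqinj h), Fin.sum_univ_four]
    · ring
    · intro k hk
      obtain ⟨r, -, rfl⟩ := Finset.mem_image.1 hk
      exact Finset.mem_erase.2 ⟨hqp r, Finset.mem_univ _⟩
  set R := (Finset.univ.erase p) \ Finset.univ.image q
  -- The product 2 with `x r` makes the entry of w at `q r` a function of its entry at p.
  have hq2 : ∀ w : ι → ℤ, (∀ r, ∑ k, x r k * w k = 2) → ∀ r,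
      w (q r) = x r (q r) * (2 - x 0 p * w p) := by
    intro w hw r
    have := hw r
    rw [sum_mul_eq_of_pair (hqp r).symm (h0 r), hpr r] at this
    linear_combination (-w (q r)) * hqq r + x r (q r) * this
  have hqprod : ∀ v w : ι → ℤ, (∀ r, ∑ k, x r k * v k = 2) → (∀ r, ∑ k, x r k * w k = 2) →
      ∀ r, v (q r) * w (q r) = (2 - x 0 p * v p) * (2 - x 0 p * w p) := by
    intro v w hv hw r
    rw [hq2 v hv r, hq2 w hw r]
    linear_combination (2 - x 0 p * v p) * (2 - x 0 p * w p) * hqq r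
  have hyy := hsplit fun k => y k * y k
  have hzz := hsplit fun k => z k * z k
  have hyz' := hsplit fun k => y k * z k
  simp only [hqprod y y hxy hxy, hqprod z z hxz hxz, hqprod y z hxy hxz, hy, hz, hyz]
    at hyy hzz hyz'
  have hpv : ∀ v w : ι → ℤ, v p * w p = (x 0 p * v p) * (x 0 p * w p) := fun v w => by
    linear_combination (-(v p * w p)) * hpp
  rw [hpv] at hyy hzz hyz'
  have hRy : 0 ≤ ∑ k ∈ R, y k * y k := Finset.sum_nonneg fun k _ => mul_self_nonneg _
  have hRz : 0 ≤ ∑ k ∈ R, z k * z k := Finset.sum_nonneg fun k _ => mul_self_nonneg _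
  -- Y is the signed entry at p and S the contribution of R to the norm: 5 = Y² + 4(2 - Y)² + S.
  have hcase : ∀ Y S : ℤ, 0 ≤ S → 5 = Y * Y + ((2 - Y) * (2 - Y) + (2 - Y) * (2 - Y) +
      (2 - Y) * (2 - Y) + (2 - Y) * (2 - Y)) + S → (Y = 1 ∧ S = 0) ∨ (Y = 2 ∧ S = 1) := by
    intro Y S hS h
    have h1 : Y ≤ 2 := by nlinarith
    have h2 : 1 ≤ Y := by nlinarith
    interval_cases Y <;> omega
  have hzero : ∀ v : ι → ℤ, ∑ k ∈ R, v k * v k = 0 → ∀ k ∈ R, v k = 0 := by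
    intro v hv k hk
    exact mul_self_eq_zero.1
      ((Finset.sum_eq_zero_iff_of_nonneg fun j _ => mul_self_nonneg (v j)).1 hv k hk)
  -- With signed entries (1,1), (1,2) or (2,1) the product of y and z would be 5 or 2. So both are
  -- 2, the part on R has product -1 with both norms 1, and y and z cancel there.
  rcases hcase _ _ hRy hyy with ⟨hY, hS⟩ | ⟨hY, hS⟩
  · rw [Finset.sum_eq_zero (s := R) fun k hk => by rw [hzero y hS k hk, zero_mul]] at hyz'
    rcases hcase _ _ hRz hzz with ⟨hZ, -⟩ | ⟨hZ, -⟩ <;> rw [hY, hZ] at hyz' <;> omega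
  · rcases hcase _ _ hRz hzz with ⟨hZ, hS'⟩ | ⟨hZ, hS'⟩
    · rw [Finset.sum_eq_zero (s := R) fun k hk => by rw [hzero z hS' k hk, mul_zero]] at hyz'
      rw [hY, hZ] at hyz'
      omega
    · rw [hY, hZ] at hyz'
      have hR : ∑ k ∈ R, (y k + z k) * (y k + z k) = 0 := by
        have : ∀ k, (y k + z k) * (y k + z k) = y k * y k + z k * z k + 2 * (y k * z k) :=
          fun k => by ring
        simp only [this, Finset.sum_add_distrib, ← Finset.mul_sum]
        omega
      refine ⟨p, ?_, fun k hk => ?_⟩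
      · rcases hp with h | h <;> rw [h] at hY hZ <;> omega
      · by_cases hkq : k ∈ Finset.univ.image q
        · obtain ⟨r, -, rfl⟩ := Finset.mem_image.1 hkq
          rw [hq2 y hxy r, hq2 z hxz r, hY, hZ]
          ring
        · exact hzero (fun k => y k + z k) hR k
            (Finset.mem_sdiff.2 ⟨Finset.mem_erase.2 ⟨hk, Finset.mem_univ _⟩, hkq⟩)

end Star

/-! ### Values at inverses and restriction to cyclic subgroups -/

section Restriction

variable {G : Type} [Group G]

/-- Irreducible representations of a finite commutative group are one-dimensional and their values
are roots of unity, for which inverse and conjugate agree. Applied to cyclic subgroups, this covers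
characters of any finite group. -/
theorem character_inv_of_isMulCommutative [Finite G] [IsMulCommutative G] {V : Type}
    [AddCommGroup V] [Module ℂ V] [FiniteDimensional ℂ V] (ρ : Representation ℂ G V) (g : G) :
    ρ.character g⁻¹ = conj (ρ.character g) := by
  refine Representation.decomposition_induction (G := G)
    (P := fun V _ _ ρ => ρ.character g⁻¹ = conj (ρ.character g)) ?_ ?_ ?_ V ρ
  · intro V _ _ ρ hV
    have : ∀ g, ρ g = 0 := fun g => by ext v; exact Subsingleton.elim _ _
    simp [Representation.character, this]
  · intro V _ _ _ ρ hρ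
    have h1 := Representation.IsIrreducible.finrank_eq_one_of_isMulCommutative ρ
    obtain ⟨v, hv, hspan⟩ := finrank_eq_one_iff'.1 h1
    have hsc : ∀ g, ∃ c : ℂ, ρ g = c • LinearMap.id := by
      intro g
      obtain ⟨c, hc⟩ := hspan (ρ g v)
      refine ⟨c, ?_⟩
      ext w
      obtain ⟨d, rfl⟩ := hspan w
      simp [← hc]
    choose c hc using hsc
    have hcv : ∀ g, ρ g v = c g • v := fun g => by rw [hc]; rfl
    have hpow : ∀ n : ℕ, ρ (g ^ n) v = c g ^ n • v := by
      intro n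
      induction n with
      | zero => simp
      | succ n ih => rw [pow_succ', map_mul, Module.End.mul_apply, ih, map_smul, hcv, smul_smul,
          pow_succ]
    have hone : c g ^ Nat.card G = 1 := by
      have := hpow (Nat.card G)
      rw [pow_card_eq_one', map_one, Module.End.one_apply] at this
      have h : (c g ^ Nat.card G - 1) • v = 0 := by rw [sub_smul, ← this, one_smul, sub_self]
      exact sub_eq_zero.1 ((smul_eq_zero.1 h).resolve_right hv)
    have hinv : c g⁻¹ * c g = 1 := by
      have h2 : ρ g⁻¹ (ρ g v) = v := by
        rw [← Module.End.mul_apply, ← map_mul, inv_mul_cancel, map_one, Module.End.one_apply]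
      rw [hcv, map_smul, hcv, smul_smul] at h2
      have h : (c g * c g⁻¹ - 1) • v = 0 := by rw [sub_smul, h2, one_smul, sub_self]
      rw [mul_comm]
      exact sub_eq_zero.1 ((smul_eq_zero.1 h).resolve_right hv)
    have hnorm : ‖c g‖ = 1 := Complex.norm_eq_one_of_pow_eq_one hone Nat.card_pos.ne'
    have hconj : c g⁻¹ = conj (c g) := by
      rw [eq_inv_of_mul_eq_one_left hinv, Complex.inv_def, Complex.normSq_eq_norm_sq, hnorm]
      simp
    simp [Representation.character, hc, h1, hconj]
  · intro V _ _ _ ρ W W' hc hW hW'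
    rw [Representation.character_eq_add_of_isCompl hc, Representation.character_eq_add_of_isCompl
      hc, hW, hW', map_add]

theorem Irr.apply_inv [Finite G] (χ : Irr G) (g : G) : χ.1 g⁻¹ = conj (χ.1 g) := by
  obtain ⟨χ, V, hV, rfl⟩ := χ
  exact character_inv_of_isMulCommutative (G := Subgroup.zpowers g)
    ((V.ρ).comp (Subgroup.zpowers g).subtype) ⟨g, Subgroup.mem_zpowers g⟩

/-- The norm of the restriction of a character to a cyclic subgroup is an integer. -/
theorem Irr.exists_sum_zpowers_eq [Finite G] (χ : Irr G) (y : G) :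
    ∃ m : ℕ, ∑ j ∈ Finset.range (orderOf y), χ.1 (y ^ j) * χ.1 (y ^ j)⁻¹ = orderOf y * m := by
  classical
  cases nonempty_fintype G
  obtain ⟨χ, V, hV, rfl⟩ := χ
  have : Invertible (Nat.card (Subgroup.zpowers y) : ℂ) :=
    invertibleOfNonzero (by exact_mod_cast Nat.card_pos.ne')
  let ρ : Representation ℂ (Subgroup.zpowers y) V := (V.ρ).comp (Subgroup.zpowers y).subtype
  have h := Representation.card_inv_mul_sum_char_mul_char_eq_finrank ρ ρ
  refine ⟨Module.finrank ℂ (ρ.IntertwiningMap ρ), ?_⟩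
  rw [← h, Nat.card_zpowers, mul_inv_cancel_left₀ (by exact_mod_cast (orderOf_pos y).ne'),
    ← Equiv.sum_comp (finEquivZPowers (isOfFinOrder_of_finite y)), Finset.sum_range]
  rfl

end Restriction

/-! ### Colourings fixed by a permutation -/

section Orbits

variable {Ω : Type*} [Fintype Ω] [DecidableEq Ω]

-- Cycle classes inside the support correspond to the cycle factors, and those outside it are single
-- fixed points. These are the two summands of `Perm.parts_partition`.
open Classical in
theorem prod_sameCycle_quotient {M : Type*} [CommMonoid M] (σ : Perm Ω) (H : ℕ → M) :
    ∏ q : Quotient (Perm.SameCycle.setoid σ),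
      H (Finset.card {x | (Quotient.mk (Perm.SameCycle.setoid σ) x) = q}) =
      (σ.partition.parts.map H).prod := by
  set mk : Ω → Quotient (Perm.SameCycle.setoid σ) := Quotient.mk _ with hmk
  have hmk_eq : ∀ x y, mk x = mk y ↔ σ.SameCycle x y := fun x y => Quotient.eq
  have hfix : ∀ x y, x ∉ σ.support → (mk y = mk x ↔ y = x) := by
    intro x y hx
    refine ⟨fun h => ?_, fun h => h ▸ rfl⟩
    obtain ⟨i, hi⟩ := ((hmk_eq y x).1 h).symm
    rw [← hi, Perm.zpow_apply_eq_self_of_apply_eq_self (Perm.notMem_support.1 hx)]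
  have huniv : (Finset.univ : Finset (Quotient (Perm.SameCycle.setoid σ))) =
      σ.support.image mk ∪ (σ.support)ᶜ.image mk := by
    rw [← Finset.image_union, Finset.union_compl]
    ext q
    obtain ⟨x, rfl⟩ := Quotient.exists_rep q
    simp only [Finset.mem_univ, true_iff, Finset.mem_image, true_and]
    exact ⟨x, rfl⟩
  have hdisj : Disjoint (σ.support.image mk) ((σ.support)ᶜ.image mk) := by
    rw [Finset.disjoint_left]
    intro q h1 h2
    obtain ⟨x, hx, rfl⟩ := Finset.mem_image.1 h1
    obtain ⟨y, hy, hxy⟩ := Finset.mem_image.1 h2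
    have hy' : y ∉ σ.support := Finset.mem_compl.1 hy
    have := (hfix y x hy').1 hxy.symm
    exact hy' (this ▸ hx)
  rw [huniv, Finset.prod_union hdisj, Perm.parts_partition, Multiset.map_add, Multiset.prod_add,
    Multiset.map_replicate, Multiset.prod_replicate]
  congr 1
  · let e : Quotient (Perm.SameCycle.setoid σ) → Perm Ω :=
      Quotient.lift (σ.cycleOf) fun x y h => Perm.SameCycle.cycleOf_eq h
    have he : ∀ x, e (mk x) = σ.cycleOf x := fun x => rfl
    have hinj : Set.InjOn e (σ.support.image mk) := by
      intro q hq r hr hqr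
      obtain ⟨x, hx, rfl⟩ := Finset.mem_image.1 (Finset.mem_coe.1 hq)
      obtain ⟨y, hy, rfl⟩ := Finset.mem_image.1 (Finset.mem_coe.1 hr)
      rw [hmk_eq]
      exact (Perm.sameCycle_iff_cycleOf_eq_of_mem_support hx hy).2 hqr
    have himg : (σ.support.image mk).image e = σ.cycleFactorsFinset := by
      ext c
      simp only [Finset.mem_image, exists_exists_and_eq_and, he]
      constructor
      · rintro ⟨x, hx, rfl⟩
        exact Perm.cycleOf_mem_cycleFactorsFinset_iff.2 hx
      · intro hc
        obtain ⟨x, hx⟩ := (Perm.mem_cycleFactorsFinset_iff.1 hc).1.nonempty_support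
        exact ⟨x, Perm.mem_cycleFactorsFinset_support_le hc hx, (Perm.cycle_is_cycleOf hx hc).symm⟩
    rw [Perm.cycleType_def, Multiset.map_map, ← himg, ← Finset.prod_eq_multiset_prod,
      Finset.prod_image hinj]
    refine Finset.prod_congr rfl fun q hq => ?_
    obtain ⟨x, hx, rfl⟩ := Finset.mem_image.1 hq
    simp only [Function.comp_apply, he]
    congr 2
    ext y
    rw [Perm.mem_support_cycleOf_iff, Finset.mem_filter, eq_comm, hmk_eq]
    simp [hx]
  · rw [Finset.prod_image fun x hx y hy h =>
      (hfix y x (Finset.mem_compl.1 (Finset.mem_coe.1 hy))).1 h,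
      Finset.prod_congr rfl (g := fun _ => H 1), Finset.prod_const, Finset.card_compl]
    intro x hx
    congr 1
    rw [Finset.card_eq_one]
    exact ⟨x, by ext y; simp [hfix x y (Finset.mem_compl.1 hx)]⟩

/-- The weighted number of colourings fixed by a permutation is a product over its cycles. -/
theorem sum_fixed_colorings {A R : Type*} [Fintype A] [DecidableEq A] [CommSemiring R]
    (σ : Perm Ω) (w : A → R) :
    ∑ f : Ω → A with ∀ x, f (σ x) = f x, ∏ x, w (f x) =
      (σ.partition.parts.map fun l => ∑ a, w a ^ l).prod := by
  classical
  rw [← prod_sameCycle_quotient σ fun l => ∑ a, w a ^ l, Finset.prod_univ_sum,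
    Fintype.piFinset_univ]
  symm
  -- A fixed colouring is constant on cycles, so it is a free choice of one colour per cycle; a
  -- cycle of length l in colour a has weight `w a ^ l`.
  have hinv : ∀ f : Ω → A, (∀ x, f (σ x) = f x) → ∀ x y, σ.SameCycle x y → f x = f y := by
    intro f hf x y ⟨i, hi⟩
    have hpow : ∀ (i : ℕ) x, f ((σ ^ i) x) = f x := by
      intro i
      induction i with
      | zero => simp
      | succ i ih => intro x; rw [pow_succ', Perm.mul_apply, hf, ih]
    rw [← hi]
    obtain ⟨i, rfl | rfl⟩ := i.eq_nat_or_neg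
    · exact (hpow i x).symm
    · rw [zpow_neg, zpow_natCast]
      have h : (σ ^ i) ((σ ^ i)⁻¹ x) = x := by simp
      conv_lhs => rw [← h, hpow]
  refine Finset.sum_bij (fun F _ x => F (Quotient.mk _ x)) ?_ ?_ ?_ ?_
  · intro F _
    simp only [Finset.mem_filter, Finset.mem_univ, true_and]
    intro x
    congr 1
    exact Quotient.sound
      (Perm.SameCycle.symm (Perm.sameCycle_apply_right.2 (Perm.SameCycle.refl _ _)))
  · intro F _ F' _ h
    ext q
    obtain ⟨x, rfl⟩ := Quotient.exists_rep q
    exact congrFun h x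
  · intro f hf
    exact ⟨Quotient.lift f (hinv f (Finset.mem_filter.1 hf).2), Finset.mem_univ _, rfl⟩
  · intro F _
    rw [← Finset.prod_fiberwise' Finset.univ (Quotient.mk (Perm.SameCycle.setoid σ))
      (fun q => w (F q))]
    simp

end Orbits

/-- The number of ways to colour cycles of the lengths in the list, using a default colour and four
more colours, so that these four are given to `a`, `b`, `c`, `d` points. -/
def coloringCount : List ℕ → ℕ → ℕ → ℕ → ℕ → ℕ
  | [], a, b, c, d => if a + b + c + d = 0 then 1 else 0
  | l :: L, a, b, c, d => coloringCount L a b c d +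
      (if l ≤ a then coloringCount L (a - l) b c d else 0) +
      (if l ≤ b then coloringCount L a (b - l) c d else 0) +
      (if l ≤ c then coloringCount L a b (c - l) d else 0) +
      (if l ≤ d then coloringCount L a b c (d - l) else 0)

-- Expand the first factor: the summand 1 gives the cycle the default colour, and `X i ^ l` gives it
-- colour i, which removes l from the exponent of i.
open MvPolynomial in
theorem coeff_prod_eq_coloringCount (L : List ℕ) (a b c d : ℕ) :
    coeff (Finsupp.equivFunOnFinite.symm ![a, b, c, d])
      (L.map fun l => (1 + ∑ i : Fin 4, (X i : MvPolynomial (Fin 4) ℕ) ^ l)).prod =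
      coloringCount L a b c d := by
  induction L generalizing a b c d with
  | nil =>
    rw [List.map_nil, List.prod_nil, coeff_one, coloringCount]
    congr 1
    rw [eq_comm, Finsupp.ext_iff]
    simp [Fin.forall_fin_succ]
    omega
  | cons l L ih =>
    rw [List.map_cons, List.prod_cons, add_mul, one_mul, coeff_add, ih, coloringCount,
      Finset.sum_mul, coeff_sum, Fin.sum_univ_four]
    have hX : ∀ (i : Fin 4) (m : Fin 4 →₀ ℕ) (p : MvPolynomial (Fin 4) ℕ),
        coeff m (X i ^ l * p) = if l ≤ m i then coeff (m - Finsupp.single i l) p else 0 := by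
      intro i m p
      simp [X_pow_eq_monomial, coeff_monomial_mul', Finsupp.single_le_iff]
    simp only [hX, ← add_assoc]
    have h0 : Finsupp.equivFunOnFinite.symm ![a, b, c, d] - Finsupp.single 0 l =
        Finsupp.equivFunOnFinite.symm ![a - l, b, c, d] := by
      ext i; fin_cases i <;> simp
    have h1 : Finsupp.equivFunOnFinite.symm ![a, b, c, d] - Finsupp.single 1 l =
        Finsupp.equivFunOnFinite.symm ![a, b - l, c, d] := by
      ext i; fin_cases i <;> simp
    have h2 : Finsupp.equivFunOnFinite.symm ![a, b, c, d] - Finsupp.single 2 l =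
        Finsupp.equivFunOnFinite.symm ![a, b, c - l, d] := by
      ext i; fin_cases i <;> simp
    have h3 : Finsupp.equivFunOnFinite.symm ![a, b, c, d] - Finsupp.single 3 l =
        Finsupp.equivFunOnFinite.symm ![a, b, c, d - l] := by
      ext i; fin_cases i <;> simp
    rw [h0, h1, h2, h3, ih, ih, ih, ih]
    rfl

/-- Colourings of `Fin n` by a default colour and four more colours used `μ 0`, …, `μ 3` times. -/
def Coloring (n : ℕ) (μ : Fin 4 → ℕ) : Type :=
  {f : Fin n → Option (Fin 4) // ∀ a, Finset.card {x | f x = some a} = μ a}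

namespace Coloring

variable {n : ℕ} {μ : Fin 4 → ℕ}

instance : Fintype (Coloring n μ) := inferInstanceAs (Fintype {_f // _})

instance : MulAction (Perm (Fin n)) (Coloring n μ) where
  smul g f := ⟨fun x => f.1 (g⁻¹ x), fun a => by
    rw [← f.2 a]
    exact Finset.card_equiv g⁻¹ (by simp)⟩
  one_smul f := rfl
  mul_smul g h f := Subtype.ext (funext fun x => by
    change f.1 ((g * h)⁻¹ x) = f.1 (h⁻¹ (g⁻¹ x))
    rw [mul_inv_rev, Perm.mul_apply])

theorem smul_apply (g : Perm (Fin n)) (f : Coloring n μ) (x : Fin n) :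
    (g • f).1 x = f.1 (g⁻¹ x) := rfl

-- Give the default colour weight 1 and colour i weight `X i`. Then the generating function of the
-- fixed colourings is a product over cycles, and the exponent of its monomials records how often
-- each colour is used.
open MvPolynomial in
theorem card_fixedBy {a b c d : ℕ} (σ : Perm (Fin n)) {L : List ℕ}
    (hL : σ.partition.parts = L) :
    Nat.card (MulAction.fixedBy (Coloring n ![a, b, c, d]) σ) = coloringCount L a b c d := by
  classical
  have h := sum_fixed_colorings σ
    (fun o : Option (Fin 4) => o.elim (1 : MvPolynomial (Fin 4) ℕ) X)
  simp only [Fintype.sum_option, Option.elim_none, Option.elim_some, one_pow, hL,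
    Multiset.map_coe, Multiset.prod_coe] at h
  have h' := congrArg (coeff (Finsupp.equivFunOnFinite.symm ![a, b, c, d])) h
  rw [coeff_prod_eq_coloringCount, coeff_sum] at h'
  rw [← h']
  have hmon : ∀ f : Fin n → Option (Fin 4),
      ∏ x, (f x).elim (1 : MvPolynomial (Fin 4) ℕ) X =
        monomial (Finsupp.equivFunOnFinite.symm fun a => Finset.card {x | f x = some a}) 1 := by
    intro f
    rw [← Finset.prod_fiberwise' Finset.univ f
      (fun o => o.elim (1 : MvPolynomial (Fin 4) ℕ) X), Fintype.prod_option]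
    simp [monomial_eq, Finsupp.prod_fintype]
  simp only [hmon, coeff_monomial]
  rw [Finset.sum_ite, Finset.sum_const_zero, add_zero, Finset.sum_const, smul_eq_mul, mul_one,
    Finset.filter_filter, ← Fintype.card_subtype, ← Nat.card_eq_fintype_card]
  refine Nat.card_congr
    { toFun := fun f => ⟨f.1.1, fun x => ?_, ?_⟩
      invFun := fun f => ⟨⟨f.1, fun a => ?_⟩, ?_⟩
      left_inv := fun f => rfl
      right_inv := fun f => rfl }
  · have := congrArg (fun k : Coloring n _ => k.1 (σ x)) f.2
    simpa [smul_apply] using this.symm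
  · rw [Equiv.apply_eq_iff_eq]
    ext a
    exact f.1.2 a
  · exact congrFun (Finsupp.equivFunOnFinite.symm.injective f.2.2) a
  · refine Subtype.ext (funext fun x => ?_)
    have h1 := f.2.1 (σ⁻¹ x)
    have h2 : σ (σ⁻¹ x) = x := by simp
    rw [h2] at h1
    exact h1.symm

end Coloring

theorem Coloring.nonempty {n : ℕ} {μ : Fin 4 → ℕ} (h : ∑ a, μ a ≤ n) :
    Nonempty (Coloring n μ) := by
  let ν : Option (Fin 4) → ℕ := fun o => o.elim (n - ∑ a, μ a) μ
  have hcard : Fintype.card (Fin n) = Fintype.card (Σ o, Fin (ν o)) := by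
    rw [Fintype.card_sigma]
    simp only [Fintype.card_fin]
    rw [Fintype.sum_option]
    simp only [ν, Option.elim_none, Option.elim_some]
    omega
  let e := Fintype.equivOfCardEq hcard
  refine ⟨⟨fun x => (e x).1, fun a => ?_⟩⟩
  rw [← Fintype.card_subtype, Fintype.card_congr ((e.subtypeEquiv fun x => Iff.rfl).trans
    (Equiv.sigmaSubtype (some a))), Fintype.card_fin]
  rfl

/-! ### Consequences of sharp transitivity -/

namespace IsSharplyTransitive

variable {n k : ℕ} {G : Subgroup (Perm (Fin n))}

/-- Enlarge S to a set of exactly k points and move an enumeration of it by π. -/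
theorem exists_eq_on (h : IsSharplyTransitive G (Fin n) k) (hk : k ≤ n) {S : Finset (Fin n)}
    (hS : S.card ≤ k) (π : Perm (Fin n)) : ∃ g : G, ∀ x ∈ S, g.1 x = π x := by
  obtain ⟨T, hST, hT⟩ := Finset.exists_superset_card_eq hS (by simpa using hk)
  let e := (T.orderEmbOfFin hT).toEmbedding
  obtain ⟨g, hg, -⟩ := h e (e.trans π.toEmbedding)
  refine ⟨g, fun x hx => ?_⟩
  have : x ∈ Set.range (T.orderEmbOfFin hT) := by
    rw [Finset.range_orderEmbOfFin]
    exact hST hx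
  obtain ⟨i, rfl⟩ := this
  exact hg i

theorem eq_one_of_fixed (h : IsSharplyTransitive G (Fin n) k) {S : Finset (Fin n)}
    (hS : k ≤ S.card) {g : Perm (Fin n)} (hg : g ∈ G) (hfix : ∀ x ∈ S, g x = x) : g = 1 := by
  obtain ⟨T, hTS, hT⟩ := Finset.exists_subset_card_eq hS
  let e := (T.orderEmbOfFin hT).toEmbedding
  obtain ⟨u, -, hu⟩ := h e e
  have h1 := hu ⟨g, hg⟩ fun i => hfix _ (hTS (T.orderEmbOfFin_mem hT i))
  have h2 := hu 1 fun i => rfl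
  exact congrArg Subtype.val (h1.trans h2.symm)

theorem card_eq (h : IsSharplyTransitive G (Fin n) k) (hk : k ≤ n) :
    Nat.card G = n.descFactorial k := by
  let e : Fin k ↪ Fin n := Fin.castLEEmb hk
  have hb : Function.Bijective fun g : G => e.trans g.1.toEmbedding := by
    constructor
    · intro g g' hgg'
      obtain ⟨u, -, hu⟩ := h e (e.trans g.1.toEmbedding)
      rw [hu g fun i => rfl, hu g' fun i => (DFunLike.congr_fun hgg' i).symm]
    · intro y
      obtain ⟨g, hg, -⟩ := h e y
      exact ⟨g, DFunLike.ext _ _ hg⟩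
  rw [Nat.card_congr (Equiv.ofBijective _ hb), Nat.card_eq_fintype_card,
    Fintype.card_embedding_eq]
  simp

/-- The colour classes of two colourings have equal sizes, so some permutation π of the points
matches them. An element of G that agrees with π on the at most k non-default points also matches
the default points, being injective. -/
theorem isPretransitive_coloring (h : IsSharplyTransitive G (Fin n) k) (hk : k ≤ n)
    {μ : Fin 4 → ℕ} (hμ : ∑ a, μ a ≤ k) : MulAction.IsPretransitive G (Coloring n μ) := by
  classical
  refine ⟨fun f f' => ?_⟩
  have hsum : ∀ f : Coloring n μ,
      Finset.card {x | f.1 x = none} + ∑ a, μ a = n := by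
    intro f
    have := Finset.card_eq_sum_card_fiberwise (f := f.1) (s := Finset.univ) (t := Finset.univ)
      (fun _ _ => by simp)
    rw [Fintype.sum_option, Finset.card_univ, Fintype.card_fin] at this
    rw [Finset.sum_congr rfl fun a _ => (f.2 a).symm]
    exact this.symm
  have hfib : ∀ o, Nonempty ({x // f.1 x = o} ≃ {x // f'.1 x = o}) := by
    intro o
    rw [← Fintype.card_eq, Fintype.card_subtype, Fintype.card_subtype]
    cases o with
    | none => have := hsum f; have := hsum f'; omega
    | some a => rw [f.2, f'.2]
  let π : Perm (Fin n) := Equiv.ofFiberEquiv fun o => (hfib o).some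
  have hπ : ∀ x, f'.1 (π x) = f.1 x := fun x => Equiv.ofFiberEquiv_map _ x
  obtain ⟨g, hg⟩ := h.exists_eq_on hk (S := {x | f.1 x ≠ none}) (by
    have h1 := Finset.card_filter_add_card_filter_not (s := Finset.univ) fun x => f.1 x = none
    rw [Finset.card_univ, Fintype.card_fin] at h1
    have h2 := hsum f
    simp only [ne_eq]
    omega) π
  have hgf : ∀ x, f'.1 (g.1 x) = f.1 x := by
    intro x
    by_cases hx : f.1 x = none
    · rw [hx]
      by_contra hne
      have hz : f.1 (π⁻¹ (g.1 x)) ≠ none := by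
        rw [← hπ]
        simpa using hne
      have h1 := hg (π⁻¹ (g.1 x)) (by simpa using hz)
      have h2 : π (π⁻¹ (g.1 x)) = g.1 x := by simp
      rw [h2] at h1
      rw [g.1.injective h1] at hz
      exact hz hx
    · rw [hg x (by simpa using hx), hπ]
  refine ⟨g, Subtype.ext (funext fun x => ?_)⟩
  have h1 := hgf (g.1⁻¹ x)
  have h2 : g.1 (g.1⁻¹ x) = x := by simp
  rw [h2] at h1
  exact h1.symm

end IsSharplyTransitive

/-! ### Burnside's lemma for cycle types -/

section Types

variable {n : ℕ} {G : Subgroup (Perm (Fin n))} {r : ℕ} {t : Fin r → List ℕ} {τ : G → Fin r}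

theorem sum_type_eq {H : Type*} [Fintype H] (τ : H → Fin r) {M : Type*} [CommSemiring M]
    (F : Fin r → M) :
    ∑ g, F (τ g) = ∑ i, (Finset.card {g | τ g = i} : M) * F i := by
  rw [← Finset.sum_fiberwise Finset.univ τ]
  refine Finset.sum_congr rfl fun i _ => ?_
  rw [Finset.sum_congr rfl (g := fun _ => F i), Finset.sum_const, nsmul_eq_mul]
  intro g hg
  rw [(Finset.mem_filter.1 hg).2]

theorem card_fixedBy_coloring (hτ : ∀ g : G, (g : Perm (Fin n)).partition.parts = t (τ g))
    (a b c d : ℕ) (g : G) : Nat.card (MulAction.fixedBy (Coloring n ![a, b, c, d]) g) =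
      coloringCount (t (τ g)) a b c d :=
  Coloring.card_fixedBy g.1 (hτ g)

/-- Burnside's lemma for colourings. -/
theorem exists_sum_coloringCount_eq [Fintype G]
    (hτ : ∀ g : G, (g : Perm (Fin n)).partition.parts = t (τ g)) (a b c d : ℕ) :
    ∃ m, ∑ i, Finset.card {g | τ g = i} * coloringCount (t i) a b c d = m * Nat.card G := by
  classical
  have h := MulAction.sum_card_fixedBy_eq_card_orbits_mul_card_group G (Coloring n ![a, b, c, d])
  simp only [← Nat.card_eq_fintype_card, card_fixedBy_coloring hτ] at h
  rw [sum_type_eq τ fun i => coloringCount (t i) a b c d] at h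
  exact ⟨_, h⟩

theorem IsSharplyTransitive.sum_coloringCount_eq [Fintype G] {k : ℕ}
    (hG : IsSharplyTransitive G (Fin n) k) (hk : k ≤ n)
    (hτ : ∀ g : G, (g : Perm (Fin n)).partition.parts = t (τ g)) (a b c d : ℕ)
    (hμ : a + b + c + d ≤ k) :
    ∑ i, Finset.card {g | τ g = i} * coloringCount (t i) a b c d = Nat.card G := by
  classical
  have h := MulAction.sum_card_fixedBy_eq_card_orbits_mul_card_group G (Coloring n ![a, b, c, d])
  simp only [← Nat.card_eq_fintype_card, card_fixedBy_coloring hτ] at h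
  rw [sum_type_eq τ fun i => coloringCount (t i) a b c d] at h
  have := hG.isPretransitive_coloring hk (μ := ![a, b, c, d]) (by
    simpa [Fin.sum_univ_four] using hμ)
  have h1 : Nat.card (MulAction.orbitRel.Quotient G (Coloring n ![a, b, c, d])) = 1 := by
    rw [Nat.card_eq_one_iff_unique]
    obtain ⟨f⟩ := Coloring.nonempty (n := n) (μ := ![a, b, c, d]) (by
      simpa [Fin.sum_univ_four] using hμ.trans hk)
    exact ⟨(MulAction.pretransitive_iff_subsingleton_quotient G _).1 this, ⟨Quotient.mk _ f⟩⟩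
  rw [h1, one_mul] at h
  exact h

theorem coloringCount_mem_virtualCharacters [Fintype G]
    (hτ : ∀ g : G, (g : Perm (Fin n)).partition.parts = t (τ g)) (a b c d : ℕ) :
    (fun g => (coloringCount (t (τ g)) a b c d : ℂ)) ∈ virtualCharacters G := by
  have h := character_mem_virtualCharacters (Representation.perm G (Coloring n ![a, b, c, d]))
  convert h using 2 with g
  rw [Representation.character_perm, card_fixedBy_coloring hτ]

end Types

/-! ### Constraints on cycle types -/

section Partitions

/-- All decreasing lists of at most `k` positive integers at most `m` with sum `n`. -/
def decreasingLists : ℕ → ℕ → ℕ → List (List ℕ)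
  | 0, n, _ => if n = 0 then [[]] else []
  | k + 1, n, m => (if n = 0 then [[]] else []) ++ (List.range m).flatMap fun i =>
      if i + 1 ≤ n then (decreasingLists k (n - (i + 1)) (i + 1)).map ((i + 1) :: ·) else []

theorem mem_decreasingLists (k m : ℕ) (L : List ℕ) (hs : L.Pairwise (· ≥ ·))
    (hpos : ∀ l ∈ L, 0 < l) (hm : ∀ l ∈ L, l ≤ m) (hk : L.length ≤ k) :
    L ∈ decreasingLists k L.sum m := by
  induction k generalizing m L with
  | zero =>
    obtain rfl : L = [] := by simpa using hk
    simp [decreasingLists]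
  | succ k ih =>
    cases L with
    | nil => simp [decreasingLists]
    | cons l L =>
      rw [decreasingLists, List.mem_append]
      right
      rw [List.mem_flatMap]
      have hl : 0 < l := hpos l (by simp)
      refine ⟨l - 1, ?_, ?_⟩
      · have := hm l (by simp)
        rw [List.mem_range]
        omega
      · rw [Nat.sub_add_cancel hl, if_pos (by simp), List.mem_map]
        refine ⟨L, ?_, rfl⟩
        have h1 : (l :: L).sum - l = L.sum := by simp
        rw [h1]
        rw [List.pairwise_cons] at hs
        exact ih l L hs.2 (fun x hx => hpos x (by simp [hx])) hs.1 (by simpa using hk)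

/-- Every point on a cycle whose length divides m is fixed by `σ ^ m`. -/
theorem sum_filter_dvd_le_card_fixed {n : ℕ} (σ : Perm (Fin n)) (m : ℕ) :
    (σ.partition.parts.filter (· ∣ m)).sum ≤ Finset.card {x | (σ ^ m) x = x} := by
  classical
  have h := prod_sameCycle_quotient (M := Multiplicative ℕ) σ
    fun l => Multiplicative.ofAdd (if l ∣ m then l else 0)
  have h2 : (σ.partition.parts.filter (· ∣ m)).sum =
      ∑ q : Quotient (Perm.SameCycle.setoid σ),
        if Finset.card {x | (Quotient.mk (Perm.SameCycle.setoid σ) x) = q} ∣ m then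
          Finset.card {x | (Quotient.mk (Perm.SameCycle.setoid σ) x) = q} else 0 := by
    apply Multiplicative.ofAdd.injective
    rw [ofAdd_sum, h]
    generalize σ.partition.parts = s
    induction s using Multiset.induction with
    | empty => rfl
    | cons a s ih =>
      rw [Multiset.map_cons, Multiset.prod_cons, ← ih, Multiset.filter_cons, Multiset.sum_add]
      split_ifs <;> simp
  rw [h2, Finset.card_eq_sum_card_fiberwise
    (f := Quotient.mk (Perm.SameCycle.setoid σ)) (t := Finset.univ) (fun _ _ => by simp)]
  refine Finset.sum_le_sum fun q _ => ?_
  split_ifs with hd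
  · refine Finset.card_le_card fun x hx => ?_
    have hx := (Finset.mem_filter.1 hx).2
    refine Finset.mem_filter.2 ⟨Finset.mem_filter.2 ⟨Finset.mem_univ _, ?_⟩, hx⟩
    by_cases hxs : x ∈ σ.support
    · have hcard : Finset.card {y | (Quotient.mk (Perm.SameCycle.setoid σ) y) = q} =
          (σ.cycleOf x).support.card := by
        congr 1
        ext y
        rw [Perm.mem_support_cycleOf_iff, Finset.mem_filter, ← hx, eq_comm, Quotient.eq]
        simp only [Finset.mem_univ, true_and, hxs, and_true]
        exact Iff.rfl
      rw [hcard] at hd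
      have := Perm.pow_mod_card_support_cycleOf_self_apply σ m x
      rw [Nat.mod_eq_zero_of_dvd hd] at this
      simpa using this.symm
    · exact Perm.pow_apply_eq_self_of_apply_eq_self (Perm.notMem_support.1 hxs) m
  · exact Nat.zero_le _

/-- The constraint on cycle lengths of an even permutation in a group in which only the identity
fixes `k` points. -/
def AdmissibleType (k b : ℕ) (L : List ℕ) : Prop :=
  (L.sum + L.length) % 2 = 0 ∧
    ∀ m ∈ List.range b, k ≤ (L.filter (· ∣ m)).sum → ∀ l ∈ L, l ∣ m

instance (k b : ℕ) (L : List ℕ) : Decidable (AdmissibleType k b L) :=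
  inferInstanceAs (Decidable (_ ∧ _))

/-- If the cycles with length dividing m cover k points, then `g ^ m` fixes k points and is the
identity, so every cycle length divides m. -/
theorem exists_admissibleType {n k : ℕ} {G : Subgroup (Perm (Fin n))}
    (h : IsSharplyTransitive G (Fin n) k) (ha : G ≤ alternatingGroup (Fin n)) {g : Perm (Fin n)}
    (hg : g ∈ G) (b : ℕ) : ∃ L ∈ decreasingLists n n n, AdmissibleType k b L ∧
      g.partition.parts = L := by
  refine ⟨g.partition.parts.sort (· ≥ ·), ?_, ⟨?_, ?_⟩, (Multiset.sort_eq _ _).symm⟩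
  · have hmem : ∀ l, l ∈ g.partition.parts.sort (· ≥ ·) ↔ l ∈ g.partition.parts :=
      fun l => Multiset.mem_sort _
    have hsum : (g.partition.parts.sort (· ≥ ·)).sum = n := by
      rw [← Multiset.sum_coe, Multiset.sort_eq, g.partition.parts_sum, Fintype.card_fin]
    have hpos : ∀ l ∈ g.partition.parts.sort (· ≥ ·), 0 < l := fun l hl =>
      g.partition.parts_pos ((hmem l).1 hl)
    have := mem_decreasingLists n n (g.partition.parts.sort (· ≥ ·))
      (Multiset.pairwise_sort _ _) hpos (fun l hl => ?_) ?_
    · rwa [hsum] at this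
    · exact (List.single_le_sum (by simp) l hl).trans_eq hsum
    · exact (List.length_le_sum_of_one_le _ hpos).trans_eq hsum
  · have h1 : Perm.sign g = 1 := Perm.mem_alternatingGroup.1 (ha hg)
    rw [Perm.sign_of_cycleType] at h1
    have h2 : (g.partition.parts.sort (· ≥ ·)).sum + (g.partition.parts.sort (· ≥ ·)).length =
        g.partition.parts.sum + g.partition.parts.card := by
      rw [← Multiset.sum_coe, ← Multiset.coe_card, Multiset.sort_eq]
    rw [h2, Perm.parts_partition]
    -- The sign is -1 to this power; each fixed point, counted as a part 1, raises sum plus length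
    -- by 2 and leaves the parity alone.
    have h3 : Even (g.cycleType.sum + g.cycleType.card) := by
      rcases Nat.even_or_odd (g.cycleType.sum + g.cycleType.card) with h | h
      · exact h
      · rw [h.neg_one_pow] at h1
        exact absurd h1 (by decide)
    rw [Nat.even_iff] at h3
    simp only [Multiset.sum_add, Multiset.sum_replicate, Multiset.card_add,
      Multiset.card_replicate, smul_eq_mul, mul_one]
    omega
  · intro m _ hm l hl
    have h1 : g ^ m = 1 := by
      refine h.eq_one_of_fixed (S := {x | (g ^ m) x = x}) (le_trans ?_
        (sum_filter_dvd_le_card_fixed g m)) (G.pow_mem hg m) (by simp)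
      refine hm.trans_eq ?_
      conv_rhs => rw [← Multiset.sort_eq g.partition.parts (· ≥ ·)]
      rw [Multiset.filter_coe, Multiset.sum_coe]
    rw [Multiset.mem_sort, Perm.parts_partition, Multiset.mem_add] at hl
    rcases hl with hl | hl
    · exact (Perm.dvd_of_mem_cycleType hl).trans (orderOf_dvd_of_pow_eq_one h1)
    · rw [Multiset.eq_of_mem_replicate hl]
      exact one_dvd m

end Partitions

/-! ### Functions of the cycle type and sums of squared degrees -/

/-- The function on `G` whose value at `g` is the value of `v` at the type of `g`. -/
def typeFun {G : Type} {r : ℕ} (τ : G → Fin r) (v : Fin r → ℤ) (g : G) : ℂ := v (τ g)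

section TypeFunctions

variable {n : ℕ} {G : Subgroup (Perm (Fin n))} {r : ℕ} {t : Fin r → List ℕ} {τ : G → Fin r}

/-- An integral combination of numbers of fixed colourings. -/
def colorComb (C : List (ℤ × ℕ × ℕ × ℕ × ℕ)) (L : List ℕ) : ℤ :=
  (C.map fun s : ℤ × ℕ × ℕ × ℕ × ℕ =>
    s.1 * (coloringCount L s.2.1 s.2.2.1 s.2.2.2.1 s.2.2.2.2 : ℤ)).sum

theorem colorComb_mem_virtualCharacters [Fintype G]
    (hτ : ∀ g : G, (g : Perm (Fin n)).partition.parts = t (τ g))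
    (C : List (ℤ × ℕ × ℕ × ℕ × ℕ)) :
    (fun g => (colorComb C (t (τ g)) : ℂ)) ∈ virtualCharacters G := by
  induction C with
  | nil =>
    convert (virtualCharacters G).zero_mem using 1
    ext g
    simp [colorComb]
  | cons s C ih =>
    convert (virtualCharacters G).add_mem ((virtualCharacters G).smul_mem s.1
      (coloringCount_mem_virtualCharacters hτ s.2.1 s.2.2.1 s.2.2.2.1 s.2.2.2.2)) ih using 1
    ext g
    simp [colorComb]

theorem type_mem_virtualCharacters [Fintype G]
    (hτ : ∀ g : G, (g : Perm (Fin n)).partition.parts = t (τ g))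
    (C : List (ℤ × ℕ × ℕ × ℕ × ℕ)) {v : Fin r → ℤ} (hv : ∀ i, colorComb C (t i) = v i) :
    typeFun τ v ∈ virtualCharacters G := by
  convert colorComb_mem_virtualCharacters hτ C using 2 with g
  rw [typeFun, hv]

theorem type_eq_of_isConj (hτ : ∀ g : G, (g : Perm (Fin n)).partition.parts = t (τ g))
    (ht : ∀ i j, (t i : Multiset ℕ) = t j → i = j) {g h : G} (hgh : IsConj g h) :
    τ g = τ h := by
  apply ht
  rw [← hτ, ← hτ]
  congr 1
  rw [← Perm.partition_eq_of_isConj]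
  obtain ⟨c, rfl⟩ := isConj_iff.1 hgh
  exact isConj_iff.2 ⟨c.1, rfl⟩

theorem type_inv (hτ : ∀ g : G, (g : Perm (Fin n)).partition.parts = t (τ g))
    (ht : ∀ i j, (t i : Multiset ℕ) = t j → i = j) (g : G) : τ g⁻¹ = τ g := by
  apply ht
  rw [← hτ, ← hτ]
  congr 1
  rw [← Perm.partition_eq_of_isConj, Perm.isConj_iff_cycleType_eq]
  exact Perm.cycleType_inv _

theorem type_one_eq (hτ : ∀ g : G, (g : Perm (Fin n)).partition.parts = t (τ g))
    (ht : ∀ i j, (t i : Multiset ℕ) = t j → i = j) {i : Fin r}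
    (hi : t i = List.replicate n 1) : τ 1 = i := by
  apply ht
  rw [← hτ, hi, Perm.parts_partition]
  simp [Multiset.coe_replicate]

theorem orderOf_eq_lcm_type (hτ : ∀ g : G, (g : Perm (Fin n)).partition.parts = t (τ g)) (g : G) :
    orderOf g = (t (τ g)).foldr Nat.lcm 1 := by
  rw [← Subgroup.orderOf_coe, ← Perm.lcm_cycleType]
  have h := hτ g
  rw [Perm.parts_partition] at h
  have h1 : (t (τ g)).foldr Nat.lcm 1 = (t (τ g) : Multiset ℕ).lcm := by
    generalize t (τ g) = L
    induction L with
    | nil => simp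
    | cons a L ih => rw [List.foldr_cons, ih, ← Multiset.cons_coe, Multiset.lcm_cons]; rfl
  rw [h1, ← h, Multiset.lcm_add]
  have h2 : (Multiset.replicate (Fintype.card (Fin n) - (g : Perm (Fin n)).support.card) 1).lcm ∣
      1 := Multiset.lcm_dvd.2 fun b hb => (Multiset.eq_of_mem_replicate hb).dvd
  rw [Nat.dvd_one.1 h2]
  simp [lcm_one_right]

theorem card_fixed_eq_count_type (hτ : ∀ g : G, (g : Perm (Fin n)).partition.parts = t (τ g))
    (g : G) : Finset.card {x | g.1 x = x} = (t (τ g)).count 1 := by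
  rw [← Multiset.coe_count, ← hτ, Perm.parts_partition, Multiset.count_add,
    Multiset.count_replicate_self, Multiset.count_eq_zero_of_notMem, zero_add, ← Finset.card_compl]
  · congr 1
    ext x
    simp
  · intro h
    exact absurd (Perm.two_le_of_mem_cycleType h) (by norm_num)

theorem cycleType_eq_filter_type (hτ : ∀ g : G, (g : Perm (Fin n)).partition.parts = t (τ g))
    (g : G) : (g : Perm (Fin n)).cycleType = ((t (τ g)).filter (2 ≤ ·) : List ℕ) := by
  rw [← Perm.filter_parts_partition_eq_cycleType, hτ, Multiset.filter_coe]

/-- Column orthogonality turns orthogonality to the rows into vanishing sums over each type. -/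
theorem sum_type_eq_zero [Fintype G] (hinv : ∀ g, τ g⁻¹ = τ g) {s : ℕ} {R : Fin s → Fin r → ℤ}
    {f : G → ℂ} (hf : ∀ a, charInner f (typeFun τ (R a)) = 0) (w : Fin s → ℤ) {i : Fin r}
    {c : ℤ} (hc : c ≠ 0) (hcol : ∀ j, ∑ a, w a * R a i * R a j = if j = i then c else 0) :
    ∑ g with τ g = i, f g = 0 := by
  have h0 : ∀ a, ∑ g, f g * (R a (τ g) : ℂ) = 0 := by
    intro a
    have h := hf a
    rw [charInner, mul_eq_zero] at h
    simpa only [typeFun, hinv] using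
      h.resolve_left (inv_ne_zero (by exact_mod_cast Nat.card_pos.ne'))
  -- By column orthogonality this combination of the rows is c times the indicator function of type
  -- i.
  have h1 : ∑ a, (w a * R a i : ℂ) * ∑ g, f g * (R a (τ g) : ℂ) = 0 := by simp [h0]
  simp only [Finset.mul_sum] at h1
  rw [Finset.sum_comm] at h1
  have h2 : ∀ g : G, ∑ a, (w a * R a i : ℂ) * (f g * (R a (τ g) : ℂ)) =
      if τ g = i then f g * c else 0 := by
    intro g
    have h3 : ∑ a, (w a * R a i : ℂ) * (f g * (R a (τ g) : ℂ)) =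
        f g * ((∑ a, w a * R a i * R a (τ g) : ℤ) : ℂ) := by
      push_cast
      rw [Finset.mul_sum]
      exact Finset.sum_congr rfl fun a _ => by ring
    rw [h3, hcol]
    split_ifs <;> simp
  simp only [h2] at h1
  rw [← Finset.sum_filter, ← Finset.sum_mul, mul_eq_zero] at h1
  exact h1.resolve_right (by exact_mod_cast hc)

/-- On a type consisting of two mutually inverse classes, a class function with zero sum is odd. -/
theorem apply_inv_eq_neg_of_sum_type_eq_zero [Fintype G] (hinv : ∀ g, τ g⁻¹ = τ g) {f : G → ℂ}
    (hf : ∀ g h, IsConj g h → f g = f h) {x : G}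
    (hx : ∀ g, τ g = τ x → IsConj x g ∨ IsConj x⁻¹ g)
    (h0 : ∑ g with τ g = τ x, f g = 0) :
    f x⁻¹ = - f x := by
  have h1 : ∑ g with τ g = τ x, f g = ∑ g with τ g = τ x, f g⁻¹ := by
    refine Finset.sum_bij' (fun g _ => g⁻¹) (fun g _ => g⁻¹) ?_ ?_ ?_ ?_ ?_ <;>
      simp [hinv]
  have hci : ∀ {g h : G}, IsConj g h → IsConj g⁻¹ h⁻¹ := by
    intro g h hgh
    obtain ⟨c, rfl⟩ := isConj_iff.1 hgh
    exact isConj_iff.2 ⟨c, by group⟩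
  -- Inversion preserves the type and exchanges or preserves its two classes, so the summand is
  -- constant on the type and must vanish.
  have h2 : ∑ g with τ g = τ x, (f g + f g⁻¹) = 0 := by
    rw [Finset.sum_add_distrib, ← h1, h0, add_zero]
  rw [Finset.sum_congr rfl (g := fun _ => f x + f x⁻¹), Finset.sum_const, nsmul_eq_mul,
    mul_eq_zero] at h2
  · have hne : (Finset.card {g | τ g = τ x} : ℂ) ≠ 0 := by
      have : x ∈ Finset.univ.filter fun g => τ g = τ x := by simp
      exact_mod_cast (Finset.card_pos.2 ⟨x, this⟩).ne'
    exact eq_neg_of_add_eq_zero_right (h2.resolve_left hne)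
  · intro g hg
    rcases hx g (Finset.mem_filter.1 hg).2 with h | h
    · rw [hf x g h, hf _ _ (hci h)]
    · have h' := hci h
      rw [inv_inv] at h'
      rw [hf _ g h, hf _ _ h', add_comm]

end TypeFunctions

/-- If the squared degrees of some irreducible characters add up to the group order, they are all
the irreducible characters. -/
theorem bijective_of_sum_degree_sq {G : Type} [Group G] [Fintype G] {ι : Type*} [Fintype ι]
    {F : ι → Irr G} (hF : Function.Injective F) (h : ∑ i, (F i).1 1 ^ 2 = Nat.card G) :
    Function.Bijective F := by
  classical
  refine ⟨hF, fun χ => ?_⟩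
  by_contra hχ
  choose d hd hd' using fun χ : Irr G => χ.exists_degree
  have h1 := sum_degree_sq (G := G)
  rw [← h] at h1
  simp only [hd'] at h1
  have h2 : ∑ χ : Irr G, d χ ^ 2 = ∑ i, d (F i) ^ 2 := by exact_mod_cast h1
  rw [← Finset.sum_image (s := Finset.univ) (g := F) (f := fun χ => d χ ^ 2)
    (fun _ _ _ _ h => hF h)] at h2
  have h3 : ∑ χ ∈ Finset.univ.image F, d χ ^ 2 < ∑ χ : Irr G, d χ ^ 2 :=
    Finset.sum_lt_sum_of_subset (Finset.subset_univ _) (Finset.mem_univ χ)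
      (by simpa using hχ) (pow_pos (hd χ) 2) (fun _ _ _ => Nat.zero_le _)
  omega

theorem sum_degree_sq_le {G : Type} [Group G] [Fintype G] {ι : Type*} [Fintype ι]
    {F : ι → Irr G} (hF : Function.Injective F) {d : ι → ℕ} (hd : ∀ i, (F i).1 1 = d i) :
    ∑ i, d i ^ 2 ≤ Nat.card G := by
  classical
  choose e he he' using fun χ : Irr G => χ.exists_degree
  have h1 := sum_degree_sq (G := G)
  simp only [he'] at h1
  have h2 : ∑ χ : Irr G, e χ ^ 2 = Nat.card G := by exact_mod_cast h1
  have h3 : ∀ i, d i = e (F i) := fun i => by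
    have := (hd i).symm.trans (he' (F i))
    exact_mod_cast this
  simp only [h3]
  rw [← h2, ← Finset.sum_image (s := Finset.univ) (g := F) (f := fun χ => e χ ^ 2)
    (fun _ _ _ _ h => hF h)]
  exact Finset.sum_le_sum_of_subset (Finset.subset_univ _)

/-! ### Frequencies of the cycle types -/

/-- The admissible cycle types in degree 11, the last of which does not occur. -/
def types11 : Fin 9 → List ℕ :=
  ![[1, 1, 1, 1, 1, 1, 1, 1, 1, 1, 1], [2, 2, 2, 2, 1, 1, 1], [3, 3, 3, 1, 1], [4, 4, 1, 1, 1],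
    [5, 5, 1], [6, 3, 2], [8, 2, 1], [11], [9, 1, 1]]

/-- The admissible cycle types in degree 12, the last two of which do not occur. -/
def types12 : Fin 16 → List ℕ :=
  ![[1, 1, 1, 1, 1, 1, 1, 1, 1, 1, 1, 1], [2, 2, 2, 2, 1, 1, 1, 1], [2, 2, 2, 2, 2, 2],
    [3, 3, 3, 1, 1, 1], [3, 3, 3, 3], [4, 4, 1, 1, 1, 1], [4, 4, 2, 2], [5, 5, 1, 1],
    [6, 3, 2, 1], [6, 6], [8, 2, 1, 1], [8, 4], [10, 2], [11, 1], [9, 3], [9, 1, 1, 1]]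

/-- Exhaustion over all partitions; the powers m up to 12 suffice. The 9-cycle passes this test and
is removed only by the Burnside equations. -/
theorem exists_eq_types11 : ∀ L ∈ decreasingLists 11 11 11, AdmissibleType 4 13 L →
    ∃ i, L = types11 i := by
  decide +kernel

theorem exists_eq_types12 : ∀ L ∈ decreasingLists 12 12 12, AdmissibleType 5 13 L →
    ∃ i, L = types12 i := by
  decide +kernel

/-- The number of elements of each type in a sharply 4-transitive group of degree 11. -/
def typeCard11 : Fin 8 → ℕ := ![1, 165, 440, 990, 1584, 1320, 1980, 1440]

/-- The number of elements of each type in a sharply 5-transitive group of degree 12. -/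
def typeCard12 : Fin 14 → ℕ :=
  ![1, 495, 396, 1760, 2640, 2970, 2970, 9504, 15840, 7920, 11880, 11880, 9504, 17280]

/-- Nine colour patterns on at most four points give nine linear equations in the nine unknown
frequencies. -/
theorem typeCard11_of_sum_eq {N : Fin 9 → ℕ}
    (hN : ∀ a b c d, a + b + c + d ≤ 4 →
      ∑ i, N i * coloringCount (types11 i) a b c d = 7920) :
    (∀ i : Fin 8, N (Fin.castLE (by norm_num) i) = typeCard11 i) ∧ N 8 = 0 := by
  have ev : ∀ a b c d (v : Fin 9 → ℕ), (∀ i, coloringCount (types11 i) a b c d = v i) →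
      a + b + c + d ≤ 4 → ∑ i, N i * v i = 7920 := by
    intro a b c d v hv h
    simpa only [hv] using hN a b c d h
  have h1 := ev 2 2 0 0
    ![1980, 36, 0, 0, 0, 0, 0, 0, 0] (by decide +kernel) (by norm_num)
  have h2 := ev 1 1 1 0
    ![990, 6, 0, 6, 0, 0, 0, 0, 0] (by decide +kernel) (by norm_num)
  have h3 := ev 3 1 0 0
    ![1320, 24, 6, 0, 0, 0, 0, 0, 0] (by decide +kernel) (by norm_num)
  have h4 := ev 2 1 0 0
    ![495, 15, 0, 3, 0, 0, 1, 0, 0] (by decide +kernel) (by norm_num)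
  have h5 := ev 1 1 0 0
    ![110, 6, 2, 6, 0, 0, 0, 0, 2] (by decide +kernel) (by norm_num)
  have h6 := ev 3 0 0 0
    ![165, 13, 3, 1, 0, 1, 1, 0, 0] (by decide +kernel) (by norm_num)
  have h7 := ev 1 0 0 0
    ![11, 3, 2, 3, 1, 0, 1, 0, 2] (by decide +kernel) (by norm_num)
  have h8 := ev 2 0 0 0
    ![55, 7, 1, 3, 0, 1, 1, 0, 1] (by decide +kernel) (by norm_num)
  have h9 := ev 0 0 0 0
    ![1, 1, 1, 1, 1, 1, 1, 1, 1] (by decide +kernel) (by norm_num)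
  clear ev hN
  simp [Fin.sum_univ_succ] at h1 h2 h3 h4 h5 h6 h7 h8 h9 
  have e0 : N 0 = 1 := by omega
  have e1 : N 1 = 165 := by omega
  have e3 : N 3 = 990 := by omega
  have e2 : N 2 = 440 := by omega
  have e6 : N 6 = 1980 := by omega
  have e8 : N 8 = 0 := by omega
  have e5 : N 5 = 1320 := by omega
  have e4 : N 4 = 1584 := by omega
  have e7 : N 7 = 1440 := by omega
  refine ⟨fun i => ?_, e8⟩
  fin_cases i
  · exact e0
  · exact e1
  · exact e2
  · exact e3
  · exact e4
  · exact e5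
  · exact e6
  · exact e7

/-- The fourteen equations used from patterns on at most five points leave `N 4` and `N 2`
undetermined, within bounds. The patterns (3,3) and (2,2,2) use six points, where the number of
orbits m is unknown, but the bounds leave only m = 2 and m = 3 respectively. -/
theorem typeCard12_of_sum_eq {N : Fin 16 → ℕ}
    (hN : ∀ a b c d, a + b + c + d ≤ 5 →
      ∑ i, N i * coloringCount (types12 i) a b c d = 95040)
    (hN' : ∀ a b c d, ∃ m, ∑ i, N i * coloringCount (types12 i) a b c d = m * 95040) :
    (∀ i : Fin 14, N (Fin.castLE (by norm_num) i) = typeCard12 i) ∧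
      N 15 = 0 ∧ N 14 = 0 := by
  have ev : ∀ a b c d (v : Fin 16 → ℕ), (∀ i, coloringCount (types12 i) a b c d = v i) →
      a + b + c + d ≤ 5 → ∑ i, N i * v i = 95040 := by
    intro a b c d v hv h
    simpa only [hv] using hN a b c d h
  have ev' : ∀ a b c d (v : Fin 16 → ℕ), (∀ i, coloringCount (types12 i) a b c d = v i) →
      ∃ m, ∑ i, N i * v i = m * 95040 := by
    intro a b c d v hv
    simpa only [hv] using hN' a b c d
  have h1 := ev 1 1 1 1
    ![11880, 24, 0, 0, 0, 24, 0, 0, 0, 0, 0, 0, 0, 0, 0, 0] (by decide +kernel) (by norm_num)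
  have h2 := ev 2 1 1 0
    ![5940, 60, 0, 0, 0, 12, 0, 0, 0, 0, 2, 0, 0, 0, 0, 0] (by decide +kernel) (by norm_num)
  have h3 := ev 3 2 0 0
    ![7920, 112, 0, 9, 0, 0, 0, 0, 1, 0, 0, 0, 0, 0, 0, 0] (by decide +kernel) (by norm_num)
  have h4 := ev 1 1 1 0
    ![1320, 24, 0, 6, 0, 24, 0, 0, 0, 0, 0, 0, 0, 0, 0, 6] (by decide +kernel) (by norm_num)
  have h5 := ev 3 1 0 0
    ![1980, 52, 0, 9, 0, 4, 0, 0, 1, 0, 2, 0, 0, 0, 0, 0] (by decide +kernel) (by norm_num)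
  have h6 := ev 2 2 0 0
    ![2970, 66, 30, 0, 0, 6, 2, 0, 0, 0, 2, 0, 0, 0, 0, 0] (by decide +kernel) (by norm_num)
  have h7 := ev 5 0 0 0
    ![792, 40, 0, 9, 0, 8, 0, 2, 1, 0, 0, 0, 0, 0, 0, 0] (by decide +kernel) (by norm_num)
  have h8 := ev 1 1 0 0
    ![132, 12, 0, 6, 0, 12, 0, 2, 0, 0, 2, 0, 0, 0, 0, 6] (by decide +kernel) (by norm_num)
  have h9 := ev 2 1 0 0
    ![660, 28, 0, 3, 0, 12, 0, 0, 1, 0, 2, 0, 0, 0, 0, 3] (by decide +kernel) (by norm_num)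
  have h10 := ev 1 0 0 0
    ![12, 4, 0, 3, 0, 4, 0, 2, 1, 0, 2, 0, 0, 1, 0, 3] (by decide +kernel) (by norm_num)
  have h11 := ev 3 0 0 0
    ![220, 20, 0, 4, 4, 4, 0, 0, 2, 0, 2, 0, 0, 0, 1, 1] (by decide +kernel) (by norm_num)
  have h12 := ev 4 0 0 0
    ![495, 31, 15, 9, 0, 3, 3, 0, 1, 0, 1, 1, 0, 0, 0, 0] (by decide +kernel) (by norm_num)
  have h13 := ev 2 0 0 0
    ![66, 10, 6, 3, 0, 6, 2, 1, 1, 0, 2, 0, 1, 0, 0, 3] (by decide +kernel) (by norm_num)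
  have h14 := ev 0 0 0 0
    ![1, 1, 1, 1, 1, 1, 1, 1, 1, 1, 1, 1, 1, 1, 1, 1] (by decide +kernel) (by norm_num)
  obtain ⟨m0, hm0⟩ := ev' 3 3 0 0
    ![18480, 176, 0, 12, 12, 0, 0, 0, 2, 0, 0, 0, 0, 0, 0, 0] (by decide +kernel)
  obtain ⟨m1, hm1⟩ := ev' 2 2 2 0
    ![83160, 312, 120, 0, 0, 0, 0, 0, 0, 0, 0, 0, 0, 0, 0, 0] (by decide +kernel)
  clear ev hN ev' hN'
  simp [Fin.sum_univ_succ] at h1 h2 h3 h4 h5 h6 h7 h8 h9 h10 h11 h12 h13 h14 hm0 hm1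
  have e0 : N 0 = 1 := by linarith only [h1, h2, h3, h4, h5, h7, h8, h9]
  have e1 : N 1 = 495 := by linarith only [h1, h2, h3, h4, h5, h7, h8, h9]
  have e5 : N 5 = 2970 := by linarith only [h1, e0, e1]
  have e10 : N 10 = 11880 := by linarith only [h2, e0, e1, e5]
  have e3 : N 3 = 1760 := by linarith only [h3, h4, h5, h7, h8, h9, e0, e1, e5, e10]
  have e8 : N 8 = 15840 := by linarith only [h3, e0, e1, e3]
  have e15 : N 15 = 0 := by linarith only [h4, e0, e1, e3, e5]
  have e7 : N 7 = 9504 := by linarith only [h7, e0, e1, e3, e5, e8]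
  have e13 : N 13 = 17280 := by linarith only [h10, e0, e1, e3, e5, e7, e8, e10, e15]
  clear h1 h2 h3 h4 h5 h7 h8 h9 h10
  -- Here 4 N 4 + N 14 = 10560 and 158400 + 12 N 4 is a multiple of 95040, which forces the multiple
  -- 2.
  have e4 : N 4 = 2640 := by
    clear h6 h12 h13 h14 hm1
    omega
  have e14 : N 14 = 0 := by linarith only [h11, e0, e1, e3, e4, e5, e8, e10, e15]
  -- Here 30 N 2 + 2 N 6 = 17820 and 237600 + 120 N 2 is a multiple of 95040, which forces the
  -- multiple 3.
  have e2 : N 2 = 396 := by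
    clear h11 h12 h13 h14 hm0
    omega
  have e6 : N 6 = 2970 := by linarith only [h6, e0, e1, e2, e5, e10]
  have e11 : N 11 = 11880 := by linarith only [h12, e0, e1, e2, e3, e5, e6, e8, e10]
  have e12 : N 12 = 9504 := by linarith only [h13, e0, e1, e2, e3, e5, e6, e7, e8, e10, e15]
  have e9 : N 9 = 7920 := by
    linarith only [h14, e0, e1, e2, e3, e4, e5, e6, e7, e8, e10, e11, e12, e13, e14, e15]
  refine ⟨fun i => ?_, e15, e14⟩
  fin_cases i
  · exact e0
  · exact e1
  · exact e2
  · exact e3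
  · exact e4
  · exact e5
  · exact e6
  · exact e7
  · exact e8
  · exact e9
  · exact e10
  · exact e11
  · exact e12
  · exact e13

/-- In a sharply 4-transitive group of even permutations of 11 points, the elements are distributed
over eight cycle types in a unique way. -/
theorem exists_type11 {G : Subgroup (Perm (Fin 11))} [Fintype G]
    (ha : G ≤ alternatingGroup (Fin 11)) (hG : IsSharplyTransitive G (Fin 11) 4) :
    ∃ τ : G → Fin 8, (∀ g : G, (g : Perm (Fin 11)).partition.parts =
        types11 (Fin.castLE (by norm_num) (τ g))) ∧
      ∀ i, Finset.card {g | τ g = i} = typeCard11 i := by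
  have h1 : ∀ g : G, ∃ i, g.1.partition.parts = types11 i := by
    intro g
    obtain ⟨L, hL, hadm, h⟩ := exists_admissibleType hG ha g.2 13
    obtain ⟨i, rfl⟩ := exists_eq_types11 L hL hadm
    exact ⟨i, h⟩
  choose σ hσ using h1
  have hcard : Nat.card G = 7920 := by rw [hG.card_eq (by norm_num)]; decide
  obtain ⟨hN, h8⟩ := typeCard11_of_sum_eq (N := fun i => Finset.card {g | σ g = i})
    fun a b c d h => by
      rw [← hcard]; exact hG.sum_coloringCount_eq (by norm_num) hσ a b c d h
  have hlt : ∀ g, (σ g).val < 8 := by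
    intro g
    have : (σ g).val ≠ 8 := fun h => by
      rw [Finset.card_eq_zero] at h8
      exact Finset.notMem_empty g (h8 ▸ Finset.mem_filter.2 ⟨Finset.mem_univ g, Fin.ext h⟩)
    omega
  refine ⟨fun g => ⟨σ g, hlt g⟩, hσ, fun i => ?_⟩
  rw [← hN i]
  congr 1
  ext g
  simp [Fin.ext_iff]

/-- In a sharply 5-transitive group of even permutations of 12 points, the elements are distributed
over fourteen cycle types in a unique way. -/
theorem exists_type12 {G : Subgroup (Perm (Fin 12))} [Fintype G]
    (ha : G ≤ alternatingGroup (Fin 12)) (hG : IsSharplyTransitive G (Fin 12) 5) :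
    ∃ τ : G → Fin 14, (∀ g : G, (g : Perm (Fin 12)).partition.parts =
        types12 (Fin.castLE (by norm_num) (τ g))) ∧
      ∀ i, Finset.card {g | τ g = i} = typeCard12 i := by
  have h1 : ∀ g : G, ∃ i, g.1.partition.parts = types12 i := by
    intro g
    obtain ⟨L, hL, hadm, h⟩ := exists_admissibleType hG ha g.2 13
    obtain ⟨i, rfl⟩ := exists_eq_types12 L hL hadm
    exact ⟨i, h⟩
  choose σ hσ using h1
  have hcard : Nat.card G = 95040 := by rw [hG.card_eq (by norm_num)]; decide
  obtain ⟨hN, h15, h14⟩ := typeCard12_of_sum_eq (N := fun i => Finset.card {g | σ g = i})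
    (fun a b c d h => by
      rw [← hcard]; exact hG.sum_coloringCount_eq (by norm_num) hσ a b c d h)
    fun a b c d => by rw [← hcard]; exact exists_sum_coloringCount_eq hσ a b c d
  have hne : ∀ i, Finset.card {g | σ g = i} = 0 → ∀ g, (σ g).val ≠ i.val := by
    intro i hi g h
    rw [Finset.card_eq_zero] at hi
    exact Finset.notMem_empty g (hi ▸ Finset.mem_filter.2 ⟨Finset.mem_univ g, Fin.ext h⟩)
  have hlt : ∀ g, (σ g).val < 14 := by
    intro g
    have h1 : (σ g).val ≠ 15 := hne 15 h15 g
    have h2 : (σ g).val ≠ 14 := hne 14 h14 g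
    omega
  refine ⟨fun g => ⟨σ g, hlt g⟩, hσ, fun i => ?_⟩
  rw [← hN i]
  congr 1
  ext g
  simp [Fin.ext_iff]

/-! ### Elements not conjugate to their inverses -/

section Inverting

variable {α : Type*}

/-- The orbit of p lies in T and has at least as many points, so it is all of T. -/
theorem exists_pow_apply_eq_of_card_le [DecidableEq α] (g : Perm α) {p : α} {T : Finset α}
    (hT : ∀ j : ℕ, (g ^ j) p ∈ T) (hc : T.card ≤ Function.minimalPeriod g p) {q : α} (hq : q ∈ T) :
    ∃ j : ℕ, (g ^ j) p = q := by
  have h1 : ((Finset.range (Function.minimalPeriod g p)).image fun j => (g ^ j) p) = T := by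
    refine Finset.eq_of_subset_of_card_le ?_ ?_
    · intro a ha
      obtain ⟨j, -, rfl⟩ := Finset.mem_image.1 ha
      exact hT j
    · rw [Finset.card_image_of_injOn, Finset.card_range]
      · exact hc
      · intro i hi j hj hij
        simp only [← Perm.iterate_eq_pow] at hij
        exact Function.iterate_injOn_Iio_minimalPeriod (by simpa using hi) (by simpa using hj) hij
  rw [← h1] at hq
  obtain ⟨j, -, hj⟩ := Finset.mem_image.1 hq
  exact ⟨j, hj⟩

theorem inverting_pow_apply {s x : Perm α} (hs : s * x * s⁻¹ = x⁻¹) (j : ℕ) (p : α) :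
    s ((x ^ j) p) = (x⁻¹ ^ j) (s p) := by
  have h : s * x ^ j * s⁻¹ = x⁻¹ ^ j := by rw [← hs, conj_pow]
  rw [← h]
  simp

theorem inverting_pow_mul {h x : Perm α} (hs : h * x * h⁻¹ = x⁻¹) (j : ℕ) :
    (x⁻¹ ^ j * h) * x * (x⁻¹ ^ j * h)⁻¹ = x⁻¹ := by
  calc (x⁻¹ ^ j * h) * x * (x⁻¹ ^ j * h)⁻¹ = x⁻¹ ^ j * (h * x * h⁻¹) * (x⁻¹ ^ j)⁻¹ := by group
    _ = x⁻¹ := by rw [hs]; group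

/-- On an x-orbit that it preserves, an inverting element acts as a reflection of a dihedral group.
-/
theorem inverting_sq_apply {s x : Perm α} (hs : s * x * s⁻¹ = x⁻¹) {i : ℕ} {p : α}
    (hp : s p = (x ^ i) p) : s (s p) = p := by
  rw [hp, inverting_pow_apply hs, hp, ← Perm.mul_apply, inv_pow, inv_mul_cancel, Perm.one_apply]

theorem inverting_mem_fixed {s x : Perm α} (hs : s * x * s⁻¹ = x⁻¹) (j : ℕ) {p : α} :
    (x ^ j) (s p) = s p ↔ (x ^ j) p = p := by
  have h := inverting_pow_apply hs j p
  rw [inv_pow, Perm.eq_inv_iff_eq] at h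
  constructor
  · intro h1
    exact s.injective ((x ^ j).injective (h.trans h1.symm))
  · intro h1
    rwa [h1] at h

end Inverting

/-- An involution inverting an element of order 11 fixes exactly one point of its long cycle. -/
theorem IsSharplyTransitive.not_isConj_inv_of_orderOf_eq_eleven {n k : ℕ}
    {G : Subgroup (Perm (Fin n))} (hG : IsSharplyTransitive G (Fin n) k) (hk : k ≤ 11)
    (hinv : ∀ s : G, orderOf s = 2 → Finset.card {q | s.1 q = q} = 0 ∨
      n < 10 + Finset.card {q | s.1 q = q})
    {x : G} (hx : orderOf x = 11) (hfix : n = 11 + Finset.card {q | x.1 q = q}) :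
    ¬ IsConj x x⁻¹ := by
  intro hconj
  obtain ⟨h, hh⟩ := isConj_iff.1 hconj
  have hh' : h.1 * x.1 * h.1⁻¹ = x.1⁻¹ := congrArg Subtype.val hh
  have hx1 : x.1 ^ 11 = 1 := by
    have := pow_orderOf_eq_one x
    rw [hx] at this
    exact congrArg Subtype.val this
  have hxne : x.1 ≠ 1 := fun h => by
    have : x = 1 := Subtype.ext h
    rw [this, orderOf_one] at hx
    omega
  obtain ⟨p, hp⟩ : ∃ p, x.1 p ≠ p := by
    by_contra! hcon
    exact hxne (Equiv.ext hcon)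
  have hper : Function.minimalPeriod x.1 p = 11 := by
    have : Fact (Nat.Prime 11) := ⟨by norm_num⟩
    refine Function.minimalPeriod_eq_prime ?_ hp
    rw [Function.IsPeriodicPt, Function.IsFixedPt, Perm.iterate_eq_pow, hx1, Perm.one_apply]
  have hTc : Finset.card {q | ¬ x.1 q = q} = 11 := by
    have := Finset.card_filter_add_card_filter_not (s := (Finset.univ : Finset (Fin n)))
      (fun q => x.1 q = q)
    simp only [Finset.card_univ, Fintype.card_fin] at this
    omega
  have hmem : ∀ {q}, x.1 q ≠ q → ∃ j : ℕ, (x.1 ^ j) p = q := by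
    intro q hq
    refine exists_pow_apply_eq_of_card_le x.1 (T := {q | ¬ x.1 q = q}) (fun j => ?_)
      (by rw [hper, hTc]) (by simpa using hq)
    simp only [Finset.mem_filter, Finset.mem_univ, true_and]
    rw [← Perm.mul_apply, ← pow_succ', pow_succ, Perm.mul_apply, (x.1 ^ j).injective.eq_iff]
    exact hp
  have hhp : x.1 (h.1 p) ≠ h.1 p := by
    have := (inverting_mem_fixed hh' 1 (p := p)).not
    simpa using this.2 hp
  obtain ⟨i, hi⟩ := hmem hhp
  -- Correcting h by a power of x keeps it inverting and makes it fix p.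
  set s : G := x⁻¹ ^ i * h with hs
  have hsx : s.1 * x.1 * s.1⁻¹ = x.1⁻¹ := inverting_pow_mul hh' i
  have hsp : s.1 p = p := by
    change (x.1⁻¹ ^ i * h.1) p = p
    rw [Perm.mul_apply, ← hi, ← Perm.mul_apply, inv_pow, inv_mul_cancel, Perm.one_apply]
  have hsj : ∀ j : ℕ, s.1 ((x.1 ^ j) p) = (x.1⁻¹ ^ j) p := fun j => by
    rw [inverting_pow_apply hsx, hsp]
  -- The square fixes all eleven points of the long cycle, and k ≤ 11.
  have hs2 : s.1 * s.1 = 1 := by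
    refine hG.eq_one_of_fixed (S := {q | ¬ x.1 q = q}) (by omega) (G.mul_mem s.2 s.2) fun q hq => ?_
    obtain ⟨j, rfl⟩ := hmem (by simpa using hq)
    have h3 : s.1 * x.1⁻¹ * s.1⁻¹ = x.1⁻¹⁻¹ := by rw [← conj_inv, hsx]
    rw [Perm.mul_apply, hsj, inverting_pow_apply h3, hsp, inv_inv]
  have hx2 : ∀ j : ℕ, (x.1⁻¹ ^ j) p = (x.1 ^ j) p → (x.1 ^ j) p = p := by
    intro j hj
    have h4 : (x.1 ^ (2 * j)) p = p := by
      rw [two_mul, pow_add, Perm.mul_apply, ← hj, ← Perm.mul_apply, inv_pow, mul_inv_cancel,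
        Perm.one_apply]
    have h5 : Function.minimalPeriod x.1 p ∣ 2 * j := by
      rw [← Function.isPeriodicPt_iff_minimalPeriod_dvd, Function.IsPeriodicPt, Function.IsFixedPt,
        Perm.iterate_eq_pow, h4]
    rw [hper, Nat.Coprime.dvd_mul_left (by norm_num)] at h5
    obtain ⟨l, rfl⟩ := h5
    rw [pow_mul, hx1, one_pow, Perm.one_apply]
  have hs1 : s ≠ 1 := by
    intro h1
    have := hsj 1
    rw [h1] at this
    have h6 := hx2 1 (by simpa using this.symm)
    exact hp (by simpa using h6)
  have hs2' : orderOf s = 2 :=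
    orderOf_eq_prime (by rw [pow_two]; exact Subtype.ext hs2) hs1
  -- As 11 is odd, s fixes only p on the long cycle. So it has at least one and at most n - 10 fixed
  -- points, against `hinv`.
  have hle : ({q | s.1 q = q} : Finset (Fin n)) ⊆
      (Finset.univ.filter fun q => x.1 q = q) ∪ {p} := by
    intro q hq
    simp only [Finset.mem_filter, Finset.mem_univ, true_and, Finset.mem_union,
      Finset.mem_singleton] at hq ⊢
    by_contra! hcon
    obtain ⟨j, rfl⟩ := hmem hcon.1
    rw [hsj] at hq
    exact hcon.2 (hx2 j hq)
  have hle' := (Finset.card_le_card hle).trans (Finset.card_union_le _ _)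
  rw [Finset.card_singleton] at hle'
  have hpos : 0 < Finset.card {q | s.1 q = q} := Finset.card_pos.2 ⟨p, by simpa using hsp⟩
  have := hinv s hs2'
  omega

theorem exists_perm_image_eq {n : ℕ} {S T : Finset (Fin n)} (h : S.card = T.card) :
    ∃ π : Perm (Fin n), ∀ q, π q ∈ T ↔ q ∈ S := by
  have e : {q // q ∈ S} ≃ {q // q ∈ T} := Fintype.equivOfCardEq (by simpa using h)
  refine ⟨e.extendSubtype, fun q => ⟨fun hq => ?_, fun hq => e.extendSubtype_mem q hq⟩⟩
  by_contra hcon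
  exact e.extendSubtype_not_mem q hcon hq

/-- If there are at most as many elements of a type as sets of `m ≤ k` points, where `m` is the
number of fixed points, then an element of this type is determined by its fixed points. -/
theorem IsSharplyTransitive.eq_of_fixed_eq {n k m : ℕ} {G : Subgroup (Perm (Fin n))}
    (hG : IsSharplyTransitive G (Fin n) k) (hk : k ≤ n) (hm : m ≤ k) {C : Finset G}
    (hC : C.card ≤ n.choose m) (hconj : ∀ g ∈ C, ∀ h, h * g * h⁻¹ ∈ C)
    (hfix : ∀ g ∈ C, Finset.card {q | g.1 q = q} = m) {g g' : G} (hg : g ∈ C) (hg' : g' ∈ C)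
    (h : ∀ q, g.1 q = q ↔ g'.1 q = q) : g = g' := by
  -- Conjugation in G moves the fixed-point set to any m-subset, so taking fixed points maps C onto
  -- the m-subsets; by the bound on C the map is injective.
  refine Finset.inj_on_of_surj_on_of_card_le (s := C)
    (t := (Finset.univ : Finset (Fin n)).powersetCard m) (fun g _ => {q | g.1 q = q})
    (fun g hg => by simpa [Finset.mem_powersetCard] using hfix g hg) (fun T hT => ?_)
    (by simpa using hC) hg hg' (by ext q; simpa using h q)
  have hT' := (Finset.mem_powersetCard.1 hT).2
  obtain ⟨π, hπ⟩ := exists_perm_image_eq ((hfix g hg).trans hT'.symm)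
  obtain ⟨u, hu⟩ := hG.exists_eq_on hk (S := {q | g.1 q = q}) (by rw [hfix g hg]; exact hm) π
  refine ⟨u * g * u⁻¹, hconj g hg u, Finset.eq_of_subset_of_card_le ?_ ?_ |>.symm⟩
  · intro q hq
    have h1 : π (π⁻¹ q) ∈ T := by simpa using hq
    rw [hπ] at h1
    have h2 := hu _ h1
    rw [(show π (π⁻¹ q) = q from π.apply_symm_apply q)] at h2
    have h3 : u.1⁻¹ q = π⁻¹ q := by rw [Perm.inv_eq_iff_eq, h2]
    have h4 : g.1 (π⁻¹ q) = π⁻¹ q := by simpa using h1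
    simp only [Finset.mem_filter, Finset.mem_univ, true_and]
    change u.1 (g.1 (u.1⁻¹ q)) = q
    rw [h3, h4, h2]
  · rw [hT', hfix _ (hconj g hg u)]

/-- The elements y² and y⁴ have the same three fixed points a, b, y b. An inverting element fixes a,
and after correction by y⁻¹ also b and y b. It reflects the remaining 8-cycle, so its square fixes
four points and is trivial. It is then an involution with the fixed points of y⁴, hence equal to y⁴,
which commutes with y. -/
theorem IsSharplyTransitive.not_isConj_inv_of_orderOf_eq_eight {G : Subgroup (Perm (Fin 11))}
    (hG : IsSharplyTransitive G (Fin 11) 4)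
    (hinv : ∀ s s' : G, orderOf s = 2 → orderOf s' = 2 →
      (∀ q, s.1 q = q ↔ s'.1 q = q) → s = s')
    (hinv' : ∀ s : G, orderOf s = 2 → Finset.card {q | s.1 q = q} = 3)
    {y : G} (hy : orderOf y = 8) (h1 : Finset.card {q | y.1 q = q} = 1)
    (h2 : Finset.card {q | (y.1 ^ 2) q = q} = 3) : ¬ IsConj y y⁻¹ := by
  intro hconj
  obtain ⟨h, hh⟩ := isConj_iff.1 hconj
  have hh' : h.1 * y.1 * h.1⁻¹ = y.1⁻¹ := congrArg Subtype.val hh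
  have hy8 : y.1 ^ 8 = 1 := by
    have := pow_orderOf_eq_one y
    rw [hy] at this
    exact congrArg Subtype.val this
  have hy4 : orderOf (y ^ 4) = 2 := by rw [orderOf_pow, hy]; rfl
  have h4 := hinv' _ hy4
  obtain ⟨a, ha⟩ := Finset.card_eq_one.1 h1
  have hfixy : ∀ q, y.1 q = q ↔ q = a := fun q => by
    simpa using Finset.ext_iff.1 ha q
  have hya := (hfixy a).2 rfl
  have hy24 : ∀ q, (y.1 ^ 2) q = q → (y.1 ^ 4) q = q := by
    intro q hq
    rw [show 4 = 2 + 2 from rfl, pow_add, Perm.mul_apply, hq, hq]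
  obtain ⟨b, hb, hba⟩ : ∃ b ∈ ({q | (y.1 ^ 2) q = q} : Finset (Fin 11)), b ≠ a :=
    Finset.exists_mem_ne (by omega) a
  have hb2 : y.1 (y.1 b) = b := by simpa [pow_two] using hb
  have hyb : y.1 b ≠ b := fun h => hba ((hfixy b).1 h)
  have hyba : y.1 b ≠ a := fun h => by
    rw [h, hya] at hb2
    exact hba hb2.symm
  have hS3 : Finset.card {a, b, y.1 b} = 3 :=
    Finset.card_eq_three.2 ⟨a, b, y.1 b, hba.symm, hyba.symm, hyb.symm, rfl⟩
  have hS2 : ({a, b, y.1 b} : Finset (Fin 11)) = Finset.univ.filter fun q => (y.1 ^ 2) q = q := by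
    refine Finset.eq_of_subset_of_card_le ?_ (by omega)
    intro q hq
    simp only [Finset.mem_insert, Finset.mem_singleton] at hq
    rcases hq with rfl | rfl | rfl <;> simp [pow_two, hya, hb2]
  have hS4 : ({a, b, y.1 b} : Finset (Fin 11)) = Finset.univ.filter fun q => (y ^ 4).1 q = q := by
    rw [hS2]
    refine Finset.eq_of_subset_of_card_le ?_ (by omega)
    intro q hq
    simpa using hy24 q (by simpa using hq)
  have hinvert : ∃ s : G, s.1 * y.1 * s.1⁻¹ = y.1⁻¹ ∧ s.1 b = b := by
    have hhb : h.1 b ∈ ({a, b, y.1 b} : Finset (Fin 11)) := by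
      rw [hS2]
      simpa using (inverting_mem_fixed hh' 2 (p := b)).2 (by simpa using hb)
    have hha : h.1 a = a := by
      rw [← hfixy]
      simpa using (inverting_mem_fixed hh' 1 (p := a)).2 (by simpa using hya)
    simp only [Finset.mem_insert, Finset.mem_singleton] at hhb
    rcases hhb with hhb | hhb | hhb
    · exact absurd (h.1.injective (hhb.trans hha.symm)) hba
    · exact ⟨h, hh', hhb⟩
    · refine ⟨y⁻¹ ^ 1 * h, inverting_pow_mul hh' 1, ?_⟩
      change (y.1⁻¹ ^ 1 * h.1) b = b
      rw [Perm.mul_apply, hhb, pow_one, show y.1⁻¹ (y.1 b) = b from y.1.symm_apply_apply b]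
  obtain ⟨s, hsy, hsb⟩ := hinvert
  have hsa : s.1 a = a := by
    rw [← hfixy]
    simpa using (inverting_mem_fixed hsy 1 (p := a)).2 (by simpa using hya)
  have hsyb : s.1 (y.1 b) = y.1 b := by
    have := inverting_pow_apply hsy 1 b
    rw [pow_one, pow_one, hsb] at this
    rw [this, Perm.inv_eq_iff_eq, hb2]
  have hsS : ∀ q ∈ ({a, b, y.1 b} : Finset (Fin 11)), s.1 q = q := by
    intro q hq
    simp only [Finset.mem_insert, Finset.mem_singleton] at hq
    rcases hq with rfl | rfl | rfl <;> assumption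
  obtain ⟨p, hp⟩ : ∃ p, p ∉ ({a, b, y.1 b} : Finset (Fin 11)) := by
    by_contra! hcon
    rw [Finset.eq_univ_of_forall hcon] at hS3
    simp at hS3
  have hp4 : ¬ (y.1 ^ 4) p = p := by
    rw [hS4] at hp
    simpa using hp
  -- The eight points outside the triple form one cycle: y⁸ fixes p but y⁴ does not.
  have hper : Function.minimalPeriod y.1 p = 2 ^ (2 + 1) := by
    refine Function.minimalPeriod_eq_prime_pow ?_ ?_
    · rw [Function.IsPeriodicPt, Function.IsFixedPt, Perm.iterate_eq_pow]
      exact hp4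
    · rw [Function.IsPeriodicPt, Function.IsFixedPt, Perm.iterate_eq_pow]
      norm_num [hy8]
  have hcomm : ∀ j : ℕ, ¬ (y.1 ^ 4) ((y.1 ^ j) p) = (y.1 ^ j) p := by
    intro j
    rw [← Perm.mul_apply, ← pow_add, add_comm, pow_add, Perm.mul_apply,
      (y.1 ^ j).injective.eq_iff]
    exact hp4
  have hTc : Finset.card {q | ¬ (y.1 ^ 4) q = q} = 8 := by
    have := Finset.card_filter_add_card_filter_not (s := (Finset.univ : Finset (Fin 11)))
      (fun q => (y.1 ^ 4) q = q)
    have h4' : Finset.card {q | (y.1 ^ 4) q = q} = 3 := h4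
    simp only [Finset.card_univ, Fintype.card_fin] at this
    omega
  obtain ⟨i, hi⟩ : ∃ j : ℕ, (y.1 ^ j) p = s.1 p := by
    refine exists_pow_apply_eq_of_card_le y.1 (T := {q | ¬ (y.1 ^ 4) q = q}) (fun j => ?_)
      (by rw [hper, hTc]; norm_num) ?_
    · simpa using hcomm j
    · simpa using (inverting_mem_fixed hsy 4 (p := p)).not.2 hp4
  have hs2 : s.1 * s.1 = 1 := by
    refine hG.eq_one_of_fixed (S := insert p {a, b, y.1 b})
      (by rw [Finset.card_insert_of_notMem hp, hS3]) (G.mul_mem s.2 s.2) fun q hq => ?_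
    rw [Perm.mul_apply]
    rcases Finset.mem_insert.1 hq with rfl | hq
    · exact inverting_sq_apply hsy hi.symm
    · rw [hsS q hq, hsS q hq]
  have hyne : y.1 ≠ y.1⁻¹ := by
    intro hyy
    have : y ^ 2 = 1 := Subtype.ext (by
      change y.1 ^ 2 = 1
      rw [pow_two]
      nth_rewrite 2 [hyy]
      exact mul_inv_cancel _)
    have := orderOf_dvd_of_pow_eq_one this
    rw [hy] at this
    omega
  have hs1 : s ≠ 1 := by
    rintro rfl
    exact hyne (by simpa using hsy)
  have hso : orderOf s = 2 :=
    orderOf_eq_prime (by rw [pow_two]; exact Subtype.ext hs2) hs1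
  have hSs : ({a, b, y.1 b} : Finset (Fin 11)) = Finset.univ.filter fun q => s.1 q = q := by
    refine Finset.eq_of_subset_of_card_le (fun q hq => by simpa using hsS q hq) ?_
    rw [hS3, hinv' s hso]
  have hsy4 : s = y ^ 4 := by
    refine hinv s _ hso hy4 fun q => ?_
    have := Finset.ext_iff.1 (hSs.symm.trans hS4) q
    simpa using this
  apply hyne
  rw [← hsy, hsy4]
  change y.1 = y.1 ^ 4 * y.1 * (y.1 ^ 4)⁻¹
  group

/-! ### Scalar products by type and norm-two virtual characters -/

section TypeFun

variable {G : Type} [Group G] [Fintype G] {r : ℕ} {τ : G → Fin r} {N : Fin r → ℕ}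

theorem charInner_eq_of_mul_eq (hN : ∀ i, Finset.card {g | τ g = i} = N i) {f h : G → ℂ}
    {P : Fin r → ℂ} (hP : ∀ g, f g * h g⁻¹ = P (τ g)) :
    charInner f h = (∑ i, N i * P i) / Nat.card G := by
  rw [charInner, div_eq_inv_mul]
  congr 1
  simp only [hP]
  rw [sum_type_eq τ P]
  simp only [hN]

theorem charInner_typeFun (hN : ∀ i, Finset.card {g | τ g = i} = N i) (hinv : ∀ g, τ g⁻¹ = τ g)
    {v w : Fin r → ℤ} {c : ℤ} (h : ∑ i, N i * (v i * w i) = Nat.card G * c) :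
    charInner (typeFun τ v) (typeFun τ w) = c := by
  rw [charInner_eq_of_mul_eq hN (P := fun i => v i * w i) fun g => by simp [typeFun, hinv],
    div_eq_iff (by exact_mod_cast Nat.card_pos.ne'), mul_comm]
  exact_mod_cast h

theorem sum_coeff_mul_eq (hN : ∀ i, Finset.card {g | τ g = i} = N i) (hinv : ∀ g, τ g⁻¹ = τ g)
    {v w : Fin r → ℤ} {n m : Irr G → ℤ} (hn : typeFun τ v = ∑ χ, (n χ : ℂ) • χ.1)
    (hm : typeFun τ w = ∑ χ, (m χ : ℂ) • χ.1) {c : ℤ}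
    (h : ∑ i, N i * (v i * w i) = Nat.card G * c) : ∑ χ, n χ * m χ = c := by
  have h1 := charInner_typeFun hN hinv h
  rw [hn, hm, charInner_sum_coeff] at h1
  exact_mod_cast h1

theorem Irr.mem_virtualCharacters {G : Type} [Group G] (χ : Irr G) : χ.1 ∈ virtualCharacters G :=
  Submodule.subset_span ⟨χ, rfl⟩

theorem irr_ne_of_charInner_eq_zero {χ ψ : Irr G} (h : charInner χ.1 ψ.1 = 0) : χ ≠ ψ := by
  classical
  rintro rfl
  rw [charInner_irr, if_pos rfl] at h
  exact one_ne_zero h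

/-- A virtual character of norm two that is orthogonal to some irreducible characters consists of
two other irreducible characters. -/
theorem exists_pair_notMem_range {ι : Type*} (F : ι → Irr G) {f : G → ℂ}
    (hf : f ∈ virtualCharacters G) (h2 : charInner f f = 2) (h0 : ∀ i, charInner f (F i).1 = 0) :
    ∃ (χ ψ : Irr G) (a b : ℤ), χ ≠ ψ ∧ (a = 1 ∨ a = -1) ∧ (b = 1 ∨ b = -1) ∧
      f = (a : ℂ) • χ.1 + (b : ℂ) • ψ.1 ∧ (∀ i, F i ≠ χ) ∧ ∀ i, F i ≠ ψ := by
  classical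
  obtain ⟨χ, ψ, a, b, hne, ha, hb, rfl⟩ := exists_pair_of_charInner_eq_two hf h2
  have ha' : (a : ℂ) ≠ 0 := by rcases ha with rfl | rfl <;> norm_num
  have hb' : (b : ℂ) ≠ 0 := by rcases hb with rfl | rfl <;> norm_num
  refine ⟨χ, ψ, a, b, hne, ha, hb, rfl, ?_, ?_⟩
  · rintro i rfl
    have := h0 i
    rw [charInner_add_left, charInner_smul_left, charInner_smul_left, charInner_irr, charInner_irr,
      if_pos rfl, if_neg hne.symm, mul_one, mul_zero, add_zero] at this
    exact ha' this
  · rintro i rfl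
    have := h0 i
    rw [charInner_add_left, charInner_smul_left, charInner_smul_left, charInner_irr, charInner_irr,
      if_pos rfl, if_neg hne, mul_one, mul_zero, zero_add] at this
    exact hb' this

/-- Two irreducible characters whose difference or sum has degree `2 * d`, with squared degrees
adding up to at most `2 * d ^ 2`, both have degree `d`. -/
theorem degree_eq_of_sum_sq_le {a b : ℤ} (ha : a = 1 ∨ a = -1) (hb : b = 1 ∨ b = -1) {d d' e : ℕ}
    (h : a * d + b * d' = 2 * e) (hle : d ^ 2 + d' ^ 2 ≤ 2 * e ^ 2) (hd : 0 < d) (hd' : 0 < d') :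
    a = 1 ∧ b = 1 ∧ d = e ∧ d' = e := by
  zify at hle hd hd'
  -- For the sign pattern (+,+) the right side is zero; the other patterns make a degree too large
  -- or the sum negative.
  have hsq : (d - e : ℤ) ^ 2 + (d' - e) ^ 2 ≤ 2 * e * (2 * e - d - d') := by nlinarith
  have he : (0 : ℤ) ≤ e := by positivity
  rcases ha with rfl | rfl <;> rcases hb with rfl | rfl
  · have h1 : (d : ℤ) = e := by nlinarith [sq_nonneg (d' - e : ℤ)]
    have h2 : (d' : ℤ) = e := by linarith
    exact ⟨rfl, rfl, by exact_mod_cast h1, by exact_mod_cast h2⟩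
  · exfalso
    have h1 : (d : ℤ) = 2 * e + d' := by linarith
    rw [h1] at hle
    nlinarith
  · exfalso
    have h1 : (d' : ℤ) = 2 * e + d := by linarith
    rw [h1] at hle
    nlinarith
  · exfalso
    linarith

end TypeFun

/-! ### Degree 12: virtual characters -/

/-- The rows of the character table in degree 12 as functions of the cycle type; the two rows with
irrational entries are replaced by their sum. -/
def rows12 : Fin 14 → Fin 14 → ℤ :=
  ![![1, 1, 1, 1, 1, 1, 1, 1, 1, 1, 1, 1, 1, 1],
    ![11, 3, -1, 2, -1, 3, -1, 1, 0, -1, 1, -1, -1, 0],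
    ![11, 3, -1, 2, -1, -1, 3, 1, 0, -1, -1, 1, -1, 0],
    ![32, 0, 8, -4, 2, 0, 0, 2, 0, 2, 0, 0, -2, -1],
    ![45, -3, 5, 0, 3, 1, 1, 0, 0, -1, -1, -1, 0, 1],
    ![54, 6, 6, 0, 0, 2, 2, -1, 0, 0, 0, 0, 1, -1],
    ![55, 7, -5, 1, 1, -1, -1, 0, 1, 1, -1, -1, 0, 0],
    ![55, -1, -5, 1, 1, 3, -1, 0, -1, 1, -1, 1, 0, 0],
    ![55, -1, -5, 1, 1, -1, 3, 0, -1, 1, 1, -1, 0, 0],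
    ![66, 2, 6, 3, 0, -2, -2, 1, -1, 0, 0, 0, 1, 0],
    ![99, 3, -1, 0, 3, -1, -1, -1, 0, -1, 1, 1, -1, 0],
    ![120, -8, 0, 3, 0, 0, 0, 0, 1, 0, 0, 0, 0, -1],
    ![144, 0, 4, 0, -3, 0, 0, -1, 0, 1, 0, 0, -1, 1],
    ![176, 0, -4, -4, -1, 0, 0, 1, 0, -1, 0, 0, 1, 0]]

/-- The norms of `rows12`. -/
def norms12 : Fin 14 → ℤ := ![1, 1, 1, 2, 1, 1, 1, 1, 1, 1, 1, 1, 1, 1]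

/-- Combinations of numbers of colourings that span a lattice of determinant four. -/
def starCombs12 : Fin 6 → List (ℤ × ℕ × ℕ × ℕ × ℕ) :=
  ![
    [(-1, 0, 0, 0, 0), (1, 1, 0, 0, 0), (-2, 1, 1, 0, 0), (-1, 3, 0, 0, 0), (2, 2, 1, 0, 0),
     (-1, 5, 0, 0, 0), (1, 6, 0, 0, 0), (1, 3, 1, 0, 0), (-1, 2, 2, 0, 0)],
    [(-1, 1, 0, 0, 0), (1, 2, 0, 0, 0), (1, 3, 0, 0, 0), (-1, 4, 0, 0, 0), (-1, 2, 1, 0, 0), (1,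
     5, 0, 0, 0)],
    [(-1, 2, 0, 0, 0), (1, 3, 0, 0, 0)],
    [(1, 2, 0, 0, 0), (-1, 1, 1, 0, 0), (-1, 4, 0, 0, 0), (1, 5, 0, 0, 0)],
    [(-1, 0, 0, 0, 0), (1, 1, 0, 0, 0), (-2, 1, 1, 0, 0), (-1, 3, 0, 0, 0), (1, 2, 1, 0, 0), (1,
     6, 0, 0, 0), (1, 3, 1, 0, 0), (-1, 2, 2, 0, 0)],
    [(1, 0, 0, 0, 0), (-1, 1, 0, 0, 0), (-1, 1, 1, 0, 0), (-1, 3, 0, 0, 0), (-4, 4, 0, 0, 0),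
     (2, 2, 1, 0, 0), (7, 5, 0, 0, 0), (1, 6, 0, 0, 0), (1, 3, 1, 0, 0), (1, 2, 2, 0, 0), (-4,
     5, 1, 0, 0), (1, 1, 1, 1, 1)]]

/-- The values of `starCombs12` on the cycle types. -/
def star12 : Fin 6 → Fin 14 → ℤ :=
  ![rows12 6 - rows12 9, rows12 6 - rows12 12, rows12 6 + rows12 10, rows12 6 + rows12 13,
    2 • rows12 6 + rows12 2, 2 • rows12 6 - rows12 2]

/-- The scalar products of `star12`. -/
def starGram12 : Matrix (Fin 6) (Fin 6) ℤ :=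
  !![2, 1, 1, 1, 2, 2;
    1, 2, 1, 1, 2, 2;
    1, 1, 2, 1, 2, 2;
    1, 1, 1, 2, 2, 2;
    2, 2, 2, 2, 5, 3;
    2, 2, 2, 2, 3, 5]

/-- Combinations of numbers of colourings that agree with `rows12` up to multiples of row 6. -/
def combs12 : Fin 14 → List (ℤ × ℕ × ℕ × ℕ × ℕ) :=
  ![
    [(1, 0, 0, 0, 0)],
    [(-1, 0, 0, 0, 0), (1, 1, 0, 0, 0)],
    [(-1, 0, 0, 0, 0), (1, 1, 0, 0, 0), (-2, 1, 1, 0, 0), (-1, 3, 0, 0, 0), (1, 2, 1, 0, 0), (1,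
     6, 0, 0, 0), (1, 3, 1, 0, 0), (-1, 2, 2, 0, 0)],
    [(-1, 1, 0, 0, 0), (-2, 2, 0, 0, 0), (-2, 3, 0, 0, 0), (-2, 4, 0, 0, 0), (5, 2, 1, 0, 0),
     (5, 5, 0, 0, 0), (2, 6, 0, 0, 0), (-2, 1, 1, 1, 0), (-3, 5, 1, 0, 0), (1, 1, 1, 1, 1)],
    [(-1, 0, 0, 0, 0), (2, 1, 0, 0, 0), (1, 2, 0, 0, 0), (-3, 1, 1, 0, 0), (-2, 4, 0, 0, 0),
     (-2, 2, 1, 0, 0), (1, 5, 0, 0, 0), (1, 6, 0, 0, 0), (2, 1, 1, 1, 0), (2, 3, 1, 0, 0), (-1,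
     5, 1, 0, 0)],
    [(-1, 1, 0, 0, 0), (1, 2, 0, 0, 0)],
    [],
    [(1, 0, 0, 0, 0), (-1, 1, 0, 0, 0), (-1, 2, 0, 0, 0), (1, 1, 1, 0, 0)],
    [(-1, 0, 0, 0, 0), (1, 1, 0, 0, 0), (1, 2, 0, 0, 0), (-2, 1, 1, 0, 0), (-2, 3, 0, 0, 0),
     (-2, 4, 0, 0, 0), (-1, 5, 0, 0, 0), (2, 6, 0, 0, 0), (1, 1, 1, 1, 0), (4, 3, 1, 0, 0), (-1,
     2, 2, 0, 0), (-1, 5, 1, 0, 0)],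
    [(1, 0, 0, 0, 0), (-1, 1, 0, 0, 0), (2, 1, 1, 0, 0), (1, 3, 0, 0, 0), (-2, 2, 1, 0, 0), (1,
     5, 0, 0, 0), (-1, 6, 0, 0, 0), (-1, 3, 1, 0, 0), (1, 2, 2, 0, 0)],
    [(-1, 2, 0, 0, 0), (1, 3, 0, 0, 0)],
    [(-1, 1, 0, 0, 0), (-1, 1, 1, 0, 0), (-1, 3, 0, 0, 0), (-2, 4, 0, 0, 0), (3, 2, 1, 0, 0),
     (6, 5, 0, 0, 0), (1, 6, 0, 0, 0), (-1, 1, 1, 1, 0), (-3, 5, 1, 0, 0), (1, 1, 1, 1, 1)],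
    [(1, 1, 0, 0, 0), (-1, 2, 0, 0, 0), (-1, 3, 0, 0, 0), (1, 4, 0, 0, 0), (1, 2, 1, 0, 0), (-1,
     5, 0, 0, 0)],
    [(1, 2, 0, 0, 0), (-1, 1, 1, 0, 0), (-1, 4, 0, 0, 0), (1, 5, 0, 0, 0)]]

/-- The multiples of row 6 that separate `combs12` from `rows12`. -/
def shifts12 : Fin 14 → ℤ := ![0, 0, -2, -2, -2, 0, 1, 0, -2, 1, -1, -2, 1, -1]

theorem colorComb_starCombs12 : ∀ a i,
    colorComb (starCombs12 a) (types12 (Fin.castLE (by norm_num) i)) = star12 a i := by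
  decide +kernel

theorem colorComb_combs12 : ∀ a i,
    colorComb (combs12 a) (types12 (Fin.castLE (by norm_num) i)) =
      rows12 a i - shifts12 a * rows12 6 i := by
  decide +kernel

theorem sum_star12_mul : ∀ a b, ∑ i, (typeCard12 i : ℤ) * (star12 a i * star12 b i) =
    95040 * starGram12 a b := by
  decide +kernel

theorem sum_rows12_mul : ∀ a b, ∑ i, (typeCard12 i : ℤ) * (rows12 a i * rows12 b i) =
    95040 * if a = b then norms12 a else 0 := by
  decide +kernel

/-- Column orthogonality weights each row by the reciprocal of its norm; everything is doubled to
stay integral, as row 3 has norm two. -/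
theorem sum_rows12_mul_rows12 : ∀ i j, ∑ a, (if a = 3 then 1 else 2) * rows12 a i * rows12 a j =
    if j = i then 2 * 95040 / (typeCard12 i : ℤ) else 0 := by
  decide +kernel

/-- The colour combinations `star12` are row 6 plus or minus another row, and twice row 6 plus or
minus row 2. Their Gram matrix is that of `exists_eq_single_of_star`. The last two add up to four
times row 6, so row 6 is an irreducible character up to sign. -/
theorem typeFun_rows12_six_mem {G : Subgroup (Perm (Fin 12))} [Fintype G] {τ : G → Fin 14}
    (hτ : ∀ g : G, (g : Perm (Fin 12)).partition.parts = types12 (Fin.castLE (by norm_num) (τ g)))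
    (hN : ∀ i, Finset.card {g | τ g = i} = typeCard12 i) (hcard : Nat.card G = 95040)
    (hinv : ∀ g, τ g⁻¹ = τ g) :
    typeFun τ (rows12 6) ∈ virtualCharacters G := by
  classical
  choose n hn using fun a => exists_coeff_of_mem_virtualCharacters
    (type_mem_virtualCharacters (t := fun i => types12 (Fin.castLE (by norm_num) i)) hτ
      (starCombs12 a) (colorComb_starCombs12 a))
  have hgram : ∀ a b, ∑ χ, n a χ * n b χ = starGram12 a b := fun a b =>
    sum_coeff_mul_eq hN hinv (hn a) (hn b) (by rw [hcard]; exact sum_star12_mul a b)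
  obtain ⟨p, hp, h0⟩ := exists_eq_single_of_star
    (x := fun a : Fin 4 => n (Fin.castLE (by norm_num) a))
    (y := n 4) (z := n 5)
    (fun a b => by rw [hgram]; revert a b; decide)
    (fun a => by rw [hgram]; revert a; decide) (fun a => by rw [hgram]; revert a; decide)
    (by rw [hgram]; decide) (by rw [hgram]; decide) (by rw [hgram]; decide)
  have h1 : (4 : ℂ) • typeFun τ (rows12 6) = ((n 4 p + n 5 p : ℤ) : ℂ) • p.1 := by
    have h2 : typeFun τ (star12 4) + typeFun τ (star12 5) = ((n 4 p + n 5 p : ℤ) : ℂ) • p.1 := by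
      rw [hn, hn, ← Finset.sum_add_distrib, Finset.sum_eq_single p]
      · rw [← add_smul]; push_cast; rfl
      · intro χ _ hχ
        rw [← add_smul]
        have := h0 χ hχ
        rw [show (n 4 χ : ℂ) + n 5 χ = ((n 4 χ + n 5 χ : ℤ) : ℂ) by push_cast; rfl, this]
        simp
      · simp
    rw [← h2]
    ext g
    simp [typeFun, star12]
    ring
  rcases hp with hp | hp
  · convert p.mem_virtualCharacters using 1
    rw [hp] at h1
    refine smul_right_injective (G → ℂ) (r := (4 : ℂ)) (by norm_num) ?_
    simpa using h1
  · convert neg_mem p.mem_virtualCharacters using 1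
    rw [hp] at h1
    refine smul_right_injective (G → ℂ) (r := (4 : ℂ)) (by norm_num) ?_
    simpa using h1

theorem typeFun_rows12_mem {G : Subgroup (Perm (Fin 12))} [Fintype G] {τ : G → Fin 14}
    (hτ : ∀ g : G, (g : Perm (Fin 12)).partition.parts = types12 (Fin.castLE (by norm_num) (τ g)))
    (hN : ∀ i, Finset.card {g | τ g = i} = typeCard12 i) (hcard : Nat.card G = 95040)
    (hinv : ∀ g, τ g⁻¹ = τ g) (a : Fin 14) :
    typeFun τ (rows12 a) ∈ virtualCharacters G := by
  have h1 := type_mem_virtualCharacters (t := fun i => types12 (Fin.castLE (by norm_num) i)) hτ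
      (combs12 a) (colorComb_combs12 a)
  have h2 := (virtualCharacters G).smul_mem (shifts12 a) (typeFun_rows12_six_mem hτ hN hcard hinv)
  convert add_mem h1 h2 using 1
  ext g
  simp [typeFun]

/-- Serves to insert the members of an irrational pair into an injective list of irreducible
characters. -/
theorem Set.InjOn.update_insert {α β : Type*} [DecidableEq α] {f : α → β} {S : Set α} {k : α}
    {b : β} (hf : Set.InjOn f S) (hk : k ∉ S) (hb : ∀ i ∈ S, f i ≠ b) :
    Set.InjOn (Function.update f k b) (insert k S) := by
  have h : ∀ i ∈ S, Function.update f k b i = f i := fun i hi =>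
    Function.update_of_ne (ne_of_mem_of_not_mem hi hk) _ _
  rw [Set.injOn_insert hk]
  refine ⟨fun i hi j hj hij => hf hi hj ?_, ?_⟩
  · rwa [h i hi, h j hj] at hij
  · rintro ⟨i, hi, hij⟩
    rw [h i hi, Function.update_self] at hij
    exact hb i hi hij

/-! ### Odd class functions and the table in degree 12 -/

section Odd

variable {G : Type} [Group G]

theorem eq_zero_of_odd {d : G → ℂ} (hd : ∀ g h, IsConj g h → d g = d h)
    (hodd : ∀ g, d g⁻¹ = - d g) {x : G} (hx : IsConj x x⁻¹) : d x = 0 := by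
  have h := hd _ _ hx
  rw [hodd] at h
  linear_combination h / 2

/-- The scalar product of two odd class functions, when each type consists of the conjugates of an
element and of its inverse. -/
theorem charInner_of_odd [Fintype G] {r : ℕ} {τ : G → Fin r} {N : Fin r → ℕ}
    (hN : ∀ i, Finset.card {g | τ g = i} = N i) {x : Fin r → G}
    (hcl : ∀ g, IsConj (x (τ g)) g ∨ IsConj (x (τ g))⁻¹ g) {d e : G → ℂ}
    (hd : ∀ g h, IsConj g h → d g = d h) (he : ∀ g h, IsConj g h → e g = e h)
    (hdo : ∀ g, d g⁻¹ = - d g) (heo : ∀ g, e g⁻¹ = - e g) :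
    charInner d e = (∑ i, N i * (-(d (x i) * e (x i)))) / Nat.card G := by
  refine charInner_eq_of_mul_eq hN fun g => ?_
  rw [heo]
  rcases hcl g with h | h
  · rw [← hd _ _ h, ← he _ _ h]
    ring
  · rw [← hd _ _ h, ← he _ _ h, hdo, heo]
    ring

end Odd

theorem conjClasses_bijective {G : Type} [Group G] [Finite G] {m : ℕ} {y : Fin m → G}
    (hinj : ∀ i j, IsConj (y i) (y j) → i = j) (hcard : Nat.card (ConjClasses G) ≤ m) :
    Function.Bijective fun i => ConjClasses.mk (y i) := by
  classical
  have : Fintype (ConjClasses G) := Fintype.ofFinite _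
  have hi : Function.Injective fun i => ConjClasses.mk (y i) := fun i j h =>
    hinj i j (ConjClasses.mk_eq_mk_iff_isConj.1 h)
  refine (Fintype.bijective_iff_injective_and_card _).2 ⟨hi, ?_⟩
  have := Fintype.card_le_of_injective _ hi
  rw [Nat.card_eq_fintype_card] at hcard
  rw [Fintype.card_fin] at this ⊢
  omega

theorem sq_eq_neg_eleven {z : ℂ} (hz : z ^ 2 = -11) :
    z = Complex.I * (Real.sqrt 11 : ℝ) ∨ z = -(Complex.I * (Real.sqrt 11 : ℝ)) := by
  refine sq_eq_sq_iff_eq_or_eq_neg.1 ?_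
  rw [hz, mul_pow, Complex.I_sq, ← Complex.ofReal_pow, Real.sq_sqrt (by norm_num)]
  norm_num

theorem sq_eq_neg_eight {z : ℂ} (hz : z ^ 2 = -8) :
    z = 2 * alpha2 ∨ z = -(2 * alpha2) := by
  refine sq_eq_sq_iff_eq_or_eq_neg.1 ?_
  rw [hz, alpha2, mul_pow, mul_pow, Complex.I_sq, ← Complex.ofReal_pow, Real.sq_sqrt (by norm_num)]
  norm_num

theorem conj_alpha2 : conj alpha2 = -alpha2 := by
  simp [alpha2]

theorem charInner_sub_eq_two {G : Type} [Group G] [Fintype G] {χ ψ : Irr G} (h : χ ≠ ψ) :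
    charInner (χ.1 - ψ.1) (χ.1 - ψ.1) = 2 := by
  classical
  simp only [← charForm_apply, map_sub, LinearMap.sub_apply]
  simp only [charForm_apply, charInner_irr, if_pos, if_neg h, if_neg h.symm]
  norm_num

theorem charInner_sub_add {G : Type} [Group G] [Fintype G] {χ ψ : Irr G} :
    charInner (χ.1 - ψ.1) (χ.1 + ψ.1) = 0 := by
  classical
  simp only [← charForm_apply, map_sub, map_add, LinearMap.sub_apply]
  simp only [charForm_apply, charInner_irr, if_pos, eq_comm (a := ψ) (b := χ)]
  ring

theorem charInner_sub_of_ne {G : Type} [Group G] [Fintype G] {χ ψ φ : Irr G} (h : φ ≠ χ)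
    (h' : φ ≠ ψ) : charInner (χ.1 - ψ.1) φ.1 = 0 := by
  classical
  simp only [← charForm_apply, map_sub, LinearMap.sub_apply]
  simp only [charForm_apply, charInner_irr, if_neg h.symm, if_neg h'.symm, sub_zero]

/-- The row of `rows12` for each row of the character table. -/
def rowIndex12 : Fin 15 → Fin 14 := ![0, 1, 2, 3, 3, 4, 5, 6, 7, 8, 9, 10, 11, 12, 13]

/-- The type of each conjugacy class. -/
def typeIndex12 : Fin 15 → Fin 14 := ![0, 1, 2, 3, 4, 5, 6, 7, 8, 9, 10, 11, 12, 13, 13]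

theorem table12_eq_rows12 : ∀ i : Fin 15, i ≠ 3 → i ≠ 4 → ∀ j,
    table12 i j = (rows12 (rowIndex12 i) (typeIndex12 j) : ℂ) := by
  intro i h3 h4 j
  fin_cases i <;> first | exact absurd rfl h3 | exact absurd rfl h4 | skip
  all_goals fin_cases j <;> simp [table12, rows12, rowIndex12, typeIndex12]

theorem omega11_eq : omega11 = (-1 + Complex.I * (Real.sqrt 11 : ℝ)) / 2 := rfl

theorem conj_omega11 : conj omega11 = (-1 - Complex.I * (Real.sqrt 11 : ℝ)) / 2 := by
  simp [omega11, map_ofNat (starRingEnd ℂ) 2]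
  ring

theorem table12_pair (j : Fin 15) {s : ℂ} (hs : s = Complex.I * (Real.sqrt 11 : ℝ)) :
    table12 3 j = (rows12 3 (typeIndex12 j) +
      (if j = 13 then s else if j = 14 then -s else 0)) / 2 ∧
    table12 4 j = (rows12 3 (typeIndex12 j) -
      (if j = 13 then s else if j = 14 then -s else 0)) / 2 := by
  have h3 : table12 3 = ![16, 0, 4, -2, 1, 0, 0, 1, 0, 1, 0, 0, -1, omega11, conj omega11] := rfl
  have h4 : table12 4 = ![16, 0, 4, -2, 1, 0, 0, 1, 0, 1, 0, 0, -1, conj omega11, omega11] := rfl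
  have hr : ∀ j, rows12 3 (typeIndex12 j) =
      ![32, 0, 8, -4, 2, 0, 0, 2, 0, 2, 0, 0, -2, -1, -1] j := by decide
  rw [conj_omega11, omega11_eq, ← hs] at h3 h4
  fin_cases j <;> norm_num [h3, h4, hr, Fin.ext_iff, sub_eq_add_neg]

theorem cycleTypes12_eq : ∀ j, cycleTypes12 j =
    ((types12 (Fin.castLE (by norm_num) (typeIndex12 j))).filter (2 ≤ ·) : List ℕ) := by
  decide +kernel

/-- The character table of a group of degree 12 with known class types and with non-real elements of
order 11. -/
theorem hasCharacterTable12 {G : Subgroup (Perm (Fin 12))} [Fintype G] {τ : G → Fin 14}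
    (hτ : ∀ g : G, (g : Perm (Fin 12)).partition.parts = types12 (Fin.castLE (by norm_num) (τ g)))
    (hN : ∀ i, Finset.card {g | τ g = i} = typeCard12 i) (hcard : Nat.card G = 95040)
    (hreal : ∀ x, τ x = 13 → ¬ IsConj x x⁻¹) :
    Nat.card (ConjClasses G) = 15 ∧ HasCharacterTable G cycleTypes12 table12 := by
  classical
  have ht : ∀ i j : Fin 14, (types12 (Fin.castLE (by norm_num) i) : Multiset ℕ) =
      types12 (Fin.castLE (by norm_num) j) → i = j := by decide +kernel
  have hinv := type_inv (t := fun i => types12 (Fin.castLE (by norm_num) i)) hτ ht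
  have hconj : ∀ g h, IsConj g h → τ g = τ h := fun g h hgh =>
    type_eq_of_isConj (t := fun i => types12 (Fin.castLE (by norm_num) i)) hτ ht hgh
  have h1 : τ 1 = 0 :=
    type_one_eq (t := fun i => types12 (Fin.castLE (by norm_num) i)) hτ ht (i := 0) rfl
  have hmem := typeFun_rows12_mem hτ hN hcard hinv
  have hinner : ∀ a b, charInner (typeFun τ (rows12 a)) (typeFun τ (rows12 b)) =
      ((if a = b then norms12 a else 0 : ℤ) : ℂ) := fun a b =>
    charInner_typeFun hN hinv (by rw [hcard]; exact sum_rows12_mul a b)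
  have hdeg : ∀ a, typeFun τ (rows12 a) 1 = ((rows12 a 0).toNat : ℂ) := by
    intro a
    rw [typeFun, h1]
    have : rows12 a 0 = ((rows12 a 0).toNat : ℤ) := by revert a; decide
    exact_mod_cast this
  have hnorm : ∀ a, a ≠ 3 → norms12 a = 1 := by decide
  have hnorm3 : norms12 3 = 2 := rfl
  have hF0 : ∀ a, ∃ f : Irr G, a ≠ 3 → f.1 = typeFun τ (rows12 a) := by
    have hirr : ∀ a, a ≠ 3 → IsIrreducibleCharacter (typeFun τ (rows12 a)) := fun a ha =>
      isIrreducibleCharacter_of_charInner_eq_one (hmem a)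
        (by rw [hinner, if_pos rfl, hnorm a ha, Int.cast_one]) (hdeg a)
    intro a
    by_cases ha : a = 3
    · exact ⟨⟨_, hirr 0 (by decide)⟩, fun h => absurd ha h⟩
    · exact ⟨⟨_, hirr a ha⟩, fun _ => rfl⟩
  choose F₀ hF₀ using hF0
  have hF₀inj : ∀ a b, a ≠ 3 → b ≠ 3 → F₀ a = F₀ b → a = b := by
    intro a b ha hb hab
    by_contra hne
    refine irr_ne_of_charInner_eq_zero ?_ hab
    rw [hF₀ a ha, hF₀ b hb, hinner, if_neg hne, Int.cast_zero]
  obtain ⟨χ, ψ, a, b, hne, ha, hb, hθ, hχ, hψ⟩ := exists_pair_notMem_range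
    (fun a : {a : Fin 14 // a ≠ 3} => F₀ a.1) (hmem 3)
    (by rw [hinner, if_pos rfl]; norm_num [hnorm3])
    (fun a => by rw [hF₀ _ a.2, hinner, if_neg a.2.symm, Int.cast_zero])
  obtain ⟨F, hFinj, hF3, hF4, hF⟩ : ∃ F : Fin 15 → Irr G, Function.Injective F ∧ F 3 = χ ∧
      F 4 = ψ ∧ ∀ i, i ≠ 3 → i ≠ 4 → F i = F₀ (rowIndex12 i) := by
    have hρ : ∀ i ∈ ({i | i ≠ 3 ∧ i ≠ 4} : Set (Fin 15)), rowIndex12 i ≠ 3 := by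
      simp only [Set.mem_ofPred_eq]; decide
    refine ⟨Function.update (Function.update (fun i => F₀ (rowIndex12 i)) 3 χ) 4 ψ, ?_, ?_, ?_,
      ?_⟩
    · have hbase : Set.InjOn (fun i => F₀ (rowIndex12 i)) {i | i ≠ 3 ∧ i ≠ 4} := by
        intro i hi j hj hij
        have := hF₀inj _ _ (hρ i hi) (hρ j hj) hij
        clear hij
        simp only [Set.mem_ofPred_eq] at hi hj
        revert i j
        decide
      have h3 := hbase.update_insert (k := 3) (b := χ) (by simp) fun i hi => hχ ⟨_, hρ i hi⟩
      have h4 := h3.update_insert (k := 4) (b := ψ) (by simp) fun i hi => by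
        rcases hi with rfl | hi
        · rwa [Function.update_self]
        · rw [Function.update_of_ne hi.1]
          exact hψ ⟨_, hρ i hi⟩
      rw [← Set.injOn_univ]
      convert h4
      ext i
      simp only [Set.mem_univ, Set.mem_insert_iff, Set.mem_ofPred_eq, true_iff]
      tauto
    · rw [Function.update_of_ne (by decide), Function.update_self]
    · rw [Function.update_self]
    · intro i h3 h4
      rw [Function.update_of_ne h4, Function.update_of_ne h3]
  obtain ⟨d, hd0, hd⟩ := χ.exists_degree
  obtain ⟨d', hd0', hd'⟩ := ψ.exists_degree
  have hFdeg : ∀ i, (F i).1 1 = ((if i = 3 then d else if i = 4 then d' else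
      (rows12 (rowIndex12 i) 0).toNat : ℕ) : ℂ) := by
    intro i
    split_ifs with h3 h4
    · rw [h3, hF3, hd]
    · rw [h4, hF4, hd']
    · have : rowIndex12 i ≠ 3 := by revert i; decide
      rw [hF i h3 h4, hF₀ _ this, hdeg]
  have hsum : ∑ i : Fin 15, (if i = 3 then d else if i = 4 then d' else
      (rows12 (rowIndex12 i) 0).toNat) ^ 2 = d ^ 2 + d' ^ 2 + 94528 := by
    have hsplit : ∀ i : Fin 15, (if i = 3 then d else if i = 4 then d' else
        (rows12 (rowIndex12 i) 0).toNat) ^ 2 = (if i = 3 then d ^ 2 else 0) +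
        (if i = 4 then d' ^ 2 else 0) +
        if i = 3 ∨ i = 4 then 0 else (rows12 (rowIndex12 i) 0).toNat ^ 2 := by
      intro i
      by_cases h3 : i = 3
      · subst h3; simp
      · by_cases h4 : i = 4 <;> simp [h3, h4]
    have hrest : ∑ i : Fin 15, (if i = 3 ∨ i = 4 then 0 else
        (rows12 (rowIndex12 i) 0).toNat ^ 2) = 94528 := by decide +kernel
    simp only [hsplit, Finset.sum_add_distrib, hrest, Finset.sum_ite_eq', Finset.mem_univ, if_true]
  -- The thirteen rational rows leave 95040 - 94528 = 512 = 2·16² for d² + d'², while the signed sum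
  -- of d and d' is 32; so both are 16 and no irreducible character is missing.
  have hle := sum_degree_sq_le hFinj hFdeg
  rw [hsum, hcard] at hle
  have hd32 : a * d + b * d' = 2 * (16 : ℕ) := by
    have h := congrFun hθ 1
    rw [hdeg, Pi.add_apply, Pi.smul_apply, Pi.smul_apply, hd, hd', smul_eq_mul, smul_eq_mul] at h
    have h32 : (rows12 3 0).toNat = 32 := rfl
    rw [h32] at h
    exact_mod_cast h.symm
  obtain ⟨rfl, rfl, rfl, rfl⟩ := degree_eq_of_sum_sq_le ha hb hd32 (by omega) hd0 hd0'
  have hFbij : Function.Bijective F := by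
    refine bijective_of_sum_degree_sq hFinj ?_
    simp only [hFdeg]
    rw [hcard]
    exact_mod_cast hsum
  have hclasses : Nat.card (ConjClasses G) = 15 := by
    rw [← card_irr_eq_card_conjClasses, ← Nat.card_congr (Equiv.ofBijective F hFbij)]
    simp
  refine ⟨hclasses, ?_⟩
  -- Fourteen types and one non-real type give fifteen distinct classes, which are all. The
  -- representatives stay arbitrary so that they can be adjusted later.
  have hbij : ∀ r : Fin 14 → G, (∀ i, τ (r i) = i) → Function.Bijective fun j : Fin 15 =>
      ConjClasses.mk (if j = 14 then (r 13)⁻¹ else r (typeIndex12 j)) := by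
    intro r hr
    refine conjClasses_bijective (fun i j hij => ?_) hclasses.le
    have h13 := hreal _ (hr 13)
    have hσ := hconj _ _ hij
    by_cases hi : i = 14 <;> by_cases hj : j = 14
    · rw [hi, hj]
    · subst hi
      rw [if_pos rfl, if_neg hj] at hij hσ
      rw [hinv, hr, hr] at hσ
      rw [← hσ] at hij
      exact absurd hij.symm h13
    · subst hj
      rw [if_pos rfl, if_neg hi] at hij hσ
      rw [hinv, hr, hr] at hσ
      rw [hσ] at hij
      exact absurd hij h13
    · rw [if_neg hi, if_neg hj, hr, hr] at hσ
      clear hij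
      revert i j
      decide
  have hcl : ∀ r : Fin 14 → G, (∀ i, τ (r i) = i) → ∀ g,
      IsConj (r (τ g)) g ∨ (τ g = 13 ∧ IsConj (r (τ g))⁻¹ g) := by
    intro r hr g
    obtain ⟨j, hj⟩ := (hbij r hr).2 (ConjClasses.mk g)
    have hj' := ConjClasses.mk_eq_mk_iff_isConj.1 hj
    have hσ := hconj _ _ hj'
    by_cases h14 : j = 14
    · rw [if_pos h14] at hj' hσ
      rw [hinv, hr] at hσ
      rw [← hσ]
      exact Or.inr ⟨rfl, hj'⟩
    · rw [if_neg h14] at hj' hσ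
      rw [hr] at hσ
      rw [← hσ]
      exact Or.inl hj'
  have hdclass : ∀ g h, IsConj g h → (χ.1 - ψ.1) g = (χ.1 - ψ.1) h := fun g h hgh => by
    rw [Pi.sub_apply, Pi.sub_apply, χ.apply_eq_of_isConj hgh, ψ.apply_eq_of_isConj hgh]
  have hθ' : typeFun τ (rows12 3) = χ.1 + ψ.1 := by rw [hθ]; simp
  have horth : ∀ a, charInner (χ.1 - ψ.1) (typeFun τ (rows12 a)) = 0 := by
    intro a
    by_cases ha : a = 3
    · rw [ha, hθ', charInner_sub_add]
    · rw [← hF₀ a ha]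
      exact charInner_sub_of_ne (hχ ⟨a, ha⟩) (hψ ⟨a, ha⟩)
  obtain ⟨r₀, hr₀⟩ : ∃ r : Fin 14 → G, ∀ i, τ (r i) = i := by
    have : ∀ i, ∃ g, τ g = i := fun i => by
      have hpos : 0 < Finset.card {g | τ g = i} := by rw [hN]; revert i; decide
      obtain ⟨g, hg⟩ := Finset.card_pos.1 hpos
      exact ⟨g, (Finset.mem_filter.1 hg).2⟩
    exact ⟨fun i => (this i).choose, fun i => (this i).choose_spec⟩
  have hodd : ∀ x, (χ.1 - ψ.1) x⁻¹ = -(χ.1 - ψ.1) x := by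
    intro x
    refine apply_inv_eq_neg_of_sum_type_eq_zero hinv hdclass (fun g hg => ?_)
      (sum_type_eq_zero hinv horth _ ?_ (fun j => sum_rows12_mul_rows12 (τ x) j))
    -- Here x itself is made the representative of its type.
    · have hr := hcl (Function.update r₀ (τ x) x) (fun i => by
        by_cases hi : i = τ x
        · rw [hi, Function.update_self]
        · rw [Function.update_of_ne hi, hr₀]) g
      rw [hg, Function.update_self] at hr
      exact hr.imp_right And.right
    · generalize τ x = i
      revert i
      decide
  have hzero : ∀ g, τ g ≠ 13 → (χ.1 - ψ.1) g = 0 := by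
    intro g hg
    have hx : ∀ h, τ h ≠ 13 → IsConj (r₀ (τ h)) h := fun h hh =>
      (hcl r₀ hr₀ h).resolve_right fun h' => hh h'.1
    refine eq_zero_of_odd hdclass hodd ((hx g hg).symm.trans ?_)
    have := hx g⁻¹ (by rwa [hinv])
    rwa [hinv] at this
  -- The difference has norm 2 and lives on 17280 elements: 2 = -(17280 / 95040) δ² = -(2 / 11) δ².
  have hsq : (χ.1 - ψ.1) (r₀ 13) ^ 2 = -11 := by
    have h := charInner_of_odd hN (x := r₀) (fun g => (hcl r₀ hr₀ g).imp_right And.right)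
      hdclass hdclass hodd hodd
    rw [charInner_sub_eq_two hne, Finset.sum_eq_single 13, hcard] at h
    · have h13 : typeCard12 13 = 17280 := rfl
      rw [h13] at h
      push_cast at h
      linear_combination (11 / 2) * h
    · intro i _ hi
      rw [hzero (r₀ i) (by rwa [hr₀])]
      simp
    · simp
  -- The difference is odd, so passing to the inverse representative chooses the sign of the root.
  obtain ⟨r, hr, hrδ⟩ : ∃ r : Fin 14 → G, (∀ i, τ (r i) = i) ∧
      (χ.1 - ψ.1) (r 13) = Complex.I * (Real.sqrt 11 : ℝ) := by
    rcases sq_eq_neg_eleven hsq with h | h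
    · exact ⟨r₀, hr₀, h⟩
    · refine ⟨Function.update r₀ 13 (r₀ 13)⁻¹, fun i => ?_, ?_⟩
      · by_cases hi : i = 13
        · rw [hi, Function.update_self, hinv, hr₀]
        · rw [Function.update_of_ne hi, hr₀]
      · rw [Function.update_self, hodd, h, neg_neg]
  refine ⟨Equiv.ofBijective _ (hbij r hr), Equiv.ofBijective F hFbij, fun j g hg => ?_⟩
  have hg' := (ConjClasses.mk_eq_mk_iff_isConj.1 hg).symm
  have hτg : τ g = typeIndex12 j := by
    rw [← hconj _ _ hg']
    split_ifs with h14
    · rw [hinv, hr, h14]; rfl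
    · rw [hr]
  have hδ : (χ.1 - ψ.1) g = if j = 13 then Complex.I * (Real.sqrt 11 : ℝ) else
      if j = 14 then -(Complex.I * (Real.sqrt 11 : ℝ)) else 0 := by
    split_ifs with h13 h14
    · subst h13
      rw [← hrδ, ← hdclass _ _ hg']
      rfl
    · subst h14
      rw [if_pos rfl] at hg'
      rw [← hrδ, ← hdclass _ _ hg', hodd]
    · refine hzero g ?_
      rw [hτg]
      clear hg hg' hτg
      revert j
      decide
  refine ⟨?_, fun i => ?_⟩
  · rw [cycleType_eq_filter_type (t := fun i => types12 (Fin.castLE (by norm_num) i)) hτ, hτg,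
      cycleTypes12_eq]
  · change (F i).1 g = _
    obtain ⟨ht3, ht4⟩ := table12_pair j rfl
    have hs := congrFun hθ' g
    rw [typeFun, hτg, Pi.add_apply] at hs
    rw [← hδ, hs, Pi.sub_apply] at ht3 ht4
    by_cases h3 : i = 3
    · rw [h3, hF3, ht3]; ring
    by_cases h4 : i = 4
    · rw [h4, hF4, ht4]; ring
    rw [table12_eq_rows12 i h3 h4, hF i h3 h4, hF₀, typeFun, hτg]
    revert i
    decide

/-! ### Degree 11: virtual characters and the table -/

/-- The rows of the character table in degree 11 as functions of the cycle type; each of the two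
pairs of rows with irrational entries is replaced by its sum. -/
def rows11 : Fin 8 → Fin 8 → ℤ :=
  ![![1, 1, 1, 1, 1, 1, 1, 1],
    ![10, 2, 1, 2, 0, -1, 0, -1],
    ![20, -4, 2, 0, 0, 2, 0, -2],
    ![11, 3, 2, -1, 1, 0, -1, 0],
    ![32, 0, -4, 0, 2, 0, 0, -1],
    ![44, 4, -1, 0, -1, 1, 0, 0],
    ![45, -3, 0, 1, 0, 0, -1, 1],
    ![55, -1, 1, -1, 0, -1, 1, 0]]

/-- The norms of `rows11`. -/
def norms11 : Fin 8 → ℤ := ![1, 1, 2, 1, 2, 1, 1, 1]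

/-- Combinations of numbers of colourings that agree with `rows11`. -/
def combs11 : Fin 8 → List (ℤ × ℕ × ℕ × ℕ × ℕ) :=
  ![[(1, 0, 0, 0, 0)],
    [(-1, 0, 0, 0, 0), (1, 1, 0, 0, 0)],
    [(-2, 0, 0, 0, 0), (2, 1, 0, 0, 0), (5, 2, 0, 0, 0), (-1, 1, 1, 0, 0), (-1, 3, 0, 0, 0),
     (-4, 2, 1, 0, 0), (1, 2, 2, 0, 0)],
    [(1, 1, 0, 0, 0), (1, 2, 0, 0, 0), (1, 1, 1, 0, 0), (-1, 3, 0, 0, 0), (-2, 2, 1, 0, 0),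
     (-1, 1, 1, 1, 0), (1, 2, 2, 0, 0)],
    [(-1, 0, 0, 0, 0), (3, 1, 0, 0, 0), (6, 2, 0, 0, 0), (-5, 3, 0, 0, 0), (-3, 2, 1, 0, 0),
     (-2, 1, 1, 1, 0), (2, 2, 2, 0, 0)],
    [(-1, 1, 0, 0, 0), (1, 2, 0, 0, 0)],
    [(1, 0, 0, 0, 0), (-1, 1, 0, 0, 0), (-1, 2, 0, 0, 0), (1, 1, 1, 0, 0)],
    [(-3, 2, 0, 0, 0), (-1, 1, 1, 0, 0), (2, 3, 0, 0, 0), (2, 2, 1, 0, 0), (1, 1, 1, 1, 0),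
     (-1, 2, 2, 0, 0)]]

theorem colorComb_combs11 : ∀ a i,
    colorComb (combs11 a) (types11 (Fin.castLE (by norm_num) i)) = rows11 a i := by
  decide +kernel

theorem sum_rows11_mul : ∀ a b, ∑ i, (typeCard11 i : ℤ) * (rows11 a i * rows11 b i) =
    7920 * if a = b then norms11 a else 0 := by
  decide +kernel

theorem sum_rows11_mul_rows11 : ∀ i j,
    ∑ a, (if norms11 a = 1 then 2 else 1) * rows11 a i * rows11 a j =
      if j = i then 2 * 7920 / (typeCard11 i : ℤ) else 0 := by
  decide +kernel

/-- The row of `rows11` for each row of the character table. -/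
def rowIndex11 : Fin 10 → Fin 8 := ![0, 1, 2, 2, 3, 4, 4, 5, 6, 7]

/-- The type of each conjugacy class. -/
def typeIndex11 : Fin 10 → Fin 8 := ![0, 1, 2, 3, 4, 5, 6, 6, 7, 7]

theorem table11_eq_rows11 : ∀ i : Fin 10, norms11 (rowIndex11 i) = 1 → ∀ j,
    table11 i j = (rows11 (rowIndex11 i) (typeIndex11 j) : ℂ) := by
  intro i hi j
  fin_cases i <;> first | exact absurd hi (by decide) | skip
  all_goals fin_cases j <;> simp [table11, rows11, rowIndex11, typeIndex11]

theorem table11_pair_ten (j : Fin 10) :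
    table11 2 j = (rows11 2 (typeIndex11 j) +
      (if j = 6 then 2 * alpha2 else if j = 7 then -(2 * alpha2) else 0)) / 2 ∧
    table11 3 j = (rows11 2 (typeIndex11 j) -
      (if j = 6 then 2 * alpha2 else if j = 7 then -(2 * alpha2) else 0)) / 2 := by
  have h2 : table11 2 = ![10, -2, 1, 0, 0, 1, alpha2, conj alpha2, -1, -1] := rfl
  have h3 : table11 3 = ![10, -2, 1, 0, 0, 1, conj alpha2, alpha2, -1, -1] := rfl
  have hr : ∀ j, rows11 2 (typeIndex11 j) = ![20, -4, 2, 0, 0, 2, 0, 0, -2, -2] j := by decide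
  rw [conj_alpha2] at h2 h3
  fin_cases j <;> norm_num [h2, h3, hr, Fin.ext_iff, neg_div]

theorem table11_pair_sixteen (j : Fin 10) {s : ℂ} (hs : s = Complex.I * (Real.sqrt 11 : ℝ)) :
    table11 5 j = (rows11 4 (typeIndex11 j) +
      (if j = 8 then s else if j = 9 then -s else 0)) / 2 ∧
    table11 6 j = (rows11 4 (typeIndex11 j) -
      (if j = 8 then s else if j = 9 then -s else 0)) / 2 := by
  have h5 : table11 5 = ![16, 0, -2, 0, 1, 0, 0, 0, omega11, conj omega11] := rfl
  have h6 : table11 6 = ![16, 0, -2, 0, 1, 0, 0, 0, conj omega11, omega11] := rfl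
  have hr : ∀ j, rows11 4 (typeIndex11 j) = ![32, 0, -4, 0, 2, 0, 0, 0, -1, -1] j := by decide
  rw [conj_omega11, omega11_eq, ← hs] at h5 h6
  fin_cases j <;> norm_num [h5, h6, hr, Fin.ext_iff, sub_eq_add_neg]

theorem cycleTypes11_eq : ∀ j, cycleTypes11 j =
    ((types11 (Fin.castLE (by norm_num) (typeIndex11 j))).filter (2 ≤ ·) : List ℕ) := by
  decide +kernel

theorem degree_sq_add_ge {a b : ℤ} (ha : a = 1 ∨ a = -1) (hb : b = 1 ∨ b = -1) {d d' e : ℕ}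
    (h : a * d + b * d' = 2 * e) : 2 * e ^ 2 ≤ d ^ 2 + d' ^ 2 := by
  zify
  have h1 : (a * d + b * d') ^ 2 + (a * d - b * d') ^ 2 = 2 * ((d : ℤ) ^ 2 + d' ^ 2) := by
    have ha2 : a ^ 2 = 1 := by rcases ha with rfl | rfl <;> norm_num
    have hb2 : b ^ 2 = 1 := by rcases hb with rfl | rfl <;> norm_num
    linear_combination 2 * (d : ℤ) ^ 2 * ha2 + 2 * (d' : ℤ) ^ 2 * hb2
  rw [h] at h1
  nlinarith [sq_nonneg (a * d - b * d' : ℤ)]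

/-- Two orthogonal combinations of the same two irreducible characters. -/
theorem degree_sq_add_eq_of_orthogonal {a b a' b' : ℤ} (ha : a = 1 ∨ a = -1) (hb : b = 1 ∨ b = -1)
    (ha' : a' = 1 ∨ a' = -1) (hb' : b' = 1 ∨ b' = -1) (horth : a * a' + b * b' = 0) {d d' e e' : ℕ}
    (h : a * d + b * d' = 2 * e) (h' : a' * d + b' * d' = 2 * e') :
    d ^ 2 + d' ^ 2 = 2 * e ^ 2 + 2 * e' ^ 2 := by
  zify
  have h1 : (a * d + b * d') ^ 2 + (a' * d + b' * d') ^ 2 = 2 * ((d : ℤ) ^ 2 + d' ^ 2) := by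
    rcases ha with rfl | rfl <;> rcases hb with rfl | rfl <;> rcases ha' with rfl | rfl <;>
      rcases hb' with rfl | rfl <;> norm_num at horth <;> ring
  rw [h, h'] at h1
  linarith

/-- The possible values of the two odd differences on the elements of orders 8 and 11. -/
theorem differences_values {p q p' q' : ℝ} (h : p ^ 2 / 4 + 2 * q ^ 2 / 11 = 2)
    (h' : p' ^ 2 / 4 + 2 * q' ^ 2 / 11 = 2) (horth : p * p' / 4 + 2 * (q * q') / 11 = 0) {m n : ℕ}
    (hm : 104 + p ^ 2 = 8 * m) (hn : 110 + 5 * q ^ 2 / 2 = 11 * n) :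
    p ^ 2 = 8 ∧ q = 0 ∧ p' = 0 ∧ q' ^ 2 = 11 := by
  have hm1 : 13 ≤ m := by
    have : (13 : ℝ) ≤ m := by nlinarith [sq_nonneg p]
    exact_mod_cast this
  have hm2 : m ≤ 14 := by
    have : (m : ℝ) ≤ 14 := by nlinarith [sq_nonneg q]
    exact_mod_cast this
  -- The norm gives p² ≤ 8. If m = 13 then p = 0 and q² = 11, so 22 n would be the odd number 275.
  -- Hence m = 14.
  obtain rfl | rfl : m = 13 ∨ m = 14 := by omega
  · exfalso
    push_cast at hm
    have hn2 : (2 * (11 * n) : ℝ) = (275 : ℕ) := by push_cast; linarith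
    have : 2 * (11 * n) = 275 := by exact_mod_cast hn2
    omega
  · push_cast at hm
    have hp : p ^ 2 = 8 := by linarith
    have hq : q = 0 := by
      have : q ^ 2 = 0 := by linarith
      exact pow_eq_zero_iff (two_ne_zero) |>.1 this
    have hp' : p' = 0 := by
      rw [hq] at horth
      have h1 : p * p' = 0 := by linarith
      rcases mul_eq_zero.1 h1 with h2 | h2
      · rw [h2] at hp; norm_num at hp
      · exact h2
    refine ⟨hp, hq, hp', ?_⟩
    rw [hp'] at h'
    linarith

/-- The value at the inverse is both the negative and the complex conjugate, so the real part
vanishes. -/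
theorem eq_I_mul_im_of_odd {G : Type} [Group G] [Finite G] {χ ψ : Irr G} {g : G}
    (h : (χ.1 - ψ.1) g⁻¹ = -(χ.1 - ψ.1) g) :
    (χ.1 - ψ.1) g = Complex.I * (((χ.1 - ψ.1) g).im : ℝ) := by
  have h1 : (χ.1 - ψ.1) g⁻¹ = conj ((χ.1 - ψ.1) g) := by
    rw [Pi.sub_apply, Pi.sub_apply, χ.apply_inv, ψ.apply_inv, map_sub]
  rw [h1] at h
  have h2 := congrArg Complex.re h
  rw [Complex.conj_re, Complex.neg_re] at h2
  apply Complex.ext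
  · simp
    have h3 : ((χ.1 - ψ.1) g).re = 0 := by linarith
    simpa using h3
  · simp

/-- The values of a character on the powers of an element, when its difference to its conjugate is
odd. -/
theorem mul_apply_inv_eq {G : Type} [Group G] [Fintype G] {r : ℕ} {τ : G → Fin r}
    (hinv : ∀ g, τ g⁻¹ = τ g) {x : Fin r → G}
    (hcl : ∀ g, IsConj (x (τ g)) g ∨ IsConj (x (τ g))⁻¹ g) {χ ψ : Irr G} {v : Fin r → ℤ}
    (hv : typeFun τ v = χ.1 + ψ.1) (hodd : ∀ g, (χ.1 - ψ.1) g⁻¹ = -(χ.1 - ψ.1) g) (g : G) :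
    χ.1 g * χ.1 g⁻¹ = (v (τ g) ^ 2 - (χ.1 - ψ.1) (x (τ g)) ^ 2) / 4 := by
  have hclass : ∀ g h, IsConj g h → (χ.1 - ψ.1) g = (χ.1 - ψ.1) h := fun g h hgh => by
    rw [Pi.sub_apply, Pi.sub_apply, χ.apply_eq_of_isConj hgh, ψ.apply_eq_of_isConj hgh]
  have h1 : (χ.1 - ψ.1) (x (τ g)) ^ 2 = (χ.1 - ψ.1) g ^ 2 := by
    rcases hcl g with h | h
    · rw [hclass _ _ h]
    · rw [← hclass _ _ h, hodd, neg_sq]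
  have h2 := congrFun hv g
  have h3 := congrFun hv g⁻¹
  rw [typeFun, Pi.add_apply] at h2 h3
  rw [hinv] at h3
  have h4 := hodd g
  rw [h1]
  rw [Pi.sub_apply, Pi.sub_apply] at h4
  rw [Pi.sub_apply]
  have h5 : χ.1 g = (v (τ g) + (χ.1 g - ψ.1 g)) / 2 := by rw [h2]; ring
  have h6 : χ.1 g⁻¹ = (v (τ g) - (χ.1 g - ψ.1 g)) / 2 := by
    linear_combination (h4 - h3) / 2
  linear_combination χ.1 g⁻¹ * h5 + (v (τ g) + (χ.1 g - ψ.1 g)) / 2 * h6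

/-- The orders of the elements of each type. -/
def orders11 : Fin 8 → ℕ := ![1, 2, 3, 4, 5, 6, 8, 11]

theorem orderOf_eq_orders11 {G : Subgroup (Perm (Fin 11))} {τ : G → Fin 8}
    (hτ : ∀ g : G, (g : Perm (Fin 11)).partition.parts = types11 (Fin.castLE (by norm_num) (τ g)))
    (g : G) : orderOf g = orders11 (τ g) := by
  rw [orderOf_eq_lcm_type (t := fun i => types11 (Fin.castLE (by norm_num) i)) hτ]
  generalize τ g = i
  revert i
  decide +kernel

/-- The eight types in degree 11 have distinct element orders, so types of powers can be read off
from orders. -/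
theorem type_eq_of_orderOf_eq {G : Subgroup (Perm (Fin 11))} {τ : G → Fin 8}
    (hτ : ∀ g : G, (g : Perm (Fin 11)).partition.parts = types11 (Fin.castLE (by norm_num) (τ g)))
    {g : G} {i : Fin 8} (h : orderOf g = orders11 i) : τ g = i := by
  rw [orderOf_eq_orders11 hτ] at h
  revert h
  generalize τ g = j
  revert i j
  decide

theorem type_pow_eq {G : Subgroup (Perm (Fin 11))} {τ : G → Fin 8}
    (hτ : ∀ g : G, (g : Perm (Fin 11)).partition.parts = types11 (Fin.castLE (by norm_num) (τ g)))
    (g : G) (j : ℕ) {i : Fin 8}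
    (h : orders11 (τ g) / (orders11 (τ g)).gcd j = orders11 i) : τ (g ^ j) = i := by
  apply type_eq_of_orderOf_eq hτ
  rw [orderOf_pow, orderOf_eq_orders11 hτ, h]

/-- The character table of a group of degree 11 with known class types and with non-real elements of
orders 8 and 11. -/
theorem hasCharacterTable11 {G : Subgroup (Perm (Fin 11))} [Fintype G] {τ : G → Fin 8}
    (hτ : ∀ g : G, (g : Perm (Fin 11)).partition.parts = types11 (Fin.castLE (by norm_num) (τ g)))
    (hN : ∀ i, Finset.card {g | τ g = i} = typeCard11 i) (hcard : Nat.card G = 7920)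
    (hreal : ∀ x, τ x = 6 ∨ τ x = 7 → ¬ IsConj x x⁻¹) :
    Nat.card (ConjClasses G) = 10 ∧ HasCharacterTable G cycleTypes11 table11 := by
  classical
  have ht : ∀ i j : Fin 8, (types11 (Fin.castLE (by norm_num) i) : Multiset ℕ) =
      types11 (Fin.castLE (by norm_num) j) → i = j := by decide +kernel
  have hinv := type_inv (t := fun i => types11 (Fin.castLE (by norm_num) i)) hτ ht
  have hconj : ∀ g h, IsConj g h → τ g = τ h := fun g h hgh =>
    type_eq_of_isConj (t := fun i => types11 (Fin.castLE (by norm_num) i)) hτ ht hgh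
  have h1 : τ 1 = 0 :=
    type_one_eq (t := fun i => types11 (Fin.castLE (by norm_num) i)) hτ ht (i := 0) rfl
  have hmem : ∀ a, typeFun τ (rows11 a) ∈ virtualCharacters G := fun a =>
    type_mem_virtualCharacters (t := fun i => types11 (Fin.castLE (by norm_num) i)) hτ (combs11 a)
      (colorComb_combs11 a)
  have hinner : ∀ a b, charInner (typeFun τ (rows11 a)) (typeFun τ (rows11 b)) =
      ((if a = b then norms11 a else 0 : ℤ) : ℂ) := fun a b =>
    charInner_typeFun hN hinv (by rw [hcard]; exact sum_rows11_mul a b)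
  have hdeg : ∀ a, typeFun τ (rows11 a) 1 = ((rows11 a 0).toNat : ℂ) := by
    intro a
    rw [typeFun, h1]
    have : rows11 a 0 = ((rows11 a 0).toNat : ℤ) := by revert a; decide
    exact_mod_cast this
  have hF0 : ∀ a, ∃ f : Irr G, norms11 a = 1 → f.1 = typeFun τ (rows11 a) := by
    have hirr : ∀ a, norms11 a = 1 → IsIrreducibleCharacter (typeFun τ (rows11 a)) := fun a ha =>
      isIrreducibleCharacter_of_charInner_eq_one (hmem a)
        (by rw [hinner, if_pos rfl, ha, Int.cast_one]) (hdeg a)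
    intro a
    by_cases ha : norms11 a = 1
    · exact ⟨⟨_, hirr a ha⟩, fun _ => rfl⟩
    · exact ⟨⟨_, hirr 0 (by decide)⟩, fun h => absurd h ha⟩
  choose F₀ hF₀ using hF0
  have hF₀inj : ∀ a b, norms11 a = 1 → norms11 b = 1 → F₀ a = F₀ b → a = b := by
    intro a b ha hb hab
    by_contra hne
    refine irr_ne_of_charInner_eq_zero ?_ hab
    rw [hF₀ a ha, hF₀ b hb, hinner, if_neg hne, Int.cast_zero]
  have hpair : ∀ k, norms11 k = 2 → ∃ (χ ψ : Irr G) (a b : ℤ), χ ≠ ψ ∧ (a = 1 ∨ a = -1) ∧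
      (b = 1 ∨ b = -1) ∧ typeFun τ (rows11 k) = (a : ℂ) • χ.1 + (b : ℂ) • ψ.1 ∧
      (∀ a, norms11 a = 1 → F₀ a ≠ χ) ∧ ∀ a, norms11 a = 1 → F₀ a ≠ ψ := by
    intro k hk
    obtain ⟨χ, ψ, a, b, hne, ha, hb, hθ, hχ, hψ⟩ := exists_pair_notMem_range
      (fun a : {a : Fin 8 // norms11 a = 1} => F₀ a.1) (hmem k)
      (by rw [hinner, if_pos rfl, hk]; norm_num) fun a => by
        have hka : k ≠ a.1 := fun h => by
          have := a.2
          rw [← h, hk] at this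
          norm_num at this
        rw [hF₀ _ a.2, hinner, if_neg hka, Int.cast_zero]
    exact ⟨χ, ψ, a, b, hne, ha, hb, hθ, fun i hi => hχ ⟨i, hi⟩, fun i hi => hψ ⟨i, hi⟩⟩
  obtain ⟨χ, ψ, a, b, hne, ha, hb, hθ, hχ, hψ⟩ := hpair 2 rfl
  obtain ⟨χ', ψ', a', b', hne', ha', hb', hθ', hχ', hψ'⟩ := hpair 4 rfl
  obtain ⟨d₁, hd₁0, hd₁⟩ := χ.exists_degree
  obtain ⟨d₂, hd₂0, hd₂⟩ := ψ.exists_degree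
  obtain ⟨d₃, hd₃0, hd₃⟩ := χ'.exists_degree
  obtain ⟨d₄, hd₄0, hd₄⟩ := ψ'.exists_degree
  have hd20 : a * d₁ + b * d₂ = 2 * (10 : ℕ) := by
    have h := congrFun hθ 1
    rw [hdeg, Pi.add_apply, Pi.smul_apply, Pi.smul_apply, hd₁, hd₂, smul_eq_mul, smul_eq_mul,
      show (rows11 2 0).toNat = 20 from rfl] at h
    exact_mod_cast h.symm
  have hd32 : a' * d₃ + b' * d₄ = 2 * (16 : ℕ) := by
    have h := congrFun hθ' 1
    rw [hdeg, Pi.add_apply, Pi.smul_apply, Pi.smul_apply, hd₃, hd₄, smul_eq_mul, smul_eq_mul,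
      show (rows11 4 0).toNat = 32 from rfl] at h
    exact_mod_cast h.symm
  obtain ⟨r₀, hr₀⟩ : ∃ r : Fin 8 → G, ∀ i, τ (r i) = i := by
    have : ∀ i, ∃ g, τ g = i := fun i => by
      have hpos : 0 < Finset.card {g | τ g = i} := by rw [hN]; revert i; decide
      obtain ⟨g, hg⟩ := Finset.card_pos.1 hpos
      exact ⟨g, (Finset.mem_filter.1 hg).2⟩
    exact ⟨fun i => (this i).choose, fun i => (this i).choose_spec⟩
  have hyinj : ∀ r : Fin 8 → G, (∀ i, τ (r i) = i) → ∀ i j : Fin 10,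
      IsConj (if i = 7 ∨ i = 9 then (r (typeIndex11 i))⁻¹ else r (typeIndex11 i))
        (if j = 7 ∨ j = 9 then (r (typeIndex11 j))⁻¹ else r (typeIndex11 j)) → i = j := by
    intro r hr i j hij
    have hσ := hconj _ _ hij
    have h67 : ∀ i, i = 7 ∨ i = 9 → typeIndex11 i = 6 ∨ typeIndex11 i = 7 := by decide
    by_cases hi : i = 7 ∨ i = 9 <;> by_cases hj : j = 7 ∨ j = 9
    · rw [if_pos hi, if_pos hj, hinv, hinv, hr, hr] at hσ
      clear hij
      revert i j
      decide
    · rw [if_pos hi, if_neg hj] at hij hσ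
      rw [hinv, hr, hr] at hσ
      rw [← hσ] at hij
      exact absurd hij.symm (hreal _ (by rw [hr]; exact h67 i hi))
    · rw [if_neg hi, if_pos hj] at hij hσ
      rw [hinv, hr, hr] at hσ
      rw [hσ] at hij
      exact absurd hij (hreal _ (by rw [hr]; exact h67 j hj))
    · rw [if_neg hi, if_neg hj, hr, hr] at hσ
      clear hij
      revert i j
      decide
  have hge : 10 ≤ Nat.card (ConjClasses G) := by
    have := Nat.card_le_card_of_injective (fun j : Fin 10 => ConjClasses.mk
      (if j = 7 ∨ j = 9 then (r₀ (typeIndex11 j))⁻¹ else r₀ (typeIndex11 j)))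
      fun i j h => hyinj r₀ hr₀ i j (ConjClasses.mk_eq_mk_iff_isConj.1 h)
    simpa using this
  have hbase8 : Set.InjOn F₀ {i | norms11 i = 1} := fun i hi j hj hij => hF₀inj _ _ hi hj hij
  -- If rows 2 and 4 were built from the same two characters, then d₁² + d₂² = 2·10² + 2·16² = 712.
  -- With 7208 from the rational rows this is the group order, so there would be eight irreducible
  -- characters for at least ten classes.
  have hshare : ¬ d₁ ^ 2 + d₂ ^ 2 = 712 := by
    intro h712
    obtain ⟨F, hFinj, hFdeg⟩ : ∃ F : Fin 8 → Irr G, Function.Injective F ∧ ∀ i,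
        (F i).1 1 = ((if i = 2 then d₁ else if i = 4 then d₂ else (rows11 i 0).toNat : ℕ) : ℂ) := by
      refine ⟨Function.update (Function.update F₀ 2 χ) 4 ψ, ?_, fun i => ?_⟩
      · have h2 := hbase8.update_insert (k := 2) (b := χ) (by decide) hχ
        have h4 := h2.update_insert (k := 4) (b := ψ)
          (by simp only [Set.mem_insert_iff, Set.mem_ofPred_eq]; decide) fun i hi => by
            rcases hi with rfl | hi
            · rwa [Function.update_self]
            · rw [Function.update_of_ne (by rintro rfl; exact absurd hi (by decide))]
              exact hψ _ hi
        rw [← Set.injOn_univ]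
        convert h4
        ext i
        simp only [Set.mem_univ, Set.mem_insert_iff, Set.mem_ofPred_eq, true_iff]
        revert i
        decide
      · split_ifs with h2 h4
        · rw [h2, Function.update_of_ne (by decide), Function.update_self, hd₁]
        · rw [h4, Function.update_self, hd₂]
        · rw [Function.update_of_ne h4, Function.update_of_ne h2, hF₀, hdeg]
          revert i
          decide
    have hsum : ∑ i : Fin 8, (if i = 2 then d₁ else if i = 4 then d₂ else
        (rows11 i 0).toNat) ^ 2 = d₁ ^ 2 + d₂ ^ 2 + 7208 := by
      simp [Fin.sum_univ_eight, rows11]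
      ring
    have hb := bijective_of_sum_degree_sq hFinj (by
      simp only [hFdeg]
      rw [hcard]
      exact_mod_cast (show _ = 7920 by rw [hsum, h712]))
    rw [← card_irr_eq_card_conjClasses, ← Nat.card_congr (Equiv.ofBijective F hb)] at hge
    simp at hge
  have horth : charInner ((a : ℂ) • χ.1 + (b : ℂ) • ψ.1)
      ((a' : ℂ) • χ'.1 + (b' : ℂ) • ψ'.1) = 0 := by
    rw [← hθ, ← hθ', hinner]
    simp
  simp only [charInner_add_left, charInner_add_right, charInner_smul_left, charInner_smul_right,
    charInner_irr] at horth
  -- Two orthogonal signed pairs cannot share exactly one character, since their product would be 1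
  -- or -1; sharing both is excluded by `hshare`.
  have hdisj : χ ≠ χ' ∧ χ ≠ ψ' ∧ ψ ≠ χ' ∧ ψ ≠ ψ' := by
    have hane : ∀ {a : ℤ}, (a = 1 ∨ a = -1) → (a : ℂ) ≠ 0 := by
      rintro a (rfl | rfl) <;> norm_num
    have huniq : ∀ {e e' : ℕ} {f : Irr G}, f.1 1 = e → f.1 1 = e' → e = e' := fun h h' => by
      have := h.symm.trans h'
      exact_mod_cast this
    by_cases h11 : χ = χ'
    · subst h11
      rw [if_pos rfl, if_neg hne', if_neg hne.symm] at horth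
      by_cases h22 : ψ = ψ'
      · subst h22
        rw [if_pos rfl] at horth
        have h0 : a * a' + b * b' = 0 := by
          have : ((a * a' + b * b' : ℤ) : ℂ) = 0 := by
            push_cast
            linear_combination horth
          exact_mod_cast this
        rw [huniq hd₃ hd₁, huniq hd₄ hd₂] at hd32
        exact absurd (degree_sq_add_eq_of_orthogonal ha hb ha' hb' h0 hd20 hd32) hshare
      · rw [if_neg h22] at horth
        simp [hane ha, hane ha'] at horth
    · by_cases h12 : χ = ψ'
      · subst h12
        rw [if_neg h11, if_pos rfl, if_neg hne.symm] at horth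
        by_cases h21 : ψ = χ'
        · subst h21
          rw [if_pos rfl] at horth
          have h0 : a * b' + b * a' = 0 := by
            have : ((a * b' + b * a' : ℤ) : ℂ) = 0 := by
              push_cast
              linear_combination horth
            exact_mod_cast this
          rw [huniq hd₃ hd₂, huniq hd₄ hd₁, add_comm] at hd32
          exact absurd (degree_sq_add_eq_of_orthogonal ha hb hb' ha' h0 hd20 hd32) hshare
        · rw [if_neg h21] at horth
          simp [hane ha, hane hb'] at horth
      · rw [if_neg h11, if_neg h12] at horth
        refine ⟨h11, h12, ?_, ?_⟩
        · rintro rfl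
          rw [if_pos rfl, if_neg hne'] at horth
          simp [hane hb, hane ha'] at horth
        · rintro rfl
          rw [if_pos rfl, if_neg hne'.symm] at horth
          simp [hane hb, hane hb'] at horth
  obtain ⟨h11, h12, h21, h22⟩ := hdisj
  obtain ⟨F, hFinj, hF2, hF3, hF5, hF6, hF⟩ : ∃ F : Fin 10 → Irr G, Function.Injective F ∧
      F 2 = χ ∧ F 3 = ψ ∧ F 5 = χ' ∧ F 6 = ψ' ∧
      ∀ i, norms11 (rowIndex11 i) = 1 → F i = F₀ (rowIndex11 i) := by
    have hρ : ∀ i, norms11 (rowIndex11 i) = 1 → i ≠ 2 ∧ i ≠ 3 ∧ i ≠ 5 ∧ i ≠ 6 := by decide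
    have hbase : Set.InjOn (fun i => F₀ (rowIndex11 i)) {i | norms11 (rowIndex11 i) = 1} := by
      intro i hi j hj hij
      have := hF₀inj _ _ hi hj hij
      clear hij
      simp only [Set.mem_ofPred_eq] at hi hj
      revert i j
      decide
    have h2 := hbase.update_insert (k := 2) (b := χ) (by decide) fun i hi => hχ _ hi
    have h3 := h2.update_insert (k := 3) (b := ψ)
      (by simp only [Set.mem_insert_iff, Set.mem_ofPred_eq]; decide) fun i hi => by
        rcases hi with rfl | hi
        · rwa [Function.update_self]
        · rw [Function.update_of_ne (hρ i hi).1]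
          exact hψ _ hi
    have h5 := h3.update_insert (k := 5) (b := χ')
      (by simp only [Set.mem_insert_iff, Set.mem_ofPred_eq]; decide) fun i hi => by
        rcases hi with rfl | rfl | hi
        · rwa [Function.update_self]
        · rwa [Function.update_of_ne (by decide), Function.update_self]
        · rw [Function.update_of_ne (hρ i hi).2.1, Function.update_of_ne (hρ i hi).1]
          exact hχ' _ hi
    have h6 := h5.update_insert (k := 6) (b := ψ')
      (by simp only [Set.mem_insert_iff, Set.mem_ofPred_eq]; decide) fun i hi => by
        rcases hi with rfl | rfl | rfl | hi
        · rwa [Function.update_self]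
        · rwa [Function.update_of_ne (by decide), Function.update_self]
        · rwa [Function.update_of_ne (by decide), Function.update_of_ne (by decide),
            Function.update_self]
        · rw [Function.update_of_ne (hρ i hi).2.2.1, Function.update_of_ne (hρ i hi).2.1,
            Function.update_of_ne (hρ i hi).1]
          exact hψ' _ hi
    refine ⟨Function.update (Function.update (Function.update (Function.update
      (fun i => F₀ (rowIndex11 i)) 2 χ) 3 ψ) 5 χ') 6 ψ', ?_, ?_, ?_, ?_, ?_, ?_⟩
    · rw [← Set.injOn_univ]
      convert h6
      ext i
      simp only [Set.mem_univ, Set.mem_insert_iff, Set.mem_ofPred_eq, true_iff]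
      revert i
      decide
    · rw [Function.update_of_ne (by decide), Function.update_of_ne (by decide),
        Function.update_of_ne (by decide), Function.update_self]
    · rw [Function.update_of_ne (by decide), Function.update_of_ne (by decide),
        Function.update_self]
    · rw [Function.update_of_ne (by decide), Function.update_self]
    · rw [Function.update_self]
    · intro i hi
      rw [Function.update_of_ne (hρ i hi).2.2.2, Function.update_of_ne (hρ i hi).2.2.1,
        Function.update_of_ne (hρ i hi).2.1, Function.update_of_ne (hρ i hi).1]
  have hFdeg : ∀ i, (F i).1 1 = ((if i = 2 then d₁ else if i = 3 then d₂ else if i = 5 then d₃ else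
      if i = 6 then d₄ else (rows11 (rowIndex11 i) 0).toNat : ℕ) : ℂ) := by
    intro i
    split_ifs with h2 h3 h5 h6
    · rw [h2, hF2, hd₁]
    · rw [h3, hF3, hd₂]
    · rw [h5, hF5, hd₃]
    · rw [h6, hF6, hd₄]
    · have : norms11 (rowIndex11 i) = 1 := by revert i; decide
      rw [hF i this, hF₀ _ this, hdeg]
  have hsum : ∑ i : Fin 10, (if i = 2 then d₁ else if i = 3 then d₂ else if i = 5 then d₃ else
      if i = 6 then d₄ else (rows11 (rowIndex11 i) 0).toNat) ^ 2 =
      d₁ ^ 2 + d₂ ^ 2 + d₃ ^ 2 + d₄ ^ 2 + 7208 := by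
    have hsplit : ∀ i : Fin 10, (if i = 2 then d₁ else if i = 3 then d₂ else if i = 5 then d₃ else
        if i = 6 then d₄ else (rows11 (rowIndex11 i) 0).toNat) ^ 2 =
        (if i = 2 then d₁ ^ 2 else 0) + (if i = 3 then d₂ ^ 2 else 0) +
        (if i = 5 then d₃ ^ 2 else 0) + (if i = 6 then d₄ ^ 2 else 0) +
        if norms11 (rowIndex11 i) = 1 then (rows11 (rowIndex11 i) 0).toNat ^ 2 else 0 := by
      intro i
      fin_cases i <;> simp [Fin.ext_iff, norms11, rowIndex11]
    have hrest : ∑ i : Fin 10, (if norms11 (rowIndex11 i) = 1 then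
        (rows11 (rowIndex11 i) 0).toNat ^ 2 else 0) = 7208 := by decide +kernel
    simp only [hsplit, Finset.sum_add_distrib, hrest, Finset.sum_ite_eq', Finset.mem_univ, if_true]
  have hle := sum_degree_sq_le hFinj hFdeg
  rw [hsum, hcard] at hle
  -- The pairs have at least 2·10² and 2·16², together 712 = 7920 - 7208, so both bounds are
  -- attained.
  have hge₁ := degree_sq_add_ge ha hb hd20
  have hge₂ := degree_sq_add_ge ha' hb' hd32
  obtain ⟨rfl, rfl, rfl, rfl⟩ := degree_eq_of_sum_sq_le ha hb hd20 (by omega) hd₁0 hd₂0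
  obtain ⟨rfl, rfl, rfl, rfl⟩ := degree_eq_of_sum_sq_le ha' hb' hd32 (by omega) hd₃0 hd₄0
  have hFbij : Function.Bijective F := by
    refine bijective_of_sum_degree_sq hFinj ?_
    simp only [hFdeg]
    rw [hcard]
    exact_mod_cast hsum
  have hclasses : Nat.card (ConjClasses G) = 10 := by
    rw [← card_irr_eq_card_conjClasses, ← Nat.card_congr (Equiv.ofBijective F hFbij)]
    simp
  refine ⟨hclasses, ?_⟩
  have hbij : ∀ r : Fin 8 → G, (∀ i, τ (r i) = i) → Function.Bijective fun j : Fin 10 =>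
      ConjClasses.mk (if j = 7 ∨ j = 9 then (r (typeIndex11 j))⁻¹ else r (typeIndex11 j)) :=
    fun r hr => conjClasses_bijective (hyinj r hr) hclasses.le
  have hcl' : ∀ r : Fin 8 → G, (∀ i, τ (r i) = i) → ∀ g,
      IsConj (r (τ g)) g ∨ ((τ g = 6 ∨ τ g = 7) ∧ IsConj (r (τ g))⁻¹ g) := by
    intro r hr g
    obtain ⟨j, hj⟩ := (hbij r hr).2 (ConjClasses.mk g)
    have hj' := ConjClasses.mk_eq_mk_iff_isConj.1 hj
    have hσ := hconj _ _ hj'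
    by_cases h7 : j = 7 ∨ j = 9
    · rw [if_pos h7] at hj' hσ
      rw [hinv, hr] at hσ
      rw [← hσ]
      refine Or.inr ⟨?_, hj'⟩
      clear hj hj' hσ
      revert j
      decide
    · rw [if_neg h7] at hj' hσ
      rw [hr] at hσ
      rw [← hσ]
      exact Or.inl hj'
  have hcl : ∀ r : Fin 8 → G, (∀ i, τ (r i) = i) → ∀ g,
      IsConj (r (τ g)) g ∨ IsConj (r (τ g))⁻¹ g := fun r hr g => (hcl' r hr g).imp_right And.right
  have hdclass : ∀ (χ ψ : Irr G) (g h), IsConj g h → (χ.1 - ψ.1) g = (χ.1 - ψ.1) h :=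
    fun χ ψ g h hgh => by
      rw [Pi.sub_apply, Pi.sub_apply, χ.apply_eq_of_isConj hgh, ψ.apply_eq_of_isConj hgh]
  have hθs : typeFun τ (rows11 2) = χ.1 + ψ.1 := by rw [hθ]; simp
  have hθs' : typeFun τ (rows11 4) = χ'.1 + ψ'.1 := by rw [hθ']; simp
  have hrow : ∀ a, a = 2 ∨ a = 4 ∨ norms11 a = 1 := by decide
  have horth₁ : ∀ a, charInner (χ.1 - ψ.1) (typeFun τ (rows11 a)) = 0 := by
    intro a
    rcases hrow a with rfl | rfl | ha
    · rw [hθs, charInner_sub_add]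
    · rw [hθs', charInner_add_right, charInner_sub_of_ne h11.symm h21.symm,
        charInner_sub_of_ne h12.symm h22.symm, add_zero]
    · rw [← hF₀ a ha]
      exact charInner_sub_of_ne (hχ a ha) (hψ a ha)
  have horth₂ : ∀ a, charInner (χ'.1 - ψ'.1) (typeFun τ (rows11 a)) = 0 := by
    intro a
    rcases hrow a with rfl | rfl | ha
    · rw [hθs, charInner_add_right, charInner_sub_of_ne h11 h12, charInner_sub_of_ne h21 h22,
        add_zero]
    · rw [hθs', charInner_sub_add]
    · rw [← hF₀ a ha]
      exact charInner_sub_of_ne (hχ' a ha) (hψ' a ha)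
  have hoddOf : ∀ χ ψ : Irr G, (∀ a, charInner (χ.1 - ψ.1) (typeFun τ (rows11 a)) = 0) →
      ∀ x, (χ.1 - ψ.1) x⁻¹ = -(χ.1 - ψ.1) x := by
    intro χ ψ horth x
    refine apply_inv_eq_neg_of_sum_type_eq_zero hinv (hdclass χ ψ) (fun g hg => ?_)
      (sum_type_eq_zero hinv horth _ ?_ (fun j => sum_rows11_mul_rows11 (τ x) j))
    · have hr := hcl (Function.update r₀ (τ x) x) (fun i => by
        by_cases hi : i = τ x
        · rw [hi, Function.update_self]
        · rw [Function.update_of_ne hi, hr₀]) g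
      rwa [hg, Function.update_self] at hr
    · generalize τ x = i
      revert i
      decide
  have hodd₁ := hoddOf χ ψ horth₁
  have hodd₂ := hoddOf χ' ψ' horth₂
  have hrealConj : ∀ g, τ g ≠ 6 → τ g ≠ 7 → IsConj g g⁻¹ := by
    intro g h6 h7
    have hx : ∀ h, τ h ≠ 6 → τ h ≠ 7 → IsConj (r₀ (τ h)) h := fun h h6 h7 =>
      (hcl' r₀ hr₀ h).resolve_right fun h' => h'.1.elim h6 h7
    refine (hx g h6 h7).symm.trans ?_
    have := hx g⁻¹ (by rwa [hinv]) (by rwa [hinv])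
    rwa [hinv] at this
  have hzero₁ : ∀ g, τ g ≠ 6 → τ g ≠ 7 → (χ.1 - ψ.1) g = 0 := fun g h6 h7 =>
    eq_zero_of_odd (hdclass χ ψ) hodd₁ (hrealConj g h6 h7)
  have hzero₂ : ∀ g, τ g ≠ 6 → τ g ≠ 7 → (χ'.1 - ψ'.1) g = 0 := fun g h6 h7 =>
    eq_zero_of_odd (hdclass χ' ψ') hodd₂ (hrealConj g h6 h7)
  have hsumOf : ∀ (d e : G → ℂ), (∀ g, τ g ≠ 6 → τ g ≠ 7 → d g = 0) →
      (∑ i, typeCard11 i * (-(d (r₀ i) * e (r₀ i)))) / (Nat.card G : ℂ) =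
        -(d (r₀ 6) * e (r₀ 6)) / 4 - 2 * (d (r₀ 7) * e (r₀ 7)) / 11 := by
    intro d e hd
    have h0 : ∀ i : Fin 8, i ≠ 6 → i ≠ 7 → d (r₀ i) = 0 := fun i h6 h7 =>
      hd _ (by rwa [hr₀]) (by rwa [hr₀])
    rw [Fin.sum_univ_eight, h0 0 (by decide) (by decide), h0 1 (by decide) (by decide),
      h0 2 (by decide) (by decide), h0 3 (by decide) (by decide), h0 4 (by decide) (by decide),
      h0 5 (by decide) (by decide), hcard, show typeCard11 6 = 1980 from rfl,
      show typeCard11 7 = 1440 from rfl]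
    push_cast
    ring
  have hn₁ := charInner_of_odd hN (hcl r₀ hr₀) (hdclass χ ψ) (hdclass χ ψ) hodd₁ hodd₁
  have hn₂ := charInner_of_odd hN (hcl r₀ hr₀) (hdclass χ' ψ') (hdclass χ' ψ') hodd₂ hodd₂
  have hn₁₂ := charInner_of_odd hN (hcl r₀ hr₀) (hdclass χ ψ) (hdclass χ' ψ') hodd₁ hodd₂
  rw [hsumOf _ _ hzero₁, charInner_sub_eq_two hne] at hn₁
  rw [hsumOf _ _ hzero₂, charInner_sub_eq_two hne'] at hn₂
  have hc0 : charInner (χ.1 - ψ.1) (χ'.1 - ψ'.1) = 0 := by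
    rw [← charForm_apply, map_sub, charForm_apply, charForm_apply,
      charInner_sub_of_ne h11.symm h21.symm, charInner_sub_of_ne h12.symm h22.symm, sub_zero]
  rw [hsumOf _ _ hzero₁, hc0] at hn₁₂
  -- The norm equations allow each difference to mix values on orders 8 and 11. Restricting χ to
  -- cyclic groups of these orders gives 104 + p² = 8 m and 110 + 5 q² / 2 = 11 n, where p and q are
  -- the imaginary parts of its difference.
  have hmul := mul_apply_inv_eq hinv (hcl r₀ hr₀) hθs hodd₁
  obtain ⟨m, hm⟩ := χ.exists_sum_zpowers_eq (r₀ 6)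
  obtain ⟨n, hn⟩ := χ.exists_sum_zpowers_eq (r₀ 7)
  have hp6 : ∀ (j : ℕ) {i : Fin 8}, 8 / Nat.gcd 8 j = orders11 i → τ (r₀ 6 ^ j) = i :=
    fun j i h => type_pow_eq hτ (r₀ 6) j (by rw [hr₀]; exact h)
  have hp7 : ∀ (j : ℕ) {i : Fin 8}, 11 / Nat.gcd 11 j = orders11 i → τ (r₀ 7 ^ j) = i :=
    fun j i h => type_pow_eq hτ (r₀ 7) j (by rw [hr₀]; exact h)
  have hz : ∀ i, i ≠ 6 → i ≠ 7 → (χ.1 - ψ.1) (r₀ i) = 0 := fun i h6 h7 =>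
    hzero₁ _ (by rwa [hr₀]) (by rwa [hr₀])
  simp only [hmul] at hm hn
  rw [orderOf_eq_orders11 hτ, hr₀, show orders11 6 = 8 from rfl] at hm
  rw [orderOf_eq_orders11 hτ, hr₀, show orders11 7 = 11 from rfl] at hn
  simp only [Finset.sum_range_succ, Finset.sum_range_zero, hp6 0 (i := 0) rfl, hp6 1 (i := 6) rfl,
    hp6 2 (i := 3) rfl, hp6 3 (i := 6) rfl, hp6 4 (i := 1) rfl, hp6 5 (i := 6) rfl,
    hp6 6 (i := 3) rfl, hp6 7 (i := 6) rfl, hz 0 (by decide) (by decide),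
    hz 1 (by decide) (by decide), hz 3 (by decide) (by decide), show rows11 2 0 = 20 from rfl,
    show rows11 2 6 = 0 from rfl, show rows11 2 3 = 0 from rfl, show rows11 2 1 = -4 from rfl] at hm
  simp only [Finset.sum_range_succ, Finset.sum_range_zero, hp7 0 (i := 0) rfl, hp7 1 (i := 7) rfl,
    hp7 2 (i := 7) rfl, hp7 3 (i := 7) rfl, hp7 4 (i := 7) rfl, hp7 5 (i := 7) rfl,
    hp7 6 (i := 7) rfl, hp7 7 (i := 7) rfl, hp7 8 (i := 7) rfl, hp7 9 (i := 7) rfl,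
    hp7 10 (i := 7) rfl, hz 0 (by decide) (by decide), show rows11 2 0 = 20 from rfl,
    show rows11 2 7 = -2 from rfl] at hn
  have hu₁ := eq_I_mul_im_of_odd (hodd₁ (r₀ 6))
  have hv₁ := eq_I_mul_im_of_odd (hodd₁ (r₀ 7))
  have hu₂ := eq_I_mul_im_of_odd (hodd₂ (r₀ 6))
  have hv₂ := eq_I_mul_im_of_odd (hodd₂ (r₀ 7))
  generalize ((χ.1 - ψ.1) (r₀ 6)).im = p at hu₁
  generalize ((χ.1 - ψ.1) (r₀ 7)).im = q at hv₁
  generalize ((χ'.1 - ψ'.1) (r₀ 6)).im = p' at hu₂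
  generalize ((χ'.1 - ψ'.1) (r₀ 7)).im = q' at hv₂
  rw [hu₁, hv₁] at hn₁
  rw [hu₂, hv₂] at hn₂
  rw [hu₁, hv₁, hu₂, hv₂] at hn₁₂
  rw [hu₁] at hm
  rw [hv₁] at hn
  have hI := Complex.I_sq
  obtain ⟨hp, hq, hp', hq'⟩ : p ^ 2 = 8 ∧ q = 0 ∧ p' = 0 ∧ q' ^ 2 = 11 := by
    refine differences_values (m := m) (n := n) ?_ ?_ ?_ ?_ ?_
    · have : ((p ^ 2 / 4 + 2 * q ^ 2 / 11 : ℝ) : ℂ) = (2 : ℝ) := by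
        push_cast
        linear_combination (p ^ 2 / 4 + 2 * q ^ 2 / 11 : ℂ) * hI - hn₁
      exact_mod_cast this
    · have : ((p' ^ 2 / 4 + 2 * q' ^ 2 / 11 : ℝ) : ℂ) = (2 : ℝ) := by
        push_cast
        linear_combination (p' ^ 2 / 4 + 2 * q' ^ 2 / 11 : ℂ) * hI - hn₂
      exact_mod_cast this
    · have : ((p * p' / 4 + 2 * (q * q') / 11 : ℝ) : ℂ) = (0 : ℝ) := by
        push_cast
        linear_combination (p * p' / 4 + 2 * (q * q') / 11 : ℂ) * hI - hn₁₂
      exact_mod_cast this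
    · have : ((104 + p ^ 2 : ℝ) : ℂ) = ((8 * m : ℝ) : ℂ) := by
        push_cast at hm ⊢
        linear_combination hm + (p ^ 2 : ℂ) * hI
      exact_mod_cast this
    · have : ((110 + 5 * q ^ 2 / 2 : ℝ) : ℂ) = ((11 * n : ℝ) : ℂ) := by
        push_cast at hn ⊢
        linear_combination hn + (5 * q ^ 2 / 2 : ℂ) * hI
      exact_mod_cast this
  have hu8 : (χ.1 - ψ.1) (r₀ 6) ^ 2 = -8 := by
    rw [hu₁, mul_pow, hI, ← Complex.ofReal_pow, hp]
    norm_num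
  have hv11 : (χ'.1 - ψ'.1) (r₀ 7) ^ 2 = -11 := by
    rw [hv₂, mul_pow, hI, ← Complex.ofReal_pow, hq']
    norm_num
  rw [hq, Complex.ofReal_zero, mul_zero] at hv₁
  rw [hp', Complex.ofReal_zero, mul_zero] at hu₂
  have hτ67 : ∀ i : Fin 8, i ≠ 6 → i ≠ 7 → ∀ g, τ g = i → (χ.1 - ψ.1) g = 0 ∧
      (χ'.1 - ψ'.1) g = 0 := fun i h6 h7 g hg =>
    ⟨hzero₁ g (by rwa [hg]) (by rwa [hg]), hzero₂ g (by rwa [hg]) (by rwa [hg])⟩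
  have hval₁ : ∀ g, τ g = 7 → (χ.1 - ψ.1) g = 0 := by
    intro g hg
    rcases hcl r₀ hr₀ g with h | h
    · rw [← hdclass χ ψ _ _ h, hg, hv₁]
    · rw [← hdclass χ ψ _ _ h, hodd₁, hg, hv₁, neg_zero]
  have hval₂ : ∀ g, τ g = 6 → (χ'.1 - ψ'.1) g = 0 := by
    intro g hg
    rcases hcl r₀ hr₀ g with h | h
    · rw [← hdclass χ' ψ' _ _ h, hg, hu₂]
    · rw [← hdclass χ' ψ' _ _ h, hodd₂, hg, hu₂, neg_zero]
  -- The two differences live on different types, so both signs can be normalised independently by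
  -- inverting representatives.
  obtain ⟨y, hy, hyδ⟩ : ∃ y, τ y = 6 ∧ (χ.1 - ψ.1) y = 2 * alpha2 := by
    rcases sq_eq_neg_eight hu8 with h | h
    · exact ⟨r₀ 6, hr₀ 6, h⟩
    · exact ⟨(r₀ 6)⁻¹, by rw [hinv, hr₀], by rw [hodd₁, h, neg_neg]⟩
  obtain ⟨x, hx, hxδ⟩ : ∃ x, τ x = 7 ∧
      (χ'.1 - ψ'.1) x = Complex.I * (Real.sqrt 11 : ℝ) := by
    rcases sq_eq_neg_eleven hv11 with h | h
    · exact ⟨r₀ 7, hr₀ 7, h⟩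
    · exact ⟨(r₀ 7)⁻¹, by rw [hinv, hr₀], by rw [hodd₂, h, neg_neg]⟩
  obtain ⟨r, hr, hr6, hr7⟩ : ∃ r : Fin 8 → G, (∀ i, τ (r i) = i) ∧ r 6 = y ∧ r 7 = x := by
    refine ⟨Function.update (Function.update r₀ 6 y) 7 x, fun i => ?_, ?_, ?_⟩
    · by_cases h7 : i = 7
      · rw [h7, Function.update_self, hx]
      · rw [Function.update_of_ne h7]
        by_cases h6 : i = 6
        · rw [h6, Function.update_self, hy]
        · rw [Function.update_of_ne h6, hr₀]
    · rw [Function.update_of_ne (by decide), Function.update_self]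
    · rw [Function.update_self]
  refine ⟨Equiv.ofBijective _ (hbij r hr), Equiv.ofBijective F hFbij, fun j g hg => ?_⟩
  have hg' := (ConjClasses.mk_eq_mk_iff_isConj.1 hg).symm
  have hτg : τ g = typeIndex11 j := by
    rw [← hconj _ _ hg']
    split_ifs
    · rw [hinv, hr]
    · rw [hr]
  have hδ₁ : (χ.1 - ψ.1) g = if j = 6 then 2 * alpha2 else
      if j = 7 then -(2 * alpha2) else 0 := by
    split_ifs with h6 h7
    · subst h6
      rw [← hyδ, ← hr6, ← hdclass χ ψ _ _ hg']
      rfl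
    · subst h7
      rw [← hyδ, ← hr6, ← hodd₁, ← hdclass χ ψ _ _ hg']
      rfl
    · by_cases h : typeIndex11 j = 7
      · exact hval₁ g (hτg.trans h)
      · refine (hτ67 _ ?_ h g hτg).1
        clear hg hg' hτg
        revert j
        decide
  have hδ₂ : (χ'.1 - ψ'.1) g = if j = 8 then Complex.I * (Real.sqrt 11 : ℝ) else
      if j = 9 then -(Complex.I * (Real.sqrt 11 : ℝ)) else 0 := by
    split_ifs with h8 h9
    · subst h8
      rw [← hxδ, ← hr7, ← hdclass χ' ψ' _ _ hg']
      rfl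
    · subst h9
      rw [← hxδ, ← hr7, ← hodd₂, ← hdclass χ' ψ' _ _ hg']
      rfl
    · by_cases h : typeIndex11 j = 6
      · exact hval₂ g (hτg.trans h)
      · refine (hτ67 _ h ?_ g hτg).2
        clear hg hg' hτg hδ₁
        revert j
        decide
  refine ⟨?_, fun i => ?_⟩
  · rw [cycleType_eq_filter_type (t := fun i => types11 (Fin.castLE (by norm_num) i)) hτ, hτg,
      cycleTypes11_eq]
  · change (F i).1 g = _
    obtain ⟨ht2, ht3⟩ := table11_pair_ten j
    obtain ⟨ht5, ht6⟩ := table11_pair_sixteen j rfl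
    have hs := congrFun hθs g
    have hs' := congrFun hθs' g
    rw [typeFun, hτg, Pi.add_apply] at hs hs'
    rw [← hδ₁, hs, Pi.sub_apply] at ht2 ht3
    rw [← hδ₂, hs', Pi.sub_apply] at ht5 ht6
    by_cases h2 : i = 2
    · rw [h2, hF2, ht2]; ring
    by_cases h3 : i = 3
    · rw [h3, hF3, ht3]; ring
    by_cases h5 : i = 5
    · rw [h5, hF5, ht5]; ring
    by_cases h6 : i = 6
    · rw [h6, hF6, ht6]; ring
    have hi : norms11 (rowIndex11 i) = 1 := by
      revert i
      decide
    rw [table11_eq_rows11 i hi, hF i hi, hF₀ _ hi, typeFun, hτg]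

/-! ### Non-real types and conclusion -/

theorem not_isConj_inv_of_type12 {G : Subgroup (Perm (Fin 12))} {τ : G → Fin 14}
    (hG : IsSharplyTransitive G (Fin 12) 5)
    (hτ : ∀ g : G, (g : Perm (Fin 12)).partition.parts = types12 (Fin.castLE (by norm_num) (τ g)))
    {x : G} (hx : τ x = 13) : ¬ IsConj x x⁻¹ := by
  have hord := orderOf_eq_lcm_type (t := fun i => types12 (Fin.castLE (by norm_num) i)) hτ
  have hfix := card_fixed_eq_count_type (t := fun i => types12 (Fin.castLE (by norm_num) i)) hτ
  refine hG.not_isConj_inv_of_orderOf_eq_eleven (by norm_num) (fun s hs => ?_)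
    (by rw [hord, hx]; decide +kernel) (by rw [hfix, hx]; decide +kernel)
  rw [hord] at hs
  rw [hfix]
  revert hs
  generalize τ s = i
  revert i
  decide +kernel

/-- There are 165 involutions, each with three fixed points, and 165 is the number of triples of
points. So an involution is determined by its fixed points, as the argument for order 8 requires. -/
theorem not_isConj_inv_of_type11 {G : Subgroup (Perm (Fin 11))} [Fintype G] {τ : G → Fin 8}
    (hG : IsSharplyTransitive G (Fin 11) 4)
    (hτ : ∀ g : G, (g : Perm (Fin 11)).partition.parts = types11 (Fin.castLE (by norm_num) (τ g)))
    (hN : ∀ i, Finset.card {g | τ g = i} = typeCard11 i) {x : G} (hx : τ x = 6 ∨ τ x = 7) :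
    ¬ IsConj x x⁻¹ := by
  have ht : ∀ i j : Fin 8, (types11 (Fin.castLE (by norm_num) i) : Multiset ℕ) =
      types11 (Fin.castLE (by norm_num) j) → i = j := by decide +kernel
  have hfix := card_fixed_eq_count_type (t := fun i => types11 (Fin.castLE (by norm_num) i)) hτ
  have htwo : ∀ s : G, orderOf s = 2 → τ s = 1 := fun s hs => type_eq_of_orderOf_eq hτ hs
  rcases hx with hx | hx
  · refine hG.not_isConj_inv_of_orderOf_eq_eight (fun s s' hs hs' h => ?_) (fun s hs => ?_)
      (by rw [orderOf_eq_orders11 hτ, hx]; rfl) (by rw [hfix, hx]; decide +kernel) ?_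
    · refine hG.eq_of_fixed_eq (m := 3) (C := {g | τ g = 1}) (by norm_num) (by norm_num)
        (by rw [hN]; decide +kernel) (fun g hg h => ?_) (fun g hg => ?_)
        (by simpa using htwo s hs) (by simpa using htwo s' hs') h
      · rw [Finset.mem_filter] at hg ⊢
        refine ⟨Finset.mem_univ _, ?_⟩
        rw [← hg.2]
        exact (type_eq_of_isConj (t := fun i => types11 (Fin.castLE (by norm_num) i)) hτ ht
          (isConj_iff.2 ⟨h, rfl⟩)).symm
      · rw [hfix, (Finset.mem_filter.1 hg).2]
        decide +kernel
    · rw [hfix, htwo s hs]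
      decide +kernel
    · have h3 : τ (x ^ 2) = 3 := type_pow_eq hτ x 2 (by rw [hx]; rfl)
      have := hfix (x ^ 2)
      rw [h3] at this
      exact this
  · refine hG.not_isConj_inv_of_orderOf_eq_eleven (by norm_num) (fun s hs => ?_)
      (by rw [orderOf_eq_orders11 hτ, hx]; rfl) (by rw [hfix, hx]; decide +kernel)
    rw [hfix, htwo s hs]
    decide +kernel

theorem theorem1p1 :
    (∀ G : Subgroup (Perm (Fin 12)), G ≤ alternatingGroup (Fin 12) →
      IsSharplyTransitive G (Fin 12) 5 →
        Nat.card (ConjClasses G) = 15 ∧ HasCharacterTable G cycleTypes12 table12) ∧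
    (∀ G : Subgroup (Perm (Fin 11)), G ≤ alternatingGroup (Fin 11) →
      IsSharplyTransitive G (Fin 11) 4 →
        Nat.card (ConjClasses G) = 10 ∧ HasCharacterTable G cycleTypes11 table11) := by
  refine ⟨fun G ha hG => ?_, fun G ha hG => ?_⟩
  · have : Fintype G := Fintype.ofFinite G
    obtain ⟨τ, hτ, hN⟩ := exists_type12 ha hG
    exact hasCharacterTable12 hτ hN (by rw [hG.card_eq (by norm_num)]; decide)
      fun x hx => not_isConj_inv_of_type12 hG hτ hx
  · have : Fintype G := Fintype.ofFinite G
    obtain ⟨τ, hτ, hN⟩ := exists_type11 ha hG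
    exact hasCharacterTable11 hτ hN (by rw [hG.card_eq (by norm_num)]; decide)
      fun x hx => not_isConj_inv_of_type11 hG hτ hN hx
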